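/- An instance of the two-machine flow shop with exact delays, $F2\mid \text{exact } l_j\in\{L_1,L_2\}\mid C_{\max}$, consists of nonnegative integers $L_1,L_2$ and of $n$ triples $(a_j,l_j,b_j)$ of nonnegative integers with $l_j\in\{L_1,L_2\}$, one for each job $j\in J=\{1,\dots,n\}$. Job $j$ has an operation of length $a_j$ on machine 1 and an operation of length $b_j$ on machine 2. A schedule assigns real starting times to all operations. It is feasible if the second operation of every job $j$ starts exactly $l_j$ time units after its first operation is completed and, of any two operations (possibly of length $0$) on the same machine, one is completed no later than the other starts. The length $C_{\max}(\sigma)$ of a schedule $\sigma$ is the time between the start of its first operation and the completion of its last operation ($0$ if there are no jobs); an optimal schedule is a feasible schedule of minimum length. Algorithm Concatenation: (1) Let $J_1=\{j\in J: l_j=L_1\}$ and $J_2=J\setminus J_1$ (so $J_2=\{j\in J:l_j=L_2\}$ if $L_1\neq L_2$). (2) Find optimal schedules $\sigma_1,\sigma_2$ of the instances formed by the jobs in $J_1$ and in $J_2$, respectively. (3) Output $\sigma=\sigma_1\oplus\sigma_2$, the schedule that executes $J_1$ according to $\sigma_1$ and then, just after the completion of the last operation of $\sigma_1$, starts executing $J_2$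 according to $\sigma_2$ translated in time. Theorem. Algorithm Concatenation can be implemented to run in time $O(n\log n)$: on a random access machine with unit-cost addition, subtraction and comparison of integers there is a program which, on every instance with $n$ jobs, outputs $\sigma_1\oplus\sigma_2$ for some optimal schedules $\sigma_1,\sigma_2$ of the two parts, after at most $T(n)$ steps, where $T(n)=O(n\log n)$. Moreover, for every choice of the optimal schedules $\sigma_1,\sigma_2$, the schedule $\sigma=\sigma_1\oplus\sigma_2$ is feasible, and $C_{\max}(\sigma)\le 2\,C_{\max}(\tau)$ for every feasible schedule $\tau$; that is, its length is within a factor of $2$ of the optimum. -/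

import Mathlib

namespace ExactDelay

/-! ### The two-machine flow shop with exact delays -/

/-- An instance with job set `ι`: job `j` has operations of lengths `a j` (machine 1) and
`b j` (machine 2), and the exact delay between them is `l j`. -/
structure Instance (ι : Type) where
  a : ι → ℕ
  l : ι → ℕ
  b : ι → ℕ

/-- A schedule: the starting times of the operations on machines 1 and 2.
Schedules may be placed anywhere on the time line. -/
structure Schedule (ι : Type) where
  start₁ : ι → ℝ
  start₂ : ι → ℝ

/-- Feasibility: the second operation of a job starts exactly `l j` time units after its first
operation is completed, and of any two operations on the same machine one is completed before
the other one starts (this includes operations of length zero). -/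
structure Instance.Feasible {ι : Type} (I : Instance ι) (σ : Schedule ι) : Prop where
  delay : ∀ j, σ.start₂ j = σ.start₁ j + I.a j + I.l j
  machine₁ : ∀ i j, i ≠ j →
    σ.start₁ i + I.a i ≤ σ.start₁ j ∨ σ.start₁ j + I.a j ≤ σ.start₁ i
  machine₂ : ∀ i j, i ≠ j →
    σ.start₂ i + I.b i ≤ σ.start₂ j ∨ σ.start₂ j + I.b j ≤ σ.start₂ i

noncomputable section

/-- The starting time of the first operation of a schedule (`0` if there are no jobs). -/
def Schedule.beginTime {ι : Type} (σ : Schedule ι) : ℝ := ⨅ j, σ.start₁ j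

/-- The completion time of the last operation of a schedule (`0` if there are no jobs). -/
def Instance.endTime {ι : Type} (I : Instance ι) (σ : Schedule ι) : ℝ :=
  ⨆ j, (σ.start₂ j + I.b j)

/-- The length (makespan) of a schedule: the time between the start of the first operation and
the completion of the last one. -/
def Instance.length {ι : Type} (I : Instance ι) (σ : Schedule ι) : ℝ :=
  I.endTime σ - σ.beginTime

/-- Optimal schedules: feasible ones of minimal length. -/
def Instance.Optimal {ι : Type} (I : Instance ι) (σ : Schedule ι) : Prop :=
  I.Feasible σ ∧ ∀ τ, I.Feasible τ → I.length σ ≤ I.length τ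

/-- The instance formed by the jobs that satisfy `P`. -/
def Instance.restrict {ι : Type} (I : Instance ι) (P : ι → Prop) : Instance {j // P j} where
  a j := I.a j
  l j := I.l j
  b j := I.b j

/-- The concatenation `σ₁ ⊕ σ₂` of schedules of the jobs in `P` and of the jobs outside `P`: the
former are executed according to `σ₁`; just after the completion of their last operation the
latter start being executed according to `σ₂`, translated in time. -/
def Instance.concat {ι : Type} (I : Instance ι) (P : ι → Prop) [DecidablePred P]
    (σ₁ : Schedule {j // P j}) (σ₂ : Schedule {j // ¬ P j}) : Schedule ι where
  start₁ j := if h : P j then σ₁.start₁ ⟨j, h⟩ else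
    σ₂.start₁ ⟨j, h⟩ + ((I.restrict P).endTime σ₁ - σ₂.beginTime)
  start₂ j := if h : P j then σ₁.start₂ ⟨j, h⟩ else
    σ₂.start₂ ⟨j, h⟩ + ((I.restrict P).endTime σ₁ - σ₂.beginTime)

/-- `σ` is a possible output of Algorithm Concatenation on an instance whose delays lie in
`{L₁, L₂}`: it is `σ₁ ⊕ σ₂` with `σ₁`, `σ₂` optimal schedules of the jobs of delay `L₁` and of the
remaining jobs, that is (for `L₁ ≠ L₂`) of the jobs of delay `L₂`. -/
def Instance.ConcatenationOutput {ι : Type} (I : Instance ι) (L₁ : ℕ) (σ : Schedule ι) : Prop :=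
  ∃ (σ₁ : Schedule {j // I.l j = L₁}) (σ₂ : Schedule {j // ¬ I.l j = L₁}),
    (I.restrict fun j => I.l j = L₁).Optimal σ₁ ∧
    (I.restrict fun j => ¬ I.l j = L₁).Optimal σ₂ ∧
    σ = I.concat (fun j => I.l j = L₁) σ₁ σ₂

end

/-! ### A random access machine with unit-cost addition, subtraction and comparison

Programs are finite; they use integer variables and integer arrays whose names are fixed in the
program text, while array cells are addressed by computed values. -/

/-- A memory state: the values of the variables, and the cells of the arrays. -/
structure State where
  var : ℕ → ℤ
  arr : ℕ → ℤ → ℤ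

/-- Expressions: constants, variables, array cells, sums and differences. -/
inductive Expr where
  | const (c : ℤ)
  | var (x : ℕ)
  | get (A : ℕ) (i : Expr)
  | add (e f : Expr)
  | sub (e f : Expr)

def Expr.eval (s : State) : Expr → ℤ
  | .const c => c
  | .var x => s.var x
  | .get A i => s.arr A (i.eval s)
  | .add e f => e.eval s + f.eval s
  | .sub e f => e.eval s - f.eval s

/-- The number of steps that the evaluation takes: one for every node of the expression. -/
def Expr.cost : Expr → ℕ
  | .const _ => 1
  | .var _ => 1
  | .get _ i => i.cost + 1
  | .add e f => e.cost + f.cost + 1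
  | .sub e f => e.cost + f.cost + 1

/-- Tests: Boolean combinations of comparisons. -/
inductive Test where
  | le (e f : Expr)
  | not (t : Test)
  | and (t u : Test)

def Test.Holds (s : State) : Test → Prop
  | .le e f => e.eval s ≤ f.eval s
  | .not t => ¬ t.Holds s
  | .and t u => t.Holds s ∧ u.Holds s

def Test.cost : Test → ℕ
  | .le e f => e.cost + f.cost + 1
  | .not t => t.cost + 1
  | .and t u => t.cost + u.cost + 1

/-- Programs. -/
inductive Cmd where
  | skip
  | assign (x : ℕ) (e : Expr)
  | store (A : ℕ) (i e : Expr)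
  | seq (c d : Cmd)
  | cond (t : Test) (c d : Cmd)
  | loop (t : Test) (c : Cmd)

def State.setVar (s : State) (x : ℕ) (v : ℤ) : State :=
  { s with var := Function.update s.var x v }

def State.setArr (s : State) (A : ℕ) (i v : ℤ) : State :=
  { s with arr := Function.update s.arr A (Function.update (s.arr A) i v) }

/-- `Exec c s k s'`: program `c`, started in state `s`, halts after exactly `k` steps in state
`s'`. -/
inductive Exec : Cmd → State → ℕ → State → Prop where
  | skip (s : State) : Exec .skip s 1 s
  | assign (s : State) (x : ℕ) (e : Expr) :
      Exec (.assign x e) s (e.cost + 1) (s.setVar x (e.eval s))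
  | store (s : State) (A : ℕ) (i e : Expr) :
      Exec (.store A i e) s (i.cost + e.cost + 1) (s.setArr A (i.eval s) (e.eval s))
  | seq {c d : Cmd} {s s' s'' : State} {k m : ℕ} :
      Exec c s k s' → Exec d s' m s'' → Exec (.seq c d) s (k + m) s''
  | condTrue {t : Test} {c d : Cmd} {s s' : State} {k : ℕ} :
      t.Holds s → Exec c s k s' → Exec (.cond t c d) s (t.cost + 1 + k) s'
  | condFalse {t : Test} {c d : Cmd} {s s' : State} {k : ℕ} :
      ¬ t.Holds s → Exec d s k s' → Exec (.cond t c d) s (t.cost + 1 + k) s'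
  | loopFalse {t : Test} {c : Cmd} {s : State} :
      ¬ t.Holds s → Exec (.loop t c) s (t.cost + 1) s
  | loopTrue {t : Test} {c : Cmd} {s s' s'' : State} {k m : ℕ} :
      t.Holds s → Exec c s k s' → Exec (.loop t c) s' m s'' →
      Exec (.loop t c) s (t.cost + 1 + k + m) s''

/-- An array that holds `f 0, …, f (n - 1)` in the cells `0, …, n - 1`, and `0` elsewhere. -/
def arrayOf {n : ℕ} (f : Fin n → ℕ) (i : ℤ) : ℤ :=
  if h : 0 ≤ i ∧ i.toNat < n then f ⟨i.toNat, h.2⟩ else 0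

/-- The input state of an instance with `n` jobs: variables `0, 1, 2` hold `n, L₁, L₂`, arrays
`0, 1, 2` hold the numbers `a j`, `l j`, `b j`; everything else is zero. -/
def Instance.input {n : ℕ} (I : Instance (Fin n)) (L₁ L₂ : ℕ) : State where
  var
    | 0 => n
    | 1 => L₁
    | 2 => L₂
    | _ => 0
  arr
    | 0 => arrayOf I.a
    | 1 => arrayOf I.l
    | 2 => arrayOf I.b
    | _ => fun _ => 0

/-- The schedule of `n` jobs found in a final state: array `3` holds the starting times on
machine 1 and array `4` those on machine 2. -/
def State.output (s : State) (n : ℕ) : Schedule (Fin n) where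
  start₁ j := (s.arr 3 (j : ℕ) : ℝ)
  start₂ j := (s.arr 4 (j : ℕ) : ℝ)

end ExactDelay

/-! The factor 2 is the easy half. A feasible schedule restricted to the jobs of one delay is
feasible and no longer, so each optimal part is at most as long as any schedule `τ` of all jobs, and
the concatenation is no longer than its two parts together (`length_concat_le`,
`concatenationOutput_approx`).

The running time is the substance. If all delays equal `L`, shifting machine 2 back by `L` gives the
two-machine no-wait flow shop, which is the travelling salesman problem of Gilmore and Gomory. With
a dummy node `0` of zero lengths, passing from node `x` to node `y` takes time `max (b x) (a y)`,
and for at least one job the minimal length is `L` plus the minimal cost of a cyclic tour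
(`exists_tour_of_feasible`, `optimal_of_tour`).

Let `P` sort the nodes by `b` and `Q` by `a`. Sending `P r` to `Q r` is a cheapest assignment, but
it may have several cycles. Interchanging the images at the positions `k` and `k + 1` costs `gapAt`,
the overlap of the interval between the two `a`-values with the one between the two `b`-values, and
joins two cycles if the nodes lie in different ones. Lower bound: by linear programming duality an
assignment costs at least the cheapest one plus the gaps that it crosses (`sum_add_gaps_le`). The
gaps crossed by a tour connect all cycles (`conn_crossed`), so they weigh at least as much as the
tree found by the greedy algorithm (`IsGreedy.sum_le`). Upper bound: in a suitable order the
interchanges of that tree cost no more than the sum of their gaps (`Interchanged.step`), namely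
those with `b ≤ a` at the lower position from top to bottom, then the others from bottom to top. The
bounds meet in `tour_optimal`.

The program consists of three merge sorts, union-find by size and linear passes for each of the two
delays. `Runs` expresses total correctness with a bound on the number of steps. The second part is
scheduled from the completion time of the first, so that the output is the concatenation itself
(`concatenation_spec`). -/

namespace ExactDelay

/-! ### Reasoning about programs -/

/-- Program `c`, started in `s`, halts after at most `k` steps in a state that satisfies `Q`. -/
def Runs (c : Cmd) (k : ℕ) (s : State) (Q : State → Prop) : Prop :=
  ∃ i t, Exec c s i t ∧ i ≤ k ∧ Q t

/-- The variables that a program may change. -/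
def Cmd.vars : Cmd → List ℕ
  | .skip => []
  | .assign x _ => [x]
  | .store _ _ _ => []
  | .seq c d => c.vars ++ d.vars
  | .cond _ c d => c.vars ++ d.vars
  | .loop _ c => c.vars

/-- The arrays that a program may change. -/
def Cmd.arrs : Cmd → List ℕ
  | .skip => []
  | .assign _ _ => []
  | .store A _ _ => [A]
  | .seq c d => c.arrs ++ d.arrs
  | .cond _ c d => c.arrs ++ d.arrs
  | .loop _ c => c.arrs

/-- The states `s` and `s'` differ at most in what `c` may change. -/
structure Frame (c : Cmd) (s s' : State) : Prop where
  var : ∀ x, x ∉ c.vars → s'.var x = s.var x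
  arr : ∀ A, A ∉ c.arrs → s'.arr A = s.arr A

theorem Frame.refl (c : Cmd) (s : State) : Frame c s s := ⟨fun _ _ => rfl, fun _ _ => rfl⟩

theorem Frame.trans {c : Cmd} {s s' s'' : State} (h : Frame c s s') (h' : Frame c s' s'') :
    Frame c s s'' :=
  ⟨fun x hx => (h'.var x hx).trans (h.var x hx), fun A hA => (h'.arr A hA).trans (h.arr A hA)⟩

theorem Frame.mono {c d : Cmd} {s s' : State} (h : Frame c s s') (hv : c.vars ⊆ d.vars)
    (ha : c.arrs ⊆ d.arrs) : Frame d s s' :=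
  ⟨fun x hx => h.var x fun h' => hx (hv h'), fun A hA => h.arr A fun h' => hA (ha h')⟩

@[simp] theorem State.setVar_var (s : State) (x y : ℕ) (v : ℤ) :
    (s.setVar x v).var y = if y = x then v else s.var y := by
  simp [State.setVar, Function.update_apply]

@[simp] theorem State.setVar_arr (s : State) (x : ℕ) (v : ℤ) :
    (s.setVar x v).arr = s.arr := rfl

@[simp] theorem State.setArr_var (s : State) (A : ℕ) (i v : ℤ) :
    (s.setArr A i v).var = s.var := rfl

@[simp] theorem State.setArr_arr (s : State) (A B : ℕ) (i v : ℤ) :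
    (s.setArr A i v).arr B = if B = A then Function.update (s.arr A) i v else s.arr B := by
  by_cases h : B = A
  · subst h; simp [State.setArr]
  · simp [State.setArr, h]

/-- Facts about memory that a program does not write to survive its execution. What it writes to can
be read off its text, so `decide` or `simp` carries such facts from stage to stage. -/
theorem Exec.frame {c : Cmd} {s s' : State} {k : ℕ} (h : Exec c s k s') : Frame c s s' := by
  induction h with
  | skip s => exact Frame.refl _ _
  | assign s x e => exact ⟨fun y hy => by simp_all [Cmd.vars], fun _ _ => rfl⟩
  | store s A i e => exact ⟨fun _ _ => rfl, fun B hB => by simp_all [Cmd.arrs]⟩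
  | seq _ _ ih ih' =>
    exact (ih.mono (by simp [Cmd.vars]) (by simp [Cmd.arrs])).trans
      (ih'.mono (by simp [Cmd.vars]) (by simp [Cmd.arrs]))
  | condTrue _ _ ih => exact ih.mono (by simp [Cmd.vars]) (by simp [Cmd.arrs])
  | condFalse _ _ ih => exact ih.mono (by simp [Cmd.vars]) (by simp [Cmd.arrs])
  | loopFalse _ => exact Frame.refl _ _
  | loopTrue _ _ _ ih ih' =>
    exact (ih.mono (by simp [Cmd.vars]) (by simp [Cmd.arrs])).trans ih'

theorem Runs.mono {c : Cmd} {k k' : ℕ} {s : State} {Q Q' : State → Prop} (h : Runs c k s Q)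
    (hk : k ≤ k') (hQ : ∀ s', Frame c s s' → Q s' → Q' s') : Runs c k' s Q' := by
  obtain ⟨m, s', he, hm, hq⟩ := h
  exact ⟨m, s', he, hm.trans hk, hQ s' he.frame hq⟩

theorem Runs.seq {c d : Cmd} {k m : ℕ} {s : State} {R Q : State → Prop}
    (h : Runs c k s R) (h' : ∀ s', Frame c s s' → R s' → Runs d m s' Q) :
    Runs (.seq c d) (k + m) s Q := by
  obtain ⟨k₁, s₁, he, hk, hr⟩ := h
  obtain ⟨k₂, s₂, he', hk', hq⟩ := h' s₁ he.frame hr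
  exact ⟨_, s₂, he.seq he', by omega, hq⟩

/-- Weakest precondition of a loop-free program. -/
def Cmd.wp : Cmd → (State → Prop) → State → Prop
  | .skip, Q, s => Q s
  | .assign x e, Q, s => Q (s.setVar x (e.eval s))
  | .store A i e, Q, s => Q (s.setArr A (i.eval s) (e.eval s))
  | .seq c d, Q, s => c.wp (d.wp Q) s
  | .cond t c d, Q, s => (t.Holds s → c.wp Q s) ∧ (¬ t.Holds s → d.wp Q s)
  | .loop _ _, _, _ => False

/-- A bound for the number of steps of a loop-free program. -/
def Cmd.bound : Cmd → ℕ
  | .skip => 1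
  | .assign _ e => e.cost + 1
  | .store _ i e => i.cost + e.cost + 1
  | .seq c d => c.bound + d.bound
  -- The sum of both branches replaces their maximum, since constant factors do not matter.
  | .cond t c d => t.cost + 1 + c.bound + d.bound
  | .loop _ _ => 0

theorem Runs.of_wp {c : Cmd} : ∀ {s : State} {Q : State → Prop}, c.wp Q s →
    Runs c c.bound s Q := by
  induction c with
  | skip => exact fun h => ⟨_, _, .skip _, le_rfl, h⟩
  | assign x e => exact fun h => ⟨_, _, .assign _ _ _, le_rfl, h⟩
  | store A i e => exact fun h => ⟨_, _, .store _ _ _ _, le_rfl, h⟩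
  | seq c d ihc ihd => exact fun h => (ihc h).seq fun s' _ h' => ihd h'
  | cond t c d ihc ihd =>
    intro s Q h
    by_cases ht : t.Holds s
    · obtain ⟨k, s', he, hk, hq⟩ := ihc (h.1 ht)
      exact ⟨_, s', .condTrue ht he, by simp only [Cmd.bound]; omega, hq⟩
    · obtain ⟨k, s', he, hk, hq⟩ := ihd (h.2 ht)
      exact ⟨_, s', .condFalse ht he, by simp only [Cmd.bound]; omega, hq⟩
  | loop t c _ => exact fun h => h.elim

/-- A loop whose body is executed at most `B` times. -/
theorem Runs.loop {t : Test} {c : Cmd} {B K : ℕ} {s : State} {Inv : ℕ → State → Prop}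
    (h0 : Inv 0 s)
    (hstep : ∀ i s', Frame c s s' → Inv i s' → t.Holds s' → i < B ∧ Runs c K s' (Inv (i + 1))) :
    Runs (.loop t c) ((K + t.cost + 1) * B + t.cost + 1) s
      (fun s' => ∃ i, Inv i s' ∧ ¬ t.Holds s') := by
  -- Here `d` is the number of iterations still allowed.
  suffices H : ∀ d i s', i + d = B → Frame c s s' → Inv i s' →
      Runs (.loop t c) ((K + t.cost + 1) * d + t.cost + 1) s'
        (fun s' => ∃ i, Inv i s' ∧ ¬ t.Holds s') from H B 0 s (by omega) (Frame.refl _ _) h0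
  intro d
  induction d with
  | zero =>
    intro i s' hi hf hI
    by_cases ht : t.Holds s'
    · have := (hstep i s' hf hI ht).1
      omega
    · exact ⟨_, s', .loopFalse ht, by omega, i, hI, ht⟩
  | succ d ih =>
    intro i s' hi hf hI
    by_cases ht : t.Holds s'
    · obtain ⟨k₁, s₁, he, hk, hI'⟩ := (hstep i s' hf hI ht).2
      obtain ⟨k₂, s₂, he', hk', hq⟩ := ih (i + 1) s₁ (by omega) (hf.trans he.frame) hI'
      exact ⟨_, s₂, .loopTrue ht he he', by rw [Nat.mul_succ]; omega, hq⟩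
    · exact ⟨_, s', .loopFalse ht, by rw [Nat.mul_succ]; omega, i, hI, ht⟩

/-- `e < f`. -/
def Test.lt (e f : Expr) : Test := .not (.le f e)

@[simp] theorem Test.lt_holds (e f : Expr) (s : State) :
    (Test.lt e f).Holds s ↔ e.eval s < f.eval s := by
  simp [Test.lt, Test.Holds]

/-- Execute `c` with the values `0, 1, …` of the variable `x` below the value of `y`. -/
def Cmd.forUp (x y : ℕ) (c : Cmd) : Cmd :=
  .seq (.assign x (.const 0))
    (.loop (.lt (.var x) (.var y)) (.seq c (.assign x (.add (.var x) (.const 1)))))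

theorem Cmd.vars_forUp (x y : ℕ) (c : Cmd) : (Cmd.forUp x y c).vars = x :: (c.vars ++ [x]) := rfl

theorem Cmd.arrs_forUp (x y : ℕ) (c : Cmd) : (Cmd.forUp x y c).arrs = c.arrs := by
  simp [Cmd.forUp, Cmd.arrs]

/-- The invariant for `i + 1` refers to the state after the increment, as it may read the counter.
Besides the body, an iteration costs 4 steps for the test, 1 for branching and 4 for the increment;
initialisation and the final failing test cost 7. -/
theorem Runs.forUp {x y : ℕ} {c : Cmd} {N K : ℕ} {s : State} {Inv : ℕ → State → Prop}
    (hN : s.var y = N) (hx : x ∉ c.vars) (hy : y ≠ x ∧ y ∉ c.vars)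
    (h0 : Inv 0 (s.setVar x 0))
    (hstep : ∀ (i : ℕ) (s' : State), i < N → s'.var x = i → Frame (.forUp x y c) s s' → Inv i s' →
      Runs c K s' (fun s'' => Inv (i + 1) (s''.setVar x (i + 1)))) :
    Runs (.forUp x y c) ((K + 9) * N + 7) s (Inv N) := by
  have hl : Runs (.loop (.lt (.var x) (.var y)) (.seq c (.assign x (.add (.var x) (.const 1)))))
      ((K + 4 + 4 + 1) * N + 4 + 1) (s.setVar x 0)
      (fun s' => ∃ i, (Inv i s' ∧ s'.var x = (i : ℕ) ∧ s'.var y = (N : ℕ) ∧ i ≤ N) ∧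
        ¬ (Test.lt (.var x) (.var y)).Holds s') := by
    refine Runs.loop (Inv := fun i s' => Inv i s' ∧ s'.var x = i ∧ s'.var y = N ∧ i ≤ N)
      ⟨h0, by simp, by simp [hy.1, hN], by omega⟩ ?_
    rintro i s' hf ⟨hI, hxi, hyN, hi⟩ ht
    have ht' : i < N := by
      simp only [Test.lt_holds, Expr.eval, hxi, hyN] at ht
      exact_mod_cast ht
    refine ⟨ht', ?_⟩
    have hf' : Frame (.forUp x y c) s s' := by
      refine Frame.trans (s' := s.setVar x 0) ⟨fun z hz => ?_, fun A hA => rfl⟩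
        (hf.mono ?_ ?_)
      · have : z ≠ x := by rintro rfl; exact hz (by simp [Cmd.vars_forUp])
        simp [this]
      · simp [Cmd.vars, Cmd.vars_forUp]
      · simp [Cmd.arrs, Cmd.arrs_forUp]
    refine (hstep i s' ht' hxi hf' hI).seq fun s₁ hf₁ hI₁ => ?_
    refine Runs.mono (Runs.of_wp (c := .assign x (.add (.var x) (.const 1)))
      (Q := fun s'' => Inv (i + 1) s'' ∧ s''.var x = (i + 1 : ℕ) ∧ s''.var y = N ∧ i + 1 ≤ N) ?_)
      (by simp [Cmd.bound, Expr.cost]) (fun s' _ h => h)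
    have h1 : s₁.var x = i := (hf₁.var x hx).trans hxi
    have h2 : s₁.var y = N := (hf₁.var y hy.2).trans hyN
    simp only [Cmd.wp, Expr.eval, h1]
    exact ⟨hI₁, by simp, by simp [hy.1, h2], ht'⟩
  refine Runs.mono (Runs.seq (Runs.of_wp (c := .assign x (.const 0)) (Q := fun s' =>
    s' = s.setVar x 0) rfl) (m := (K + 4 + 4 + 1) * N + 4 + 1) fun s' _ h => h ▸ hl) ?_ ?_
  · simp only [Cmd.bound, Expr.cost]
    apply le_of_eq; ring
  · rintro s' _ ⟨i, ⟨hI, hxi, hyN, hi⟩, ht⟩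
    simp only [Test.lt_holds, Expr.eval, hxi, hyN] at ht
    have : i = N := by omega
    exact this ▸ hI

end ExactDelay

namespace ExactDelay

/-! ### Connectivity and minimum spanning trees -/

section Linked

variable {V κ : Type*}

/-- The equivalence relation generated by a set of edges. -/
def linked (E : Set (V × V)) : Setoid V := Relation.EqvGen.setoid fun x y => (x, y) ∈ E

theorem linked_of_mem {E : Set (V × V)} {x y : V} (h : (x, y) ∈ E) : linked E x y :=
  Relation.EqvGen.rel _ _ h

theorem linked_le {E : Set (V × V)} {r : Setoid V} (h : ∀ p ∈ E, r p.1 p.2) {x y : V}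
    (hxy : linked E x y) : r x y := by
  induction hxy with
  | rel x y h' => exact h _ h'
  | refl x => exact r.refl' x
  | symm x y _ ih => exact r.symm' ih
  | trans x y z _ _ ih ih' => exact r.trans' ih ih'

theorem linked_mono {E F : Set (V × V)} (h : E ⊆ F) {x y : V} (hxy : linked E x y) :
    linked F x y :=
  linked_le (r := linked F) (fun _ hp => linked_of_mem (h hp)) hxy

/-- The relation obtained from `r` by merging the classes of `u` and `v`. -/
def mergeClasses (r : Setoid V) (u v : V) : Setoid V where
  r x y := r x y ∨ (r x u ∧ r v y) ∨ (r x v ∧ r u y)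
  iseqv :=
    { refl := fun x => Or.inl (r.refl' x)
      symm := by
        rintro x y (h | ⟨h, h'⟩ | ⟨h, h'⟩)
        · exact Or.inl (r.symm' h)
        · exact Or.inr (Or.inr ⟨r.symm' h', r.symm' h⟩)
        · exact Or.inr (Or.inl ⟨r.symm' h', r.symm' h⟩)
      trans := by
        rintro x y z (h | ⟨h, h'⟩ | ⟨h, h'⟩) (g | ⟨g, g'⟩ | ⟨g, g'⟩)
        · exact Or.inl (r.trans' h g)
        · exact Or.inr (Or.inl ⟨r.trans' h g, g'⟩)
        · exact Or.inr (Or.inr ⟨r.trans' h g, g'⟩)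
        · exact Or.inr (Or.inl ⟨h, r.trans' h' g⟩)
        · exact Or.inr (Or.inl ⟨h, g'⟩)
        · exact Or.inl (r.trans' h g')
        · exact Or.inr (Or.inr ⟨h, r.trans' h' g⟩)
        · exact Or.inl (r.trans' h g')
        · exact Or.inr (Or.inr ⟨h, g'⟩) }

/-- One new edge merges at most two classes. Both the exchange argument for spanning trees and the
correctness of union-find rest on this formula. -/
theorem linked_insert {E : Set (V × V)} {u v x y : V} :
    linked (insert (u, v) E) x y ↔ mergeClasses (linked E) u v x y := by
  constructor
  · refine linked_le ?_
    rintro p (rfl | hp)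
    · exact Or.inr (Or.inl ⟨(linked E).refl' _, (linked E).refl' _⟩)
    · exact Or.inl (linked_of_mem hp)
  · have huv : linked (insert (u, v) E) u v := linked_of_mem (Set.mem_insert _ _)
    have hm : ∀ {x y}, linked E x y → linked (insert (u, v) E) x y :=
      linked_mono (Set.subset_insert _ _)
    rintro (h | ⟨h, g⟩ | ⟨h, g⟩)
    · exact hm h
    · exact Setoid.trans' _ (hm h) (Setoid.trans' _ huv (hm g))
    · exact Setoid.trans' _ (hm h) (Setoid.trans' _ (Setoid.symm' _ huv) (hm g))

/-- Connectivity by the edges in `E` and the edges `e k` with `k ∈ K`. -/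
def conn (E : Set (V × V)) (e : κ → V × V) (K : Set κ) : Setoid V := linked (E ∪ e '' K)

variable {E : Set (V × V)} {e : κ → V × V}

theorem conn_mono {K L : Set κ} (h : K ⊆ L) {x y : V} (hxy : conn E e K x y) : conn E e L x y :=
  linked_mono (Set.union_subset_union_right _ (Set.image_mono h)) hxy

theorem conn_base {K : Set κ} {x y : V} (h : (x, y) ∈ E) : conn E e K x y :=
  linked_of_mem (Or.inl h)

theorem conn_edge {K : Set κ} {k : κ} (h : k ∈ K) : conn E e K (e k).1 (e k).2 :=
  linked_of_mem (Or.inr ⟨k, h, rfl⟩)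

theorem conn_le {K L : Set κ} (h : ∀ k ∈ K, conn E e L (e k).1 (e k).2) {x y : V}
    (hxy : conn E e K x y) : conn E e L x y := by
  refine linked_le (r := conn E e L) ?_ hxy
  rintro p (hp | ⟨k, hk, rfl⟩)
  · exact conn_base hp
  · exact h k hk

theorem conn_insert {K : Set κ} {k : κ} {x y : V} :
    conn E e (insert k K) x y ↔ mergeClasses (conn E e K) (e k).1 (e k).2 x y := by
  rw [conn, Set.image_insert_eq, Set.union_insert]
  exact linked_insert

/-- `T` is the outcome of the greedy algorithm that considers the edges in the order of `pos`. -/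
def IsGreedy (E : Set (V × V)) (e : κ → V × V) (pos : κ → ℕ) (T : Finset κ) : Prop :=
  ∀ k, k ∈ T ↔ ¬ conn E e {k' | pos k' < pos k} (e k).1 (e k).2

variable {pos : κ → ℕ} {T : Finset κ}

/-- A rejected edge has ends that earlier edges already connect, so by induction dropping the
rejected edges loses no connectivity. This is why `IsGreedy` may refer to all earlier edges and not
only to the chosen ones. -/
theorem IsGreedy.conn_iff (hT : IsGreedy E e pos T) (j : ℕ) {x y : V} :
    conn E e {k | k ∈ T ∧ pos k < j} x y ↔ conn E e {k | pos k < j} x y := by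
  refine ⟨conn_mono fun k hk => hk.2, ?_⟩
  induction j generalizing x y with
  | zero => exact conn_le fun k hk => absurd hk (Nat.not_lt_zero _)
  | succ j ih =>
    refine conn_le fun k hk => ?_
    by_cases hkT : k ∈ T
    · exact conn_edge ⟨hkT, hk⟩
    · rw [hT k, not_not] at hkT
      have hk' : pos k < j + 1 := hk
      exact conn_mono (L := {k | k ∈ T ∧ pos k < j + 1})
        (fun k' (h' : k' ∈ T ∧ pos k' < j) => ⟨h'.1, by have := h'.2; omega⟩)
        (ih (conn_mono (fun k' (h' : pos k' < pos k) => show pos k' < j by omega) hkT))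

/-- In a cycle of chosen edges the last one would have been rejected. The induction on `j` discards
chosen edges from the top, until only edges before `k` are left. -/
theorem IsGreedy.independent (hT : IsGreedy E e pos T) (hpos : Function.Injective pos) {k : κ}
    (hk : k ∈ T) : ¬ conn E e {k' | k' ∈ T ∧ k' ≠ k} (e k).1 (e k).2 := by
  suffices H : ∀ j, ¬ conn E e {k' | k' ∈ T ∧ pos k' < j ∧ k' ≠ k} (e k).1 (e k).2 by
    intro h
    refine H ((T.sup pos) + 1) (conn_mono ?_ h)
    rintro k' ⟨h1, h2⟩
    exact ⟨h1, Nat.lt_succ_of_le (Finset.le_sup h1), h2⟩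
  intro j
  induction j with
  | zero =>
    refine fun h => (hT k).1 hk (conn_mono ?_ h)
    rintro k' ⟨_, h, _⟩
    exact absurd h (Nat.not_lt_zero _)
  | succ j ih =>
    intro h
    by_cases hj : j ≤ pos k
    · refine (hT k).1 hk (conn_mono ?_ h)
      rintro k' ⟨_, h1, h2⟩
      have : pos k' ≠ pos k := fun h' => h2 (hpos h')
      show pos k' < pos k
      omega
    by_cases he : ∃ f ∈ T, pos f = j
    · obtain ⟨f, hfT, hfj⟩ := he
      have h' : conn E e (insert f {k' | k' ∈ T ∧ pos k' < j ∧ k' ≠ k}) (e k).1 (e k).2 := by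
        refine conn_mono ?_ h
        rintro k' ⟨h0, h1, h2⟩
        by_cases hk' : pos k' = j
        · exact Or.inl (hpos (hk'.trans hfj.symm))
        · exact Or.inr ⟨h0, by omega, h2⟩
      have hsub : ∀ {x y}, conn E e {k' | k' ∈ T ∧ pos k' < j ∧ k' ≠ k} x y →
          conn E e {k' | pos k' < pos f} x y :=
        fun h => conn_mono
          (fun k' hk' => by have := hk'.2.1; simp only [Set.mem_ofPred_eq]; omega) h
      have hke : conn E e {k' | pos k' < pos f} (e k).1 (e k).2 :=
        conn_edge (by simp only [Set.mem_ofPred_eq]; omega)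
      -- If the last edge `f` were needed, its ends would be connected by `k` and other edges before
      -- `f`, so `f` would not have been chosen.
      rcases conn_insert.1 h' with h1 | ⟨h1, h2⟩ | ⟨h1, h2⟩
      · exact ih h1
      · exact (hT f).1 hfT (Setoid.trans' _ (Setoid.symm' _ (hsub h1))
          (Setoid.trans' _ hke (Setoid.symm' _ (hsub h2))))
      · exact (hT f).1 hfT (Setoid.trans' _ (hsub h2)
          (Setoid.trans' _ (Setoid.symm' _ hke) (hsub h1)))
    · refine ih (conn_mono ?_ h)
      rintro k' ⟨h0, h1, h2⟩
      have : pos k' ≠ j := fun h' => he ⟨k', h0, h'⟩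
      exact ⟨h0, by omega, h2⟩

/-- Add the edges of `F` to `X` one at a time. The edge `f` at which `x` and `y` become connected
lies on a path between them, so the pair `(x, y)` can take its place. -/
theorem exists_exchange [DecidableEq κ] {X : Set κ} {x y : V} (hX : ¬ conn E e X x y)
    (F : Finset κ) (hF : conn E e (X ∪ F) x y) :
    ∃ f ∈ F, f ∉ X ∧
      mergeClasses (conn E e (X ∪ (F.erase f : Finset κ))) x y (e f).1 (e f).2 := by
  induction F using Finset.induction_on with
  | empty => exact absurd (conn_mono (by simp) hF) hX
  | insert f F hf ih =>
    by_cases h : conn E e (X ∪ F) x y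
    · obtain ⟨g, hg, hgX, hm⟩ := ih h
      have hs : ∀ {x y}, conn E e (X ∪ (F.erase g : Finset κ)) x y →
          conn E e (X ∪ ((insert f F).erase g : Finset κ)) x y := fun h =>
        conn_mono (Set.union_subset_union_right _ (by
          exact_mod_cast Finset.erase_subset_erase g (Finset.subset_insert f F))) h
      refine ⟨g, Finset.mem_insert_of_mem hg, hgX, ?_⟩
      exact hm.imp hs (Or.imp (And.imp hs hs) (And.imp hs hs))
    · refine ⟨f, Finset.mem_insert_self _ _, fun hfX => h ?_, ?_⟩
      · refine conn_mono ?_ hF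
        rw [Finset.coe_insert, Set.union_insert]
        exact Set.insert_subset (Or.inl hfX) le_rfl
      · rw [Finset.erase_insert hf]
        rw [Finset.coe_insert, Set.union_insert, conn_insert] at hF
        rcases hF with h1 | ⟨h1, h2⟩ | ⟨h1, h2⟩
        · exact absurd h1 h
        · exact Or.inr (Or.inl ⟨Setoid.symm' _ h1, Setoid.symm' _ h2⟩)
        · exact Or.inr (Or.inr ⟨h2, h1⟩)

/-- The greedy algorithm finds a spanning set of edges of minimum weight. -/
theorem IsGreedy.sum_le [DecidableEq κ] (hT : IsGreedy E e pos T) (hpos : Function.Injective pos)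
    {w : κ → ℤ} (hw : ∀ k, 0 ≤ w k) (hmono : ∀ k k', pos k ≤ pos k' → w k ≤ w k')
    {K : Finset κ} (hK : ∀ x y, conn E e (K : Set κ) x y) : ∑ k ∈ T, w k ≤ ∑ k ∈ K, w k := by
  -- `K'` is a spanning set no heavier than `K` that agrees with `T` before position `j`; past the
  -- last position of `T` it contains `T`.
  suffices H : ∀ j, ∃ K' : Finset κ, ∑ k ∈ K', w k ≤ ∑ k ∈ K, w k ∧
      (∀ x y, conn E e (K' : Set κ) x y) ∧ ∀ k, pos k < j → (k ∈ K' ↔ k ∈ T) by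
    obtain ⟨K', h1, -, h3⟩ := H (T.sup pos + 1)
    refine (Finset.sum_le_sum_of_subset_of_nonneg (fun k hk => ?_) fun k _ _ => hw k).trans h1
    exact (h3 k (Nat.lt_succ_of_le (Finset.le_sup hk))).2 hk
  intro j
  induction j with
  | zero => exact ⟨K, le_rfl, hK, fun k hk => absurd hk (Nat.not_lt_zero _)⟩
  | succ j ih =>
    obtain ⟨K', h1, h2, h3⟩ := ih
    by_cases hf : ∃ f, pos f = j ∧ ¬ (f ∈ K' ↔ f ∈ T)
    swap
    · refine ⟨K', h1, h2, fun k hk => ?_⟩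
      by_cases hkj : pos k = j
      · by_contra h; exact hf ⟨k, hkj, h⟩
      · exact h3 k (by omega)
    obtain ⟨f, hfj, hne⟩ := hf
    by_cases hfT : f ∈ T
    · have hfK : f ∉ K' := by tauto
      have hX : ¬ conn E e {k | k ∈ T ∧ pos k < j} (e f).1 (e f).2 := fun h =>
        (hT f).1 hfT (by rw [hfj]; exact (hT.conn_iff j).1 h)
      obtain ⟨g, hg, hgX, hm⟩ := exists_exchange hX K'
        (conn_mono Set.subset_union_right (h2 _ _))
      have hgf : g ≠ f := by rintro rfl; exact hfK hg
      -- The edge `g` to be replaced is not among the common edges before `j`, so it weighs at least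
      -- as much as `f`.
      have hgj : j ≤ pos g := by
        by_contra h
        exact hgX ⟨(h3 g (by omega)).1 hg, by omega⟩
      have hfe : f ∉ K'.erase g := fun h => hfK (Finset.mem_of_mem_erase h)
      refine ⟨insert f (K'.erase g), ?_, ?_, ?_⟩
      · rw [Finset.sum_insert hfe]
        have := Finset.add_sum_erase K' w hg
        have := hmono f g (by omega)
        omega
      · intro x y
        refine conn_le (fun k hk => ?_) (h2 x y)
        by_cases hkg : k = g
        · subst hkg
          rw [Finset.coe_insert, conn_insert]
          have hs : ∀ {x y}, conn E e ({k | k ∈ T ∧ pos k < j} ∪ (K'.erase k : Finset κ)) x y →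
              conn E e (K'.erase k : Finset κ) x y := by
            refine fun h => conn_mono (Set.union_subset ?_ le_rfl) h
            rintro k' ⟨hk1, hk2⟩
            refine Finset.mem_coe.2 (Finset.mem_erase.2 ⟨?_, (h3 k' hk2).2 hk1⟩)
            rintro rfl
            omega
          exact hm.imp hs (Or.imp (And.imp hs hs) (And.imp hs hs))
        · refine conn_edge ?_
          simp only [Finset.coe_insert, Set.mem_insert_iff, Finset.mem_coe, Finset.mem_erase]
          exact Or.inr ⟨hkg, hk⟩
      · intro k hk
        by_cases hkf : k = f
        · subst hkf; simp [hfT]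
        · have hkj : pos k ≠ j := fun h => hkf (hpos (h.trans hfj.symm))
          have hkg : k ≠ g := by rintro rfl; omega
          rw [Finset.mem_insert, Finset.mem_erase, ← h3 k (by omega)]
          tauto
    -- An edge of `K'` that the greedy algorithm rejects is redundant: common edges before it
    -- connect its ends.
    · have hfK : f ∈ K' := by tauto
      refine ⟨K'.erase f, ?_, ?_, ?_⟩
      · have := Finset.add_sum_erase K' w hfK
        have := hw f
        omega
      · intro x y
        refine conn_le (fun k hk => ?_) (h2 x y)
        by_cases hkf : k = f
        · subst hkf
          rw [hT k, not_not, hfj] at hfT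
          refine conn_mono ?_ ((hT.conn_iff j).2 hfT)
          rintro k' ⟨hk1, hk2⟩
          refine Finset.mem_coe.2 (Finset.mem_erase.2 ⟨?_, (h3 k' hk2).2 hk1⟩)
          rintro rfl
          omega
        · exact conn_edge (Finset.mem_coe.2 (Finset.mem_erase.2 ⟨hkf, hk⟩))
      · intro k hk
        by_cases hkf : k = f
        · subst hkf; simp [hfT]
        · have hkj : pos k ≠ j := fun h => hkf (hpos (h.trans hfj.symm))
          rw [Finset.mem_erase, ← h3 k (by omega)]
          tauto

theorem IsGreedy.conn_total (hT : IsGreedy E e pos T) (hK : ∀ x y, conn E e Set.univ x y)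
    (x y : V) : conn E e (T : Set κ) x y := by
  refine conn_le (fun k _ => ?_) (hK x y)
  by_cases hk : k ∈ T
  · exact conn_edge hk
  · rw [hT k, not_not] at hk
    exact conn_mono (fun k' h => h.1) ((hT.conn_iff (pos k)).2 hk)

end Linked

end ExactDelay

namespace ExactDelay

/-! ### Assignments between sorted sequences -/

/-- The cost of interchanging neighbours in the assignment between two sorted sequences. -/
def gap (a₀ b₀ a₁ b₁ : ℤ) : ℤ := max 0 (min a₁ b₁ - max a₀ b₀)

theorem gap_nonneg (a₀ b₀ a₁ b₁ : ℤ) : 0 ≤ gap a₀ b₀ a₁ b₁ := le_max_left _ _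

section Potential

variable (A B : ℕ → ℤ)

/-- Row potential of the assignment problem with costs `max (B r) (A s)`. -/
def rowPot : ℕ → ℤ
  | 0 => max (B 0) (A 0)
  | r + 1 => rowPot r + max 0 (B (r + 1) - max (B r) (A r))

/-- Column potential of the assignment problem with costs `max (B r) (A s)`. -/
def colPot : ℕ → ℤ
  | 0 => 0
  | s + 1 => colPot s + max 0 (A (s + 1) - max (A s) (B (s + 1)))

variable {A B}

/-- The potentials record the increase of `max (B r) (A s)` along the staircase `(r, r)`, `(r + 1,
r)`, `(r + 1, r + 1)`: steps in `r` go to `rowPot`, steps in `s` to `colPot`. Hence the dual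
constraints are tight on the diagonal. -/
theorem rowPot_add_colPot (hA : Monotone A) (hB : Monotone B) (r : ℕ) :
    rowPot A B r + colPot A B r = max (B r) (A r) := by
  induction r with
  | zero => simp [rowPot, colPot]
  | succ r ih =>
    have h1 := hA (Nat.le_succ r)
    have h2 := hB (Nat.le_succ r)
    simp only [rowPot, colPot, Nat.succ_eq_add_one] at *
    omega

/-- The increase of `max (B r) (A s)` in `s` is largest for small `r`. Above the diagonal each
further step in `s` therefore adds at least one gap to the slack of the dual constraint. -/
theorem pot_add_gaps_le (hA : Monotone A) (hB : Monotone B) {r s : ℕ} (h : r ≤ s) :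
    rowPot A B r + colPot A B s +
      ∑ k ∈ Finset.Ico r s, gap (A k) (B k) (A (k + 1)) (B (k + 1)) ≤ max (B r) (A s) := by
  induction s, h using Nat.le_induction with
  | base => simp [rowPot_add_colPot hA hB]
  | succ s hs ih =>
    rw [Finset.sum_Ico_succ_top hs]
    have h1 := hA (Nat.le_succ s)
    have h2 := hB (Nat.le_succ s)
    have h3 := hB hs
    simp only [colPot, gap, Nat.succ_eq_add_one] at *
    omega

/-- The same monotonicity of increments, below the diagonal. No gain is needed here, because a
permutation crosses every gap as often upwards as downwards. -/
theorem pot_le (hA : Monotone A) (hB : Monotone B) {r s : ℕ} (h : s ≤ r) :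
    rowPot A B r + colPot A B s ≤ max (B r) (A s) := by
  induction r, h using Nat.le_induction with
  | base => simp [rowPot_add_colPot hA hB]
  | succ r hr ih =>
    have h2 := hB (Nat.le_succ r)
    have h3 := hA hr
    simp only [rowPot, Nat.succ_eq_add_one] at *
    omega

end Potential

variable {m : ℕ}

/-- The cost of interchanging the neighbours `k` and `k + 1`. -/
def gapAt (A B : Fin (m + 1) → ℤ) (k : Fin m) : ℤ :=
  gap (A k.castSucc) (B k.castSucc) (A k.succ) (B k.succ)

/-- The gaps that the permutation `ψ` crosses upwards. -/
def crossed (ψ : Equiv.Perm (Fin (m + 1))) : Finset (Fin m) :=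
  Finset.univ.filter fun k => ∃ r, r ≤ k.castSucc ∧ k.castSucc < ψ r

/-- Sum the dual constraints over all rows: the potentials add up to the cost of the diagonal, and
each crossed gap occurs in the slack of at least one row. -/
theorem sum_add_gaps_le {A B : Fin (m + 1) → ℤ} (hA : Monotone A) (hB : Monotone B)
    (ψ : Equiv.Perm (Fin (m + 1))) :
    ∑ r, max (B r) (A r) + ∑ k ∈ crossed ψ, gapAt A B k ≤ ∑ r, max (B r) (A (ψ r)) := by
  -- The sequences are continued beyond `m` by their last values, since the potentials are defined
  -- by recursion on `ℕ`.
  have hcl : Monotone fun i : ℕ => (⟨min i m, by omega⟩ : Fin (m + 1)) := fun i j h =>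
    Fin.mk_le_mk.2 (by omega)
  set A' : ℕ → ℤ := fun i => A ⟨min i m, by omega⟩
  set B' : ℕ → ℤ := fun i => B ⟨min i m, by omega⟩
  have hA' : Monotone A' := hA.comp hcl
  have hB' : Monotone B' := hB.comp hcl
  have hAr : ∀ r : Fin (m + 1), A' r = A r := fun r => congrArg A (Fin.ext (by simp; omega))
  have hBr : ∀ r : Fin (m + 1), B' r = B r := fun r => congrArg B (Fin.ext (by simp; omega))
  have hg : ∀ k : Fin m, gap (A' k) (B' k) (A' (k + 1)) (B' (k + 1)) = gapAt A B k := fun k => by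
    rw [gapAt, ← hAr, ← hBr, ← hAr, ← hBr]; rfl
  have hpt : ∀ r : Fin (m + 1), rowPot A' B' r + colPot A' B' (ψ r) +
      ∑ k : Fin m, (if r ≤ k.castSucc ∧ k.castSucc < ψ r then gapAt A B k else 0) ≤
        max (B r) (A (ψ r)) := by
    intro r
    rw [← hAr, ← hBr]
    rcases le_total (r : ℕ) (ψ r : ℕ) with h | h
    · refine le_trans (add_le_add le_rfl ?_) (pot_add_gaps_le hA' hB' h)
      rw [← Finset.sum_filter]
      refine le_of_eq (Finset.sum_bij (fun k _ => (k : ℕ)) ?_ ?_ ?_ ?_)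
      · intro k hk
        simp only [Finset.mem_filter, Finset.mem_univ, true_and, Fin.le_def, Fin.lt_def,
          Fin.val_castSucc] at hk
        exact Finset.mem_Ico.2 hk
      · intro k _ k' _ h; exact Fin.ext h
      · intro k hk
        rw [Finset.mem_Ico] at hk
        refine ⟨⟨k, by omega⟩, ?_, rfl⟩
        simp [Fin.le_def, Fin.lt_def, hk]
      · intro k _; exact (hg k).symm
    · refine le_trans (le_of_eq ?_) (pot_le hA' hB' h)
      rw [Finset.sum_eq_zero, add_zero]
      intro k _
      rw [if_neg]
      rintro ⟨h1, h2⟩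
      rw [Fin.le_def] at h1
      rw [Fin.lt_def] at h2
      omega
  have hsum := Finset.sum_le_sum fun r (_ : r ∈ Finset.univ) => hpt r
  refine le_trans ?_ hsum
  rw [Finset.sum_add_distrib, Finset.sum_add_distrib,
    Equiv.sum_comp ψ (fun r => colPot A' B' r), ← Finset.sum_add_distrib, Finset.sum_comm]
  refine add_le_add (le_of_eq (Finset.sum_congr rfl fun r _ => ?_)) ?_
  · rw [rowPot_add_colPot hA' hB', hAr, hBr]
  · rw [crossed, Finset.sum_filter]
    refine Finset.sum_le_sum fun k _ => ?_
    split_ifs with h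
    · obtain ⟨r, hr⟩ := h
      refine le_trans (le_of_eq (if_pos hr).symm) (Finset.single_le_sum
        (f := fun r => if r ≤ k.castSucc ∧ k.castSucc < ψ r then gapAt A B k else 0)
        (fun r _ => ?_) (Finset.mem_univ r))
      split_ifs
      exacts [gap_nonneg _ _ _ _, le_rfl]
    · refine Finset.sum_nonneg fun r _ => ?_
      split_ifs
      exacts [gap_nonneg _ _ _ _, le_rfl]

/-- If nothing crosses `k` upwards, the positions up to `k` are mapped into themselves, hence onto
themselves by finiteness, and nothing can come down from above. -/
theorem mem_crossed_of_down {ψ : Equiv.Perm (Fin (m + 1))} {k : Fin m} {r : Fin (m + 1)}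
    (h1 : k.castSucc < r) (h2 : ψ r ≤ k.castSucc) : k ∈ crossed ψ := by
  by_contra h
  simp only [crossed, Finset.mem_filter, Finset.mem_univ, true_and, not_exists, not_and,
    not_lt] at h
  have hm : Set.MapsTo ψ (Set.Iic k.castSucc) (Set.Iic k.castSucc) := fun r hr => h r hr
  have := Equiv.Perm.perm_symm_mapsTo_of_mapsTo ψ hm h2
  simp only [Equiv.symm_apply_apply, Set.mem_Iic] at this
  exact absurd this (not_le.2 h1)

/-! ### Tours -/

/-- The edges between the `k`-th and the next node in the order given by `P`. -/
def stepEdge (P : Equiv.Perm (Fin (m + 1))) (k : Fin m) : Fin (m + 1) × Fin (m + 1) :=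
  (P k.castSucc, P k.succ)

/-- The edges of the optimal assignment. -/
def baseEdges (P Q : Equiv.Perm (Fin (m + 1))) : Set (Fin (m + 1) × Fin (m + 1)) :=
  Set.range fun r => (P r, Q r)

variable {P Q : Equiv.Perm (Fin (m + 1))}

theorem conn_of_forall_between {K : Set (Fin m)} {r s : Fin (m + 1)} (hrs : r ≤ s)
    (h : ∀ k : Fin m, r ≤ k.castSucc → k.castSucc < s → k ∈ K) :
    conn (baseEdges P Q) (stepEdge P) K (P r) (P s) := by
  induction s using Fin.induction with
  | zero => rw [le_antisymm hrs (Fin.zero_le _)]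
  | succ s ih =>
    by_cases hr : r ≤ s.castSucc
    · exact Setoid.trans' _ (ih hr fun k h1 h2 => h k h1 (h2.trans s.castSucc_lt_succ))
        (conn_edge (e := stepEdge P) (h s hr s.castSucc_lt_succ))
    · have : r = s.succ := by
        rw [Fin.le_def] at *
        simp only [Fin.val_castSucc, Fin.val_succ, not_le] at *
        exact Fin.ext (by simp; omega)
      rw [this]

/-- A permutation without proper invariant subsets. -/
def IsTour {V : Type*} (π : Equiv.Perm V) : Prop :=
  ∀ C : Set V, C.Nonempty → (∀ x ∈ C, π x ∈ C) → C = Set.univ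

/-- Going from `P r` to its successor `Q (ψ r)` amounts to moving from position `r` to `ψ r` through
gaps that `ψ` crosses, and then along an edge of the optimal assignment. So every class is invariant
under `π`, and a tour leaves room for one class only. -/
theorem conn_crossed {π : Equiv.Perm (Fin (m + 1))} (hπ : IsTour π) (x y : Fin (m + 1)) :
    conn (baseEdges P Q) (stepEdge P) (crossed (Q⁻¹ * π * P) : Set (Fin m)) x y := by
  set ψ := Q⁻¹ * π * P with hψ
  set c := conn (baseEdges P Q) (stepEdge P) (crossed ψ : Set (Fin m))
  have key : ∀ z, c z (π z) := by
    intro z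
    obtain ⟨r, rfl⟩ := P.surjective z
    have h1 : π (P r) = Q (ψ r) := by simp [hψ]
    rw [h1]
    refine Setoid.trans' _ (y := P (ψ r)) ?_ (conn_base ⟨_, rfl⟩)
    rcases le_total r (ψ r) with h | h
    · refine conn_of_forall_between h fun k h1 h2 => ?_
      simp only [crossed, Finset.coe_filter, Finset.mem_univ, true_and]
      exact ⟨r, h1, h2⟩
    · exact Setoid.symm' _ (conn_of_forall_between h fun k h1 h2 => mem_crossed_of_down h2 h1)
  have := hπ {z | c x z} ⟨x, Setoid.refl' c x⟩ fun z hz => Setoid.trans' _ hz (key z)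
  have hy : y ∈ {z | c x z} := this ▸ Set.mem_univ y
  exact hy

/-- The cost of a tour. -/
def tourCost (a b : Fin (m + 1) → ℤ) (π : Equiv.Perm (Fin (m + 1))) : ℤ :=
  ∑ x, max (b x) (a (π x))

/-- The lower bound: the crossed gaps form a spanning set, so they weigh at least as much as the
greedy tree. -/
theorem tourCost_ge {a b : Fin (m + 1) → ℤ} (hA : Monotone (a ∘ Q)) (hB : Monotone (b ∘ P))
    {pos : Fin m → ℕ} {T : Finset (Fin m)}
    (hT : IsGreedy (baseEdges P Q) (stepEdge P) pos T) (hpos : Function.Injective pos)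
    (hmono : ∀ k k', pos k ≤ pos k' → gapAt (a ∘ Q) (b ∘ P) k ≤ gapAt (a ∘ Q) (b ∘ P) k')
    {π : Equiv.Perm (Fin (m + 1))} (hπ : IsTour π) :
    ∑ r, max (b (P r)) (a (Q r)) + ∑ k ∈ T, gapAt (a ∘ Q) (b ∘ P) k ≤ tourCost a b π := by
  have h1 := hT.sum_le hpos (fun k => gap_nonneg _ _ _ _) hmono (conn_crossed hπ)
  have h2 := sum_add_gaps_le hA hB (Q⁻¹ * π * P)
  have h3 : tourCost a b π = ∑ r, max (b (P r)) (a (π (P r))) :=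
    (Equiv.sum_comp P fun x => max (b x) (a (π x))).symm
  rw [h3]
  have h4 : ∀ r, (a ∘ Q) ((Q⁻¹ * π * P) r) = a (π (P r)) := fun r => by simp
  simp only [h4] at h2
  exact (add_le_add le_rfl h1).trans h2

/-! ### Merging cycles by interchanges -/

theorem sameCycle_le {V : Type*} {π : Equiv.Perm V} {r : Setoid V} (h : ∀ z, r z (π z)) {x y : V}
    (hxy : π.SameCycle x y) : r x y := by
  obtain ⟨i, rfl⟩ := hxy
  induction i using Int.induction_on with
  | zero => exact Setoid.refl' _ _
  | succ i ih =>
    rw [add_comm, zpow_add, zpow_one, Equiv.Perm.mul_apply]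
    exact Setoid.trans' _ ih (h _)
  | pred i ih =>
    refine Setoid.trans' _ ih (Setoid.symm' _ ?_)
    have := h ((π ^ (-(i : ℤ) - 1)) x)
    rw [← Equiv.Perm.mul_apply, ← zpow_one_add] at this
    simpa using this

/-- After the swap `x` is sent to `π y`. From there the old cycle of `y` is followed, which avoids
`x`, until `y` is reached after `q` steps. -/
theorem sameCycle_mul_swap {V : Type*} [DecidableEq V] [Finite V] {π : Equiv.Perm V} {x y : V}
    (h : ¬ π.SameCycle x y) : (π * Equiv.swap x y).SameCycle x y := by
  obtain ⟨p, hp0, -, hp⟩ := (Equiv.Perm.SameCycle.refl π (π y)).exists_pow_eq''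
  have hex : ∃ p, 0 < p ∧ (π ^ p) y = y := by
    refine ⟨p, hp0, π.injective ?_⟩
    rw [← Equiv.Perm.mul_apply, ← pow_succ', pow_succ, Equiv.Perm.mul_apply]
    exact hp
  classical
  obtain ⟨hq0, hq⟩ := Nat.find_spec hex
  set q := Nat.find hex
  have key : ∀ j, j < q → ((π * Equiv.swap x y) ^ (j + 1)) x = (π ^ (j + 1)) y := by
    intro j
    induction j with
    | zero => intro _; simp
    | succ j ih =>
      intro hj
      rw [pow_succ', Equiv.Perm.mul_apply, ih (by omega), Equiv.Perm.mul_apply,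
        Equiv.swap_apply_of_ne_of_ne, ← Equiv.Perm.mul_apply, ← pow_succ']
      · intro h'
        exact h (Equiv.Perm.SameCycle.symm ⟨(j + 1 : ℕ), by rw [zpow_natCast]; exact h'⟩)
      · intro h'
        exact Nat.find_min hex hj ⟨by omega, h'⟩
  refine ⟨(q : ℕ), ?_⟩
  rw [zpow_natCast]
  have := key (q - 1) (by omega)
  rwa [Nat.sub_add_cancel hq0, hq] at this

/-- No more is merged because every new successor lies in the merged class of its node; no less,
because every old successor lies in the new cycle of its node. -/
theorem sameCycle_mul_swap_iff {V : Type*} [DecidableEq V] [Finite V] {π : Equiv.Perm V}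
    {r : Setoid V} (hr : ∀ z w, π.SameCycle z w ↔ r z w) {x y : V} (h : ¬ r x y) (z w : V) :
    (π * Equiv.swap x y).SameCycle z w ↔ mergeClasses r x y z w := by
  have hxy := sameCycle_mul_swap (mt (hr x y).1 h)
  have hxr : mergeClasses r x y x y := Or.inr (Or.inl ⟨r.refl' _, r.refl' _⟩)
  have happ : ∀ z, (π * Equiv.swap x y) z = π z ∨ (z = x ∧ (π * Equiv.swap x y) z = π y) ∨
      (z = y ∧ (π * Equiv.swap x y) z = π x) := by
    intro z
    by_cases hx : z = x
    · subst hx; simp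
    by_cases hy : z = y
    · subst hy; simp
    · left; simp [Equiv.swap_apply_of_ne_of_ne hx hy]
  have hpi : ∀ z, mergeClasses r x y z (π z) := fun z =>
    Or.inl ((hr _ _).1 ((Equiv.Perm.SameCycle.refl π z).apply_right))
  have hself : ∀ z, (π * Equiv.swap x y).SameCycle z ((π * Equiv.swap x y) z) := fun z =>
    (Equiv.Perm.SameCycle.refl _ z).apply_right
  constructor
  · refine sameCycle_le fun z => ?_
    rcases happ z with h' | ⟨rfl, h'⟩ | ⟨rfl, h'⟩ <;> rw [h']
    · exact hpi z
    · exact Setoid.trans' _ hxr (hpi y)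
    · exact Setoid.trans' _ (Setoid.symm' _ hxr) (hpi x)
  · have step : ∀ z, (π * Equiv.swap x y).SameCycle z (π z) := by
      intro z
      by_cases hx : z = x
      · subst hx
        have := hself y
        simp only [Equiv.Perm.mul_apply, Equiv.swap_apply_right] at this
        exact hxy.trans this
      by_cases hy : z = y
      · subst hy
        have := hself x
        simp only [Equiv.Perm.mul_apply, Equiv.swap_apply_left] at this
        exact hxy.symm.trans this
      · have := hself z
        simpa [Equiv.swap_apply_of_ne_of_ne hx hy] using this
    have hle : ∀ z w, r z w → (π * Equiv.swap x y).SameCycle z w := by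
      intro z w hzw
      exact sameCycle_le (r := Equiv.Perm.SameCycle.setoid (π * Equiv.swap x y)) step
        ((hr z w).2 hzw)
    rintro (h1 | ⟨h1, h2⟩ | ⟨h1, h2⟩)
    · exact hle _ _ h1
    · exact (hle _ _ h1).trans (hxy.trans (hle _ _ h2))
    · exact (hle _ _ h1).trans (hxy.symm.trans (hle _ _ h2))

/-- The invariant of the interchange phase: the interchanges in `D` have been carried out and have
led to the assignment `ψ`. -/
structure Interchanged (a b : Fin (m + 1) → ℤ) (P Q : Equiv.Perm (Fin (m + 1)))
    (D : Finset (Fin m)) (ψ : Equiv.Perm (Fin (m + 1))) : Prop where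
  touched : ∀ r, ψ r ≠ r → ∃ k ∈ D, k.castSucc = r ∨ k.succ = r
  cost : ∑ r, max (b (P r)) (a (Q (ψ r))) ≤
    ∑ r, max (b (P r)) (a (Q r)) + ∑ k ∈ D, gapAt (a ∘ Q) (b ∘ P) k
  cycles : ∀ x y, (Q * ψ * P⁻¹).SameCycle x y ↔
    conn (baseEdges P Q) (stepEdge P) (D : Set (Fin m)) x y

theorem Interchanged.init (a b : Fin (m + 1) → ℤ) (P Q : Equiv.Perm (Fin (m + 1))) :
    Interchanged a b P Q ∅ 1 where
  touched r h := absurd rfl h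
  cost := by simp
  cycles x y := by
    constructor
    · exact sameCycle_le fun z => conn_base (Set.mem_range.2 ⟨P⁻¹ z, by simp⟩)
    · refine linked_le (r := Equiv.Perm.SameCycle.setoid (Q * 1 * P⁻¹)) ?_
      rintro p (⟨r, rfl⟩ | ⟨k, hk, rfl⟩)
      · have := (Equiv.Perm.SameCycle.refl (Q * 1 * P⁻¹) (P r)).apply_right
        have h : (Q * 1 * P⁻¹) (P r) = Q r := by simp
        rwa [h] at this
      · simp at hk

/-- Let the indices `0` and `1` stand for the lower and the upper position. The interchange costs at
most `max 0 (min a₁ b₁ - max a₀ b₀)`, whatever is currently assigned, as long as an end of this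
interval that is given by `a` alone still has its original assignment. `hlow` ensures this for the
lower position when `b₀ < a₀`, and `hupp` for the upper one when `a₁ < b₁`. -/
theorem Interchanged.step {a b : Fin (m + 1) → ℤ} {D : Finset (Fin m)}
    {ψ : Equiv.Perm (Fin (m + 1))} (h : Interchanged a b P Q D ψ) (hB : Monotone (b ∘ P))
    {k : Fin m} (hkD : k ∉ D)
    (hind : ¬ conn (baseEdges P Q) (stepEdge P) (D : Set (Fin m)) (P k.castSucc) (P k.succ))
    (hlow : b (P k.castSucc) < a (Q k.castSucc) → ∀ k' ∈ D, k'.succ ≠ k.castSucc)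
    (hupp : a (Q k.succ) < b (P k.succ) → ∀ k' ∈ D, k'.castSucc ≠ k.succ) :
    Interchanged a b P Q (insert k D) (ψ * Equiv.swap k.castSucc k.succ) := by
  have hne : k.castSucc ≠ k.succ := k.castSucc_lt_succ.ne
  refine ⟨fun r hr => ?_, ?_, fun x y => ?_⟩
  · by_cases h1 : r = k.castSucc
    · exact ⟨k, Finset.mem_insert_self _ _, Or.inl h1.symm⟩
    by_cases h2 : r = k.succ
    · exact ⟨k, Finset.mem_insert_self _ _, Or.inr h2.symm⟩
    rw [Equiv.Perm.mul_apply, Equiv.swap_apply_of_ne_of_ne h1 h2] at hr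
    obtain ⟨k', hk', h'⟩ := h.touched r hr
    exact ⟨k', Finset.mem_insert_of_mem hk', h'⟩
  · rw [Finset.sum_insert hkD]
    have h1 : b (P k.castSucc) < a (Q k.castSucc) → ψ k.castSucc = k.castSucc := by
      intro hlt
      by_contra hψ
      obtain ⟨k', hk', h' | h'⟩ := h.touched _ hψ
      · exact hkD (Fin.castSucc_injective _ h' ▸ hk')
      · exact hlow hlt k' hk' h'
    have h2 : a (Q k.succ) < b (P k.succ) → ψ k.succ = k.succ := by
      intro hlt
      by_contra hψ
      obtain ⟨k', hk', h' | h'⟩ := h.touched _ hψ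
      · exact hupp hlt k' hk' h'
      · exact hkD (Fin.succ_injective _ h' ▸ hk')
    have hsplit : ∀ f : Fin (m + 1) → ℤ, ∑ r, f r = f k.castSucc + (f k.succ +
        ∑ r ∈ (Finset.univ.erase k.castSucc).erase k.succ, f r) := fun f => by
      rw [Finset.add_sum_erase _ _ (Finset.mem_erase.2 ⟨hne.symm, Finset.mem_univ _⟩),
        Finset.add_sum_erase _ _ (Finset.mem_univ _)]
    have hrest : ∑ r ∈ (Finset.univ.erase k.castSucc).erase k.succ,
        max (b (P r)) (a (Q ((ψ * Equiv.swap k.castSucc k.succ) r))) =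
        ∑ r ∈ (Finset.univ.erase k.castSucc).erase k.succ, max (b (P r)) (a (Q (ψ r))) := by
      refine Finset.sum_congr rfl fun r hr => ?_
      simp only [Finset.mem_erase, Finset.mem_univ, and_true] at hr
      rw [Equiv.Perm.mul_apply, Equiv.swap_apply_of_ne_of_ne hr.2 hr.1]
    have hc := h.cost
    rw [hsplit fun r => max (b (P r)) (a (Q (ψ r)))] at hc
    rw [hsplit fun r => max (b (P r)) (a (Q ((ψ * Equiv.swap k.castSucc k.succ) r))), hrest]
    simp only [Equiv.Perm.mul_apply, Equiv.swap_apply_left, Equiv.swap_apply_right] at hc ⊢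
    have hb : b (P k.castSucc) ≤ b (P k.succ) := hB k.castSucc_lt_succ.le
    have hkey : max (b (P k.castSucc)) (a (Q (ψ k.succ))) +
        max (b (P k.succ)) (a (Q (ψ k.castSucc))) ≤
        max (b (P k.castSucc)) (a (Q (ψ k.castSucc))) +
        max (b (P k.succ)) (a (Q (ψ k.succ))) + gapAt (a ∘ Q) (b ∘ P) k := by
      simp only [gapAt, gap, Function.comp_apply]
      by_cases c1 : b (P k.castSucc) < a (Q k.castSucc) <;>
        by_cases c2 : a (Q k.succ) < b (P k.succ)
      · rw [h1 c1, h2 c2]; omega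
      · rw [h1 c1]; omega
      · rw [h2 c2]; omega
      · omega
    linarith
  -- In terms of nodes, the interchange of positions is a swap of `P k.castSucc` and `P k.succ`,
  -- which lie in different cycles by `hind`.
  · have heq : Q * (ψ * Equiv.swap k.castSucc k.succ) * P⁻¹ =
        (Q * ψ * P⁻¹) * Equiv.swap (P k.castSucc) (P k.succ) := by
      rw [Equiv.swap_apply_apply]
      group
    rw [heq, sameCycle_mul_swap_iff h.cycles hind, Finset.coe_insert, conn_insert]
    rfl

end ExactDelay

namespace ExactDelay

/-! ### Schedules of jobs with equal delays -/

theorem isTour_of_sameCycle {V : Type*} [Finite V] {π : Equiv.Perm V}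
    (h : ∀ x y, π.SameCycle x y) : IsTour π := by
  rintro C ⟨x, hx⟩ hC
  refine Set.eq_univ_of_forall fun y => ?_
  obtain ⟨i, -, -, rfl⟩ := (h x y).exists_pow_eq''
  induction i with
  | zero => exact hx
  | succ i ih => rw [pow_succ', Equiv.Perm.mul_apply]; exact hC _ ih

theorem finRotate_castSucc (m : ℕ) (i : Fin m) : finRotate (m + 1) i.castSucc = i.succ := by
  rw [finRotate_apply]
  exact Fin.ext (by simp)

theorem sameCycle_finRotate (m : ℕ) (x y : Fin (m + 1)) : (finRotate (m + 1)).SameCycle x y := by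
  have h0 : ∀ x, (finRotate (m + 1)).SameCycle 0 x := by
    intro x
    induction x using Fin.induction with
    | zero => exact Equiv.Perm.SameCycle.refl _ _
    | succ i ih => rw [← finRotate_castSucc]; exact ih.apply_right
  exact (h0 x).symm.trans (h0 y)

section

variable {m : ℕ} {ι : Type}

theorem Schedule.beginTime_le [Finite ι] (σ : Schedule ι) (j : ι) : σ.beginTime ≤ σ.start₁ j :=
  ciInf_le (Set.finite_range _).bddBelow j

theorem Instance.le_endTime [Finite ι] (I : Instance ι) (σ : Schedule ι) (j : ι) :
    σ.start₂ j + I.b j ≤ I.endTime σ :=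
  le_ciSup (f := fun j => σ.start₂ j + (I.b j : ℝ)) (Set.finite_range _).bddAbove j

/-- The first operations of the jobs, preceded by an operation of length zero. -/
def Instance.nodeA (I : Instance ι) (J : Fin m ≃ ι) : Fin (m + 1) → ℤ :=
  Fin.cons 0 fun i => (I.a (J i) : ℤ)

/-- The second operations of the jobs, preceded by an operation of length zero. -/
def Instance.nodeB (I : Instance ι) (J : Fin m ≃ ι) : Fin (m + 1) → ℤ :=
  Fin.cons 0 fun i => (I.b (J i) : ℤ)

@[simp] theorem Instance.nodeA_zero (I : Instance ι) (J : Fin m ≃ ι) : I.nodeA J 0 = 0 := rfl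
@[simp] theorem Instance.nodeB_zero (I : Instance ι) (J : Fin m ≃ ι) : I.nodeB J 0 = 0 := rfl
@[simp] theorem Instance.nodeA_succ (I : Instance ι) (J : Fin m ≃ ι) (i : Fin m) :
    I.nodeA J i.succ = I.a (J i) := rfl
@[simp] theorem Instance.nodeB_succ (I : Instance ι) (J : Fin m ≃ ι) (i : Fin m) :
    I.nodeB J i.succ = I.b (J i) := rfl

theorem Instance.nodeA_nonneg (I : Instance ι) (J : Fin m ≃ ι) (x : Fin (m + 1)) :
    0 ≤ I.nodeA J x := by
  cases x using Fin.cases <;> simp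

theorem Instance.nodeB_nonneg (I : Instance ι) (J : Fin m ≃ ι) (x : Fin (m + 1)) :
    0 ≤ I.nodeB J x := by
  cases x using Fin.cases <;> simp

/-- A tour through nodes that can be put in a compatible temporal order. -/
theorem exists_tour_le {a b : Fin (m + 1) → ℤ} (ha : ∀ x, 0 ≤ a x) (hb : ∀ x, 0 ≤ b x)
    {c : Fin (m + 1) → ℝ} {t₁ : ℝ} (hc₀ : ∀ x, c 0 + a x ≤ c x)
    (hc₁ : ∀ x, c x + b x ≤ t₁)
    (hc : ∀ x y, x ≠ y → c x + max (b x : ℝ) (a y) ≤ c y ∨ c y + max (b y : ℝ) (a x) ≤ c x) :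
    ∃ π : Equiv.Perm (Fin (m + 1)), IsTour π ∧ (tourCost a b π : ℝ) ≤ t₁ - c 0 := by
  -- Ties in time are broken by `b - a`. If `hc` orders a tied pair the other way round, then the
  -- earlier node has `a = 0` and the later one `b = 0`, and the tie-break makes their other lengths
  -- vanish as well.
  let f : Fin (m + 1) → ℝ ×ₗ ℤ := fun x => toLex (c x, b x - a x)
  let p := Tuple.sort f
  have hp : Monotone (f ∘ p) := Tuple.monotone_sort f
  have hord : ∀ r s, r < s → c (p r) + max (b (p r) : ℝ) (a (p s)) ≤ c (p s) := by
    intro r s hrs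
    rcases hc (p r) (p s) (fun h => hrs.ne (p.injective h)) with h | h
    · exact h
    · have hf : f (p r) ≤ f (p s) := hp hrs.le
      have hax : (0 : ℝ) ≤ a (p r) := by exact_mod_cast ha (p r)
      have hbx : (0 : ℝ) ≤ b (p s) := by exact_mod_cast hb (p s)
      have hmax1 := le_max_left (b (p s) : ℝ) (a (p r))
      have hmax2 := le_max_right (b (p s) : ℝ) (a (p r))
      rw [Prod.Lex.toLex_le_toLex] at hf
      rcases hf with hf | ⟨hf, hf'⟩
      · dsimp only at hf
        linarith
      · dsimp only at hf hf'
        have h1 : (a (p r) : ℝ) ≤ 0 := by linarith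
        have h2 : (b (p s) : ℝ) ≤ 0 := by linarith
        have h1' : a (p r) ≤ 0 := by exact_mod_cast h1
        have h2' : b (p s) ≤ 0 := by exact_mod_cast h2
        have h3 : b (p r) = 0 := by have := hb (p r); have := ha (p s); omega
        have h4 : a (p s) = 0 := by have := hb (p r); have := ha (p s); omega
        rw [h3, h4, hf]
        simp
  refine ⟨p * finRotate (m + 1) * p⁻¹, isTour_of_sameCycle fun x y => ?_, ?_⟩
  · rw [Equiv.Perm.sameCycle_conj]
    exact sameCycle_finRotate _ _ _
  -- The first node is no later than node `0`, so `hc₀` leaves no room for its first operation.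
  -- Hence closing the tour costs only the last `b`.
  · have hfirst : a (p 0) = 0 := by
      have h0 : c (p 0) ≤ c 0 := by
        by_cases h : p 0 = 0
        · rw [h]
        · obtain ⟨z, hz⟩ := p.surjective 0
          have hne : (0 : Fin (m + 1)) < z := by
            refine Fin.pos_of_ne_zero fun h' => h ?_
            rw [← h', hz, h']
          have := hord 0 z hne
          rw [hz] at this
          have h2 : (0 : ℝ) ≤ b (p 0) := by exact_mod_cast hb (p 0)
          have h3 := le_max_left (b (p 0) : ℝ) (a 0)
          linarith
      have h1 := hc₀ (p 0)
      have h2 : (a (p 0) : ℝ) ≤ 0 := by linarith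
      exact le_antisymm (by exact_mod_cast h2) (ha _)
    have hcost : tourCost a b (p * finRotate (m + 1) * p⁻¹) =
        ∑ i : Fin m, max (b (p i.castSucc)) (a (p i.succ)) + b (p (Fin.last m)) := by
      rw [tourCost, ← Equiv.sum_comp p, Fin.sum_univ_castSucc]
      congr 1
      · refine Finset.sum_congr rfl fun i _ => ?_
        simp
      · simp [hfirst, hb]
    have htel : ∑ i : Fin m, c (p i.succ) + c (p 0) =
        ∑ i : Fin m, c (p i.castSucc) + c (p (Fin.last m)) := by
      rw [add_comm, ← Fin.sum_univ_succ (fun r => c (p r)),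
        ← Fin.sum_univ_castSucc (fun r => c (p r))]
    have hle : ∑ i : Fin m, (c (p i.castSucc) + max (b (p i.castSucc) : ℝ) (a (p i.succ))) ≤
        ∑ i : Fin m, c (p i.succ) :=
      Finset.sum_le_sum fun i _ => hord _ _ i.castSucc_lt_succ
    rw [Finset.sum_add_distrib] at hle
    have h1 := hc₁ (p (Fin.last m))
    have h2 := hc₀ (p 0)
    rw [hfirst] at h2
    rw [hcost]
    push_cast at h2 ⊢
    linarith

/-- The jobs are ordered by the time at which they leave machine 1. As the delays are equal, two
jobs with operations of positive length come in the same order on both machines, so that at least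
`max (b i) (a j)` elapses between their times. Node `0` stands at the beginning of the schedule. -/
theorem exists_tour_of_feasible {I : Instance ι} {L : ℕ} (hl : ∀ j, I.l j = L) (J : Fin m ≃ ι)
    (hm : m ≠ 0) {τ : Schedule ι} (hτ : I.Feasible τ) :
    ∃ π : Equiv.Perm (Fin (m + 1)), IsTour π ∧
      (tourCost (I.nodeA J) (I.nodeB J) π : ℝ) + L ≤ I.length τ := by
  have : Finite ι := Finite.of_equiv _ J
  -- A job with two operations of length zero may stand at the moment when another job leaves
  -- machine 1, after it on machine 1 and before it on machine 2. Such jobs are moved to the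
  -- beginning.
  let c : Fin (m + 1) → ℝ := Fin.cons τ.beginTime fun i =>
    if I.a (J i) = 0 ∧ I.b (J i) = 0 then τ.beginTime else τ.start₁ (J i) + I.a (J i)
  have hc0 : c 0 = τ.beginTime := rfl
  have hbeg : ∀ j, τ.beginTime ≤ τ.start₁ j := τ.beginTime_le
  have hend : ∀ j, τ.start₁ j + I.a j + L + I.b j ≤ I.endTime τ := fun j => by
    have := I.le_endTime τ j
    rwa [hτ.delay j, hl j] at this
  have hpos : τ.beginTime + L ≤ I.endTime τ := by
    have j := J ⟨0, Nat.pos_of_ne_zero hm⟩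
    have := hbeg j
    have := hend j
    have : (0 : ℝ) ≤ I.a j := Nat.cast_nonneg _
    have : (0 : ℝ) ≤ I.b j := Nat.cast_nonneg _
    linarith
  have hcs : ∀ i : Fin m, (I.a (J i) = 0 ∧ I.b (J i) = 0 ∧ c i.succ = τ.beginTime) ∨
      ((I.a (J i) ≠ 0 ∨ I.b (J i) ≠ 0) ∧ c i.succ = τ.start₁ (J i) + I.a (J i)) := by
    intro i
    by_cases h : I.a (J i) = 0 ∧ I.b (J i) = 0
    · exact Or.inl ⟨h.1, h.2, if_pos h⟩
    · exact Or.inr ⟨by tauto, if_neg h⟩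
  have hc₀ : ∀ x, c 0 + (I.nodeA J x : ℤ) ≤ c x := by
    intro x
    rw [hc0]
    cases x using Fin.cases with
    | zero => simp [hc0]
    | succ i =>
      rcases hcs i with ⟨h1, h2, h3⟩ | ⟨h1, h2⟩
      · simp [h3, h1]
      · simp [h2, hbeg]
  have hc₁ : ∀ x, c x + (I.nodeB J x : ℤ) ≤ I.endTime τ - L := by
    intro x
    cases x using Fin.cases with
    | zero => simp only [hc0, Instance.nodeB_zero, Int.cast_zero]; linarith
    | succ i =>
      rcases hcs i with ⟨h1, h2, h3⟩ | ⟨h1, h2⟩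
      · simp only [h3, Instance.nodeB_succ, h2, Nat.cast_zero, Int.cast_zero]; linarith
      · have := hend (J i)
        simp only [h2, Instance.nodeB_succ, Int.cast_natCast]; linarith
  have hzero : ∀ x y, c x = c 0 → I.nodeB J x = 0 →
      c x + max (I.nodeB J x : ℝ) (I.nodeA J y) ≤ c y := by
    intro x y hx hbx
    have h1 := hc₀ y
    have h2 : (0 : ℝ) ≤ I.nodeA J y := by exact_mod_cast I.nodeA_nonneg J y
    rw [hbx, Int.cast_zero, max_eq_right h2, hx]
    exact h1
  have hpair : ∀ x y, x ≠ y → c x + max (I.nodeB J x : ℝ) (I.nodeA J y) ≤ c y ∨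
      c y + max (I.nodeB J y : ℝ) (I.nodeA J x) ≤ c x := by
    intro x y hxy
    cases x using Fin.cases with
    | zero => exact Or.inl (hzero _ _ rfl rfl)
    | succ i =>
      cases y using Fin.cases with
      | zero => exact Or.inr (hzero _ _ rfl rfl)
      | succ j =>
        rcases hcs i with ⟨h1, h2, h3⟩ | ⟨hi, hi'⟩
        · exact Or.inl (hzero _ _ h3 (by simp [h2]))
        rcases hcs j with ⟨h1, h2, h3⟩ | ⟨hj, hj'⟩
        · exact Or.inr (hzero _ _ h3 (by simp [h2]))
        have hne : J i ≠ J j := fun h => hxy (by rw [J.injective h])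
        have e1 := hτ.machine₁ _ _ hne
        have e2 := hτ.machine₂ _ _ hne
        rw [hτ.delay, hτ.delay, hl, hl] at e2
        rw [hi', hj']
        simp only [Instance.nodeA_succ, Instance.nodeB_succ, Int.cast_natCast]
        have ai : (0 : ℝ) ≤ I.a (J i) := Nat.cast_nonneg _
        have bi : (0 : ℝ) ≤ I.b (J i) := Nat.cast_nonneg _
        have aj : (0 : ℝ) ≤ I.a (J j) := Nat.cast_nonneg _
        have bj : (0 : ℝ) ≤ I.b (J j) := Nat.cast_nonneg _
        have pi : 0 < (I.a (J i) : ℝ) + I.b (J i) := by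
          have : 0 < I.a (J i) + I.b (J i) := by omega
          exact_mod_cast this
        have pj : 0 < (I.a (J j) : ℝ) + I.b (J j) := by
          have : 0 < I.a (J j) + I.b (J j) := by omega
          exact_mod_cast this
        rcases e1 with e1 | e1 <;> rcases e2 with e2 | e2
        · left
          rw [← le_sub_iff_add_le', max_le_iff]
          constructor <;> linarith
        -- Opposite orders on the two machines would force `a + b ≤ 0` for one of the jobs.
        · exfalso; linarith
        · exfalso; linarith
        · right
          rw [← le_sub_iff_add_le', max_le_iff]
          constructor <;> linarith
  obtain ⟨π, hπ, hle⟩ := exists_tour_le (I.nodeA_nonneg J) (I.nodeB_nonneg J) hc₀ hc₁ hpair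
  exact ⟨π, hπ, by rw [Instance.length, ← hc0]; linarith⟩

/-- The times at which the jobs of a tour that starts at node `0` pass from one machine to the
other, if the delay is disregarded. -/
def passTime (a b : Fin (m + 1) → ℤ) (π : Equiv.Perm (Fin (m + 1))) (t₀ : ℤ) : ℕ → ℤ
  | 0 => t₀
  | k + 1 => passTime a b π t₀ k + max (b ((π ^ k) 0)) (a ((π ^ (k + 1)) 0))

/-! ### The orbit of node `0` under a cyclic permutation -/

section Orbit

variable {π : Equiv.Perm (Fin (m + 1))}

theorem exists_pow_zero_eq (h : ∀ x y, π.SameCycle x y) (x : Fin (m + 1)) :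
    ∃ k ≤ m, (π ^ k) 0 = x := by
  have hc : π.IsCycleOn (Finset.univ : Finset (Fin (m + 1))) :=
    ⟨by simp, fun x _ y _ => h x y⟩
  obtain ⟨k, hk, hx⟩ := hc.exists_pow_eq (Finset.mem_univ 0) (Finset.mem_univ x)
  rw [Finset.card_univ, Fintype.card_fin] at hk
  exact ⟨k, by omega, hx⟩

theorem pow_zero_injOn (h : ∀ x y, π.SameCycle x y) {k k' : ℕ} (hk : k ≤ m) (hk' : k' ≤ m)
    (he : (π ^ k) 0 = (π ^ k') 0) : k = k' := by
  have hc : π.IsCycleOn (Finset.univ : Finset (Fin (m + 1))) :=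
    ⟨by simp, fun x _ y _ => h x y⟩
  have := (hc.pow_apply_eq_pow_apply (Finset.mem_univ 0)).1 he
  rw [Finset.card_univ, Fintype.card_fin] at this
  exact Nat.ModEq.eq_of_lt_of_lt this (by omega) (by omega)

theorem pow_card_zero (h : ∀ x y, π.SameCycle x y) : (π ^ (m + 1)) 0 = 0 := by
  have hc : π.IsCycleOn (Finset.univ : Finset (Fin (m + 1))) :=
    ⟨by simp, fun x _ y _ => h x y⟩
  exact (hc.pow_apply_eq (Finset.mem_univ 0)).2 (by simp)

theorem passTime_card (h : ∀ x y, π.SameCycle x y) (a b : Fin (m + 1) → ℤ) (t₀ : ℤ) :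
    passTime a b π t₀ (m + 1) = t₀ + tourCost a b π := by
  have h1 : ∀ k, passTime a b π t₀ k =
      t₀ + ∑ i ∈ Finset.range k, max (b ((π ^ i) 0)) (a (π ((π ^ i) 0))) := by
    intro k
    induction k with
    | zero => simp [passTime]
    | succ k ih =>
      rw [passTime, ih, Finset.sum_range_succ, add_assoc, pow_succ', Equiv.Perm.mul_apply]
  rw [h1, tourCost]
  congr 1
  refine Finset.sum_bij (fun k _ => (π ^ k) 0) (fun _ _ => Finset.mem_univ _) ?_ ?_ ?_
  · intro k hk k' hk' he
    rw [Finset.mem_range] at hk hk'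
    exact pow_zero_injOn h (by omega) (by omega) he
  · intro x _
    obtain ⟨k, hk, hx⟩ := exists_pow_zero_eq h x
    exact ⟨k, Finset.mem_range.2 (by omega), hx⟩
  · intro k _; rfl

end Orbit

/-- This is the definition for neighbours on the tour; otherwise even more time elapses, as lengths
are nonnegative. It separates the operations on both machines at once. -/
theorem passTime_add_le {a b : Fin (m + 1) → ℤ} (ha : ∀ x, 0 ≤ a x) (hb : ∀ x, 0 ≤ b x)
    (π : Equiv.Perm (Fin (m + 1))) (t₀ : ℤ) {k k' : ℕ} (hk : k < k') :
    passTime a b π t₀ k + max (b ((π ^ k) 0)) (a ((π ^ k') 0)) ≤ passTime a b π t₀ k' := by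
  induction k', hk using Nat.le_induction with
  | base => rw [passTime]
  | succ k' hk ih =>
    rw [passTime]
    have := ha ((π ^ k') 0)
    have := hb ((π ^ k') 0)
    omega

/-- A tour of minimum cost yields an optimal schedule. -/
theorem optimal_of_tour {I : Instance ι} {L : ℕ} (hl : ∀ j, I.l j = L) (J : Fin m ≃ ι)
    {π : Equiv.Perm (Fin (m + 1))} (hπ : ∀ x y, π.SameCycle x y)
    (hmin : ∀ π', IsTour π' →
      tourCost (I.nodeA J) (I.nodeB J) π ≤ tourCost (I.nodeA J) (I.nodeB J) π')
    (t₀ : ℤ) {σ : Schedule ι}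
    (hσ : ∀ (i : Fin m) (k : ℕ), k ≤ m → (π ^ k) 0 = i.succ →
      σ.start₁ (J i) = passTime (I.nodeA J) (I.nodeB J) π t₀ k - I.a (J i) ∧
      σ.start₂ (J i) = passTime (I.nodeA J) (I.nodeB J) π t₀ k + L) :
    I.Optimal σ ∧ (m ≠ 0 → σ.beginTime = t₀ ∧
      I.endTime σ = passTime (I.nodeA J) (I.nodeB J) π t₀ (m + 1) + L) := by
  have : Finite ι := Finite.of_equiv _ J
  set a := I.nodeA J with ha
  set b := I.nodeB J with hb
  set c := passTime a b π t₀ with hc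
  have hidx : ∀ j : ι, ∃ k, 0 < k ∧ k ≤ m ∧ σ.start₁ j = c k - I.a j ∧ σ.start₂ j = c k + L ∧
      a ((π ^ k) 0) = I.a j ∧ b ((π ^ k) 0) = I.b j ∧ (π ^ k) 0 = (J.symm j).succ := by
    intro j
    obtain ⟨i, rfl⟩ := J.surjective j
    obtain ⟨k, hk, hx⟩ := exists_pow_zero_eq hπ i.succ
    obtain ⟨h1, h2⟩ := hσ i k hk hx
    refine ⟨k, Nat.pos_of_ne_zero ?_, hk, h1, h2, by rw [hx]; rfl, by rw [hx]; rfl, by simpa⟩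
    rintro rfl
    exact (Fin.succ_ne_zero i) hx.symm
  have horder : ∀ {k k' : ℕ}, k < k' →
      (c k : ℝ) + b ((π ^ k) 0) ≤ c k' ∧ (c k : ℝ) + a ((π ^ k') 0) ≤ c k' := by
    intro k k' hk
    have := passTime_add_le (I.nodeA_nonneg J) (I.nodeB_nonneg J) π t₀ hk
    rw [← ha, ← hb, ← hc] at this
    have h1 : c k + b ((π ^ k) 0) ≤ c k' := by omega
    have h2 : c k + a ((π ^ k') 0) ≤ c k' := by omega
    exact ⟨by exact_mod_cast h1, by exact_mod_cast h2⟩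
  have hfeas : I.Feasible σ := by
    have hpair : ∀ i j, i ≠ j →
        (σ.start₁ i + I.a i ≤ σ.start₁ j ∧ σ.start₂ i + I.b i ≤ σ.start₂ j) ∨
        (σ.start₁ j + I.a j ≤ σ.start₁ i ∧ σ.start₂ j + I.b j ≤ σ.start₂ i) := by
      intro i j hij
      obtain ⟨k, -, hk, h1, h2, h3, h4, h5⟩ := hidx i
      obtain ⟨k', -, hk', g1, g2, g3, g4, g5⟩ := hidx j
      rcases lt_trichotomy k k' with h | h | h
      · have := horder h
        rw [g3, h4] at this
        push_cast at this
        left; constructor <;> linarith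
      · subst h
        refine absurd (J.symm.injective (Fin.succ_injective _ (h5.symm.trans g5))) hij
      · have := horder h
        rw [h3, g4] at this
        push_cast at this
        right; constructor <;> linarith
    refine ⟨fun j => ?_, fun i j hij => (hpair i j hij).imp And.left And.left,
      fun i j hij => (hpair i j hij).imp And.right And.right⟩
    obtain ⟨k, -, hk, h1, h2, -⟩ := hidx j
    rw [h1, h2, hl j]; ring
  have hends : m ≠ 0 → σ.beginTime = t₀ ∧ I.endTime σ = c (m + 1) + L := by
    intro hm
    have hne : Nonempty ι := ⟨J ⟨0, Nat.pos_of_ne_zero hm⟩⟩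
    have hnode : ∀ k, 0 < k → k ≤ m → ∃ i : Fin m, (π ^ k) 0 = i.succ := by
      intro k hk hkm
      refine ⟨((π ^ k) 0).pred fun h0 => ?_, by simp⟩
      have := pow_zero_injOn hπ hkm (Nat.zero_le m) (h0.trans (by simp))
      omega
    constructor
    · refine le_antisymm ?_ (le_ciInf fun j => ?_)
      · obtain ⟨i, hi⟩ := hnode 1 one_pos (by omega)
        refine (σ.beginTime_le (J i)).trans (le_of_eq ?_)
        -- Node `0` has `b = 0`, so the first job of the tour starts exactly at `t₀`.
        have h1 : c 1 = t₀ + I.a (J i) := by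
          rw [hc, passTime, passTime, zero_add, hi]
          simp [ha, hb]
        rw [(hσ i 1 (by omega) hi).1, h1]
        push_cast; ring
      · obtain ⟨k, h0, hk, h1, h2, h3, h4, h5⟩ := hidx j
        have := (horder h0).2
        rw [h3] at this
        rw [h1]
        have h0' : c 0 = t₀ := rfl
        rw [h0'] at this
        push_cast at this
        linarith
    · refine le_antisymm (ciSup_le fun j => ?_) ?_
      · obtain ⟨k, h0, hk, h1, h2, h3, h4, h5⟩ := hidx j
        have := (horder (show k < m + 1 by omega)).1
        rw [h4] at this
        push_cast at this
        rw [h2]; linarith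
      · obtain ⟨i, hi⟩ := hnode m (Nat.pos_of_ne_zero hm) le_rfl
        refine le_trans (le_of_eq ?_) (I.le_endTime σ (J i))
        -- Node `0` has `a = 0`, so the closing step of the tour is the second operation of the last
        -- job.
        have h1 : c (m + 1) = c m + I.b (J i) := by
          rw [hc, passTime, pow_card_zero hπ, hi]
          simp [ha, hb]
        rw [(hσ i m le_rfl hi).2, h1]
        push_cast; ring
  refine ⟨⟨hfeas, fun τ hτ => ?_⟩, hends⟩
  -- Without jobs every length is `0`, by the values of `⨅` and `⨆` of an empty family in `ℝ`.
  by_cases hm : m = 0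
  · subst hm
    have : IsEmpty ι := J.symm.isEmpty
    simp [Instance.length, Instance.endTime, Schedule.beginTime]
  · obtain ⟨π', hπ', hle⟩ := exists_tour_of_feasible hl J hm hτ
    obtain ⟨h1, h2⟩ := hends hm
    have h3 : (tourCost a b π : ℝ) ≤ tourCost a b π' := by exact_mod_cast hmin π' hπ'
    rw [Instance.length, h1, h2, hc, passTime_card hπ]
    push_cast
    linarith

end

end ExactDelay

namespace ExactDelay

/-! ### Merge sort -/

/-- The values `f 0, …, f (N - 1)` are `0, …, N - 1` in some order, and each block of `w`
consecutive ones is sorted by `key`. -/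
structure BlockSorted (key : ℤ → ℤ) (N w : ℕ) (f : ℕ → ℤ) : Prop where
  range : ∀ x < N, ∃ k < N, f x = (k : ℕ)
  inj : ∀ x y, x < y → y < N → f x ≠ f y
  sorted : ∀ x y, x ≤ y → y < N → x / w = y / w → key (f x) ≤ key (f y)

/-- The state of a merging pass that turns blocks of length `w` of `f` into blocks of length `2 * w`
of `g`: the cells below `p` of `g` are final, and the next element is the `i`-th or the `j`-th
of `f`. -/
structure Merging (key : ℤ → ℤ) (N w : ℕ) (f g : ℕ → ℤ) (p lo i j : ℕ) : Prop where
  dvd : 2 * w ∣ lo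
  lo_le : lo ≤ i
  i_le : i ≤ lo + w
  le_j : lo + w ≤ j
  j_le : j ≤ lo + 2 * w
  count : i + j = p + lo + w
  sorted : ∀ x y, x ≤ y → y < p → x / (2 * w) = y / (2 * w) → key (g x) ≤ key (g y)
  left : ∀ x y, lo ≤ x → x < p → i ≤ y → y < lo + w → y < N → key (g x) ≤ key (f y)
  right : ∀ x y, lo ≤ x → x < p → j ≤ y → y < lo + 2 * w → y < N → key (g x) ≤ key (f y)
  content : ∀ x < p, ∃ y < N, (y < i ∨ (lo + w ≤ y ∧ y < j)) ∧ g x = f y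
  inj : ∀ x y, x < y → y < p → g x ≠ g y

variable {key : ℤ → ℤ} {N w : ℕ} {f g g' : ℕ → ℤ} {p lo i j : ℕ}

theorem div_eq_of_mem_block {w lo x : ℕ} (hd : w ∣ lo) (h1 : lo ≤ x) (h2 : x < lo + w) :
    x / w = lo / w := by
  obtain ⟨q, rfl⟩ := hd
  have hw : 0 < w := by omega
  rw [Nat.mul_div_cancel_left _ hw]
  refine Nat.div_eq_of_lt_le (by rwa [mul_comm]) ?_
  rw [add_mul, one_mul, mul_comm]
  exact h2

theorem le_of_div_eq {w lo x y : ℕ} (hd : w ∣ lo) (h1 : lo ≤ y) (h2 : y < lo + w)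
    (h : x / w = y / w) : lo ≤ x := by
  rw [div_eq_of_mem_block hd h1 h2] at h
  have := Nat.div_mul_le_self x w
  rwa [h, Nat.div_mul_cancel hd] at this

theorem BlockSorted.le_of_block (hf : BlockSorted key N w f) {x y : ℕ} (hd : w ∣ lo) (h1 : lo ≤ x)
    (h2 : x ≤ y) (h3 : y < lo + w) (h4 : y < N) : key (f x) ≤ key (f y) :=
  hf.sorted x y h2 h4 (by
    rw [div_eq_of_mem_block hd h1 (by omega), div_eq_of_mem_block hd (by omega) h3])

theorem Merging.init (key : ℤ → ℤ) (N w : ℕ) (f g : ℕ → ℤ) : Merging key N w f g 0 0 0 w :=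
  ⟨dvd_zero _, le_rfl, by omega, by omega, by omega, by omega, by omega, by omega, by omega,
    by omega, by omega⟩

/-- By `count`, reaching the end of the pair of blocks forces `i = lo + w`, `j = lo + 2 * w` and `p
= lo + 2 * w`. -/
theorem Merging.nextBlock (h : Merging key N w f g p lo i j) (hp : lo + 2 * w ≤ p) :
    Merging key N w f g p p p (p + w) := by
  have h1 := h.i_le
  have h2 := h.j_le
  have h3 := h.count
  have h4 := h.lo_le
  refine ⟨?_, le_rfl, by omega, le_rfl, by omega, by omega, h.sorted, by omega, by omega,
    fun x hx => ?_, h.inj⟩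
  · have : p = lo + 2 * w := by omega
    exact this ▸ Dvd.dvd.add h.dvd dvd_rfl
  · obtain ⟨y, hy, hy', he⟩ := h.content x hx
    exact ⟨y, hy, by omega, he⟩

/-- The common core of the two moves: `z` is the position from which the next element is taken, and
its key is at most that of everything left in either block. -/
theorem Merging.append (h : Merging key N w f g p lo i j) (hp : p < lo + 2 * w)
    (hf : BlockSorted key N w f) (hg : ∀ x < p, g' x = g x)
    {z i' j' : ℕ} (hz : z < N) (hgp : g' p = f z)
    (hz' : (z = i ∧ i < lo + w ∧ i' = i + 1 ∧ j' = j) ∨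
      (z = j ∧ j < lo + 2 * w ∧ i' = i ∧ j' = j + 1))
    (hleft : ∀ y, i' ≤ y → y < lo + w → y < N → key (f z) ≤ key (f y))
    (hright : ∀ y, j' ≤ y → y < lo + 2 * w → y < N → key (f z) ≤ key (f y)) :
    Merging key N w f g' (p + 1) lo i' j' := by
  have h1 := h.i_le
  have h2 := h.j_le
  have h3 := h.count
  have h4 := h.lo_le
  have h5 := h.le_j
  have hlow : ∀ x, lo ≤ x → x < p → key (g x) ≤ key (f z) := fun x hx hxp => by
    rcases hz' with hz' | hz'
    · exact h.left x z hx hxp (by omega) (by omega) hz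
    · exact h.right x z hx hxp (by omega) (by omega) hz
  refine ⟨h.dvd, by omega, by omega, by omega, by omega, by omega, fun x y hxy hy hb => ?_,
    fun x y hx hxp hy hy' hyN => ?_, fun x y hx hxp hy hy' hyN => ?_, fun x hx => ?_,
    fun x y hxy hy => ?_⟩
  · by_cases hyp : y = p
    · subst hyp
      have hlo := le_of_div_eq h.dvd (by omega) hp hb
      by_cases hx : x = y
      · rw [hx]
      · rw [hgp, hg x (by omega)]
        exact hlow x hlo (by omega)
    · rw [hg x (by omega), hg y (by omega)]
      exact h.sorted x y hxy (by omega) hb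
  · by_cases hxp' : x = p
    · rw [hxp', hgp]
      exact hleft y hy hy' hyN
    · rw [hg x (by omega)]
      exact h.left x y hx (by omega) (by omega) hy' hyN
  · by_cases hxp' : x = p
    · rw [hxp', hgp]
      exact hright y hy hy' hyN
    · rw [hg x (by omega)]
      exact h.right x y hx (by omega) (by omega) hy' hyN
  · by_cases hxp : x = p
    · exact ⟨z, hz, by omega, hxp ▸ hgp⟩
    · obtain ⟨y, hy, hy', he⟩ := h.content x (by omega)
      exact ⟨y, hy, by omega, (hg x (by omega)).trans he⟩
  · by_cases hyp : y = p
    · subst hyp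
      rw [hgp, hg x hxy]
      obtain ⟨y', hy', hy2, he⟩ := h.content x hxy
      rw [he]
      -- What has been written comes from consumed positions, and `z` is not yet consumed.
      have hne : y' ≠ z := by omega
      rcases lt_or_gt_of_ne hne with hlt | hlt
      · exact hf.inj _ _ hlt hz
      · exact (hf.inj _ _ hlt hy').symm
    · rw [hg x (by omega), hg y (by omega)]
      exact h.inj x y hxy (by omega)

theorem Merging.takeLeft (h : Merging key N w f g p lo i j) (hp : p < lo + 2 * w)
    (hf : BlockSorted key N w f) (hpN : p < N) (hi : i < lo + w)
    (hle : j < lo + 2 * w → j < N → key (f i) ≤ key (f j)) (hg : ∀ x < p, g' x = g x)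
    (hgp : g' p = f i) : Merging key N w f g' (p + 1) lo (i + 1) j := by
  have h3 := h.count
  have h4 := h.lo_le
  have h5 := h.le_j
  have hd : w ∣ lo := (Dvd.intro_left 2 rfl).trans h.dvd
  refine h.append hp hf hg (by omega) hgp (Or.inl ⟨rfl, hi, rfl, rfl⟩)
    (fun y hy hy' hyN => ?_) fun y hy hy' hyN => ?_
  · exact hf.le_of_block hd h4 (by omega) hy' hyN
  · refine (hle (by omega) (by omega)).trans ?_
    exact hf.le_of_block (lo := lo + w) (hd.add dvd_rfl) h5 hy (by omega) hyN

theorem Merging.takeRight (h : Merging key N w f g p lo i j) (hp : p < lo + 2 * w)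
    (hf : BlockSorted key N w f) (hpN : p < N)
    (hc : i = lo + w ∨ (j < lo + 2 * w ∧ j < N ∧ key (f j) ≤ key (f i)))
    (hg : ∀ x < p, g' x = g x)
    (hgp : g' p = f j) : Merging key N w f g' (p + 1) lo i (j + 1) := by
  have h3 := h.count
  have h4 := h.lo_le
  have h5 := h.le_j
  have hd : w ∣ lo := (Dvd.intro_left 2 rfl).trans h.dvd
  refine h.append hp hf hg (by omega) hgp (Or.inr ⟨rfl, by omega, rfl, rfl⟩)
    (fun y hy hy' hyN => ?_) fun y hy hy' hyN => ?_
  · rcases hc with hc | hc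
    · omega
    · exact hc.2.2.trans (hf.le_of_block hd h4 hy hy' hyN)
  · exact hf.le_of_block (lo := lo + w) (hd.add dvd_rfl) h5 (by omega) (by omega) hyN

theorem Merging.finish (h : Merging key N w f g N lo i j) (hf : BlockSorted key N w f) :
    BlockSorted key N (2 * w) g :=
  ⟨fun x hx => by
    obtain ⟨y, hy, -, he⟩ := h.content x hx
    rw [he]; exact hf.range y hy, h.inj, h.sorted⟩

theorem BlockSorted.exists_perm (hf : BlockSorted key N w f) (hw : N ≤ w) :
    ∃ σ : Equiv.Perm (Fin N), (∀ r : Fin N, f r = (σ r : ℕ)) ∧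
      ∀ r s : Fin N, r ≤ s → key (σ r : ℕ) ≤ key (σ s : ℕ) := by
  choose! φ hφ hφ' using hf.range
  have hinj : Function.Injective fun r : Fin N => (⟨φ r, hφ r r.2⟩ : Fin N) := by
    intro r s hrs
    have he : φ r = φ s := congrArg Fin.val hrs
    by_contra hne
    rcases lt_or_gt_of_ne hne with h | h
    · exact hf.inj r s h s.2 (by rw [hφ' r r.2, hφ' s s.2, he])
    · exact hf.inj s r h r.2 (by rw [hφ' r r.2, hφ' s s.2, he])
  refine ⟨Equiv.ofBijective _ (Finite.injective_iff_bijective.1 hinj), fun r => hφ' r r.2,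
    fun r s hrs => ?_⟩
  have := hf.sorted r s hrs s.2 (by rw [Nat.div_eq_of_lt (by omega), Nat.div_eq_of_lt (by omega)])
  rwa [hφ' r r.2, hφ' s s.2] at this

-- The names abbreviate numerals, so that `decide` can tell them apart. Variables and arrays are
-- numbered independently: `vLen` and `arrTmp` do not clash.
notation "vLen" => (20 : ℕ)
notation "vWidth" => (21 : ℕ)
notation "vPos" => (22 : ℕ)
notation "vLeft" => (23 : ℕ)
notation "vMid" => (24 : ℕ)
notation "vRight" => (25 : ℕ)
notation "vHigh" => (26 : ℕ)
notation "arrTmp" => (20 : ℕ)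

/-- One step of a merging pass. -/
def mergeStep (K P : ℕ) : Cmd :=
  .seq
    (.cond (.le (.var vHigh) (.var vPos))
      (.seq (.assign vLeft (.var vPos))
      (.seq (.assign vMid (.add (.var vPos) (.var vWidth)))
      (.seq (.assign vRight (.var vMid))
        (.assign vHigh (.add (.var vMid) (.var vWidth))))))
      .skip)
    (.cond (.and (.lt (.var vLeft) (.var vMid))
        (.not (.and (.and (.lt (.var vRight) (.var vHigh)) (.lt (.var vRight) (.var vLen)))
          (.lt (.get K (.get P (.var vRight))) (.get K (.get P (.var vLeft)))))))
      (.seq (.store arrTmp (.var vPos) (.get P (.var vLeft)))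
        (.assign vLeft (.add (.var vLeft) (.const 1))))
      (.seq (.store arrTmp (.var vPos) (.get P (.var vRight)))
        (.assign vRight (.add (.var vRight) (.const 1)))))

/-- Merge all pairs of neighbouring blocks, and double the block length. -/
def mergePass (K P : ℕ) : Cmd :=
  .seq (.seq (.assign vLeft (.const 0))
    (.seq (.assign vMid (.var vWidth))
    (.seq (.assign vRight (.var vWidth))
      (.assign vHigh (.add (.var vWidth) (.var vWidth))))))
  (.seq (.forUp vPos vLen (mergeStep K P))
  (.seq (.forUp vPos vLen (.store P (.var vPos) (.get arrTmp (.var vPos))))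
    (.assign vWidth (.add (.var vWidth) (.var vWidth)))))

/-- Store in array `P` a permutation of `0, …, vLen - 1` that sorts the values in array `K`. -/
def mergeSort (K P : ℕ) : Cmd :=
  .seq (.forUp vPos vLen (.store P (.var vPos) (.var vPos)))
  (.seq (.assign vWidth (.const 1))
    (.loop (.lt (.var vWidth) (.var vLen)) (mergePass K P)))

/-! ### Correctness and running time of merge sort -/

section

variable {K P : ℕ}

theorem vars_mergeStep :
    (mergeStep K P).vars = [vLeft, vMid, vRight, vHigh, vLeft, vRight] := rfl

theorem vars_mergePass : (mergePass K P).vars =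
    [vLeft, vMid, vRight, vHigh, vPos, vLeft, vMid, vRight, vHigh, vLeft, vRight, vPos, vPos, vPos,
      vWidth] := rfl

theorem vars_mergeSort :
    (mergeSort K P).vars = [vPos, vPos, vWidth] ++ (mergePass K P).vars := rfl

theorem mergeStep_spec {s : State}
    {key : ℤ → ℤ} (hkey : s.arr K = key) (hw : 0 < w) (hf : BlockSorted key N w f) (hpN : p < N)
    (hfs : ∀ x : ℕ, s.arr P x = f x) (hsp : s.var vPos = p) (hsw : s.var vWidth = w)
    (hsN : s.var vLen = N) (hs1 : s.var vLeft = i) (hs2 : s.var vMid = (lo + w : ℕ))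
    (hs3 : s.var vRight = j) (hs4 : s.var vHigh = (lo + 2 * w : ℕ))
    (h : Merging key N w f (fun x => s.arr arrTmp x) p lo i j) :
    Runs (mergeStep K P) (mergeStep K P).bound s fun s' =>
      ∃ lo i j : ℕ, s'.var vLeft = i ∧ s'.var vMid = (lo + w : ℕ) ∧ s'.var vRight = j ∧
        s'.var vHigh = (lo + 2 * w : ℕ) ∧
        Merging key N w f (fun x => s'.arr arrTmp x) (p + 1) lo i j := by
  apply Runs.of_wp
  -- The choice between the two blocks, when `p` lies before the end of the current pair. It is used
  -- both directly and after a move to the next pair.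
  have hcore : ∀ (s : State) (lo i j : ℕ), s.arr K = key → (∀ x : ℕ, s.arr P x = f x) →
      s.var vPos = p → s.var vLen = N → s.var vLeft = i → s.var vMid = (lo + w : ℕ) →
      s.var vRight = j → s.var vHigh = (lo + 2 * w : ℕ) → p < lo + 2 * w →
      Merging key N w f (fun x => s.arr arrTmp x) p lo i j →
      Cmd.wp (.cond (.and (.lt (.var vLeft) (.var vMid))
        (.not (.and (.and (.lt (.var vRight) (.var vHigh)) (.lt (.var vRight) (.var vLen)))
          (.lt (.get K (.get P (.var vRight))) (.get K (.get P (.var vLeft)))))))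
      (.seq (.store arrTmp (.var vPos) (.get P (.var vLeft)))
        (.assign vLeft (.add (.var vLeft) (.const 1))))
      (.seq (.store arrTmp (.var vPos) (.get P (.var vRight)))
        (.assign vRight (.add (.var vRight) (.const 1))))) (fun s' =>
      ∃ lo i j : ℕ, s'.var vLeft = i ∧ s'.var vMid = (lo + w : ℕ) ∧ s'.var vRight = j ∧
        s'.var vHigh = (lo + 2 * w : ℕ) ∧
        Merging key N w f (fun x => s'.arr arrTmp x) (p + 1) lo i j) s := by
    intro s lo i j hkey hfs hsp hsN hs1 hs2 hs3 hs4 hp h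
    have h1 := h.i_le
    refine ⟨fun ht => ⟨lo, i + 1, j, ?_⟩, fun ht => ⟨lo, i, j + 1, ?_⟩⟩
    · simp only [Test.Holds, Test.lt_holds, Expr.eval, hkey, hfs, hsN, hs1, hs2, hs3, hs4] at ht
      refine ⟨by simp [Expr.eval, hs1], by simp [hs2], by simp [hs3], by simp [hs4], ?_⟩
      refine h.takeLeft hp hf hpN (by omega) (fun h1 h2 => ?_) (fun x hx => ?_) ?_
      · by_contra hlt
        exact ht.2 ⟨⟨by omega, by omega⟩, by omega⟩
      · have : (x : ℤ) ≠ p := by omega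
        simp [Expr.eval, hsp, this]
      · simp [Expr.eval, hsp, hs1, hfs]
    · simp only [Test.Holds, Test.lt_holds, Expr.eval, hkey, hfs, hsN, hs1, hs2, hs3, hs4] at ht
      refine ⟨by simp [hs1], by simp [hs2], by simp [Expr.eval, hs3], by simp [hs4], ?_⟩
      refine h.takeRight hp hf hpN (by omega) (fun x hx => ?_) ?_
      · have : (x : ℤ) ≠ p := by omega
        simp [Expr.eval, hsp, this]
      · simp [Expr.eval, hsp, hs3, hfs]
  refine ⟨fun ht => ?_, fun ht => ?_⟩
  · simp only [Test.Holds, Expr.eval, hs4, hsp] at ht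
    refine hcore _ p p (p + w) ?_ ?_ ?_ ?_ ?_ ?_ ?_ ?_ (by omega) (h.nextBlock (by omega)) <;>
      simp [Expr.eval, hkey, hfs, hsp, hsN, hsw]
    ring
  · simp only [Test.Holds, Expr.eval, hs4, hsp] at ht
    exact hcore s lo i j hkey hfs hsp hsN hs1 hs2 hs3 hs4 (by omega) h

theorem mergePass_spec (hK : K ≠ arrTmp) (hP : P ≠ arrTmp) {s : State}
    (hw : 0 < w) (hsw : s.var vWidth = w) (hsN : s.var vLen = N)
    (hf : BlockSorted (s.arr K) N w fun x => s.arr P x) :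
    Runs (mergePass K P) (((mergeStep K P).bound + 50) * (N + 1)) s fun s' =>
      s'.var vWidth = (2 * w : ℕ) ∧ BlockSorted (s.arr K) N (2 * w) fun x => s'.arr P x := by
  have hpre : Runs (.seq (.assign vLeft (.const 0))
      (.seq (.assign vMid (.var vWidth))
      (.seq (.assign vRight (.var vWidth))
        (.assign vHigh (.add (.var vWidth) (.var vWidth)))))) 10 s fun s' =>
      s'.var vLeft = (0 : ℕ) ∧ s'.var vMid = (0 + w : ℕ) ∧ s'.var vRight = w ∧
        s'.var vHigh = (0 + 2 * w : ℕ) := by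
    refine (Runs.of_wp ?_).mono ?_ fun _ _ h => h
    · simp [Cmd.wp, Expr.eval, hsw]
      ring
    · simp [Cmd.bound, Expr.cost]
  refine Runs.mono (Runs.seq hpre fun s₁ hf₁ h₁ => Runs.seq
    (Runs.forUp (N := N) (K := (mergeStep K P).bound) (Inv := fun p s' => ∃ lo i j : ℕ,
      s'.var vLeft = i ∧ s'.var vMid = (lo + w : ℕ) ∧ s'.var vRight = j ∧
        s'.var vHigh = (lo + 2 * w : ℕ) ∧
        Merging (s.arr K) N w (fun x => s.arr P x) (fun x => s'.arr arrTmp x) p lo i j)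
      ?_ ?_ ?_ ?_ ?_) fun s₂ hf₂ h₂ => Runs.seq
    (Runs.forUp (N := N) (K := 4) (Inv := fun p s' => ∀ x : ℕ, x < p →
      s'.arr P x = s₂.arr arrTmp x) ?_ ?_ ?_ ?_ ?_) fun s₃ hf₃ h₃ => ?_)
    (k := 10 + (((mergeStep K P).bound + 9) * N + 7 + ((4 + 9) * N + 7 + 4))) ?_ fun _ _ h => h
  · rw [hf₁.var _ (by decide), hsN]
  · simp [vars_mergeStep]
  · simp [vars_mergeStep]
  · exact ⟨0, 0, w, by simp [h₁.1], by simp [h₁.2.1], by simp [h₁.2.2.1], by simp [h₁.2.2.2],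
      Merging.init _ _ _ _ _⟩
  · rintro p s' hp hsp hF ⟨lo, i, j, h1, h2, h3, h4, h5⟩
    have hPa : P ∉ (Cmd.forUp vPos vLen (mergeStep K P)).arrs := by
      simp [Cmd.arrs_forUp, mergeStep, Cmd.arrs, hP]
    have hKa : K ∉ (Cmd.forUp vPos vLen (mergeStep K P)).arrs := by
      simp [Cmd.arrs_forUp, mergeStep, Cmd.arrs, hK]
    have hv1 : s'.var vWidth = w := by
      rw [hF.var _ (by simp [Cmd.vars_forUp, vars_mergeStep]), hf₁.var _ (by decide), hsw]
    have hv2 : s'.var vLen = N := by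
      rw [hF.var _ (by simp [Cmd.vars_forUp, vars_mergeStep]), hf₁.var _ (by decide), hsN]
    refine (mergeStep_spec (key := s.arr K) ?_ hw hf hp ?_ hsp hv1 hv2 h1 h2 h3 h4
      h5).mono le_rfl fun s'' _ h => by simpa using h
    · rw [hF.arr _ hKa, hf₁.arr _ (by simp [Cmd.arrs])]
    · intro x
      rw [hF.arr _ hPa, hf₁.arr _ (by simp [Cmd.arrs])]
  · rw [hf₂.var _ (by simp [Cmd.vars_forUp, vars_mergeStep]), hf₁.var _ (by decide), hsN]
  · simp [Cmd.vars]
  · simp [Cmd.vars]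
  · simp
  · intro p s' hp hsp hF hI
    refine (Runs.of_wp ?_).mono (by simp [Cmd.bound, Expr.cost]) fun _ _ h => h
    intro x hx
    have hT : s'.arr arrTmp = s₂.arr arrTmp :=
      hF.arr _ (by simp [Cmd.arrs_forUp, Cmd.arrs, hP.symm])
    by_cases hxp : x = p
    · simp [Expr.eval, hsp, hxp, hT]
    · have : (x : ℤ) ≠ p := by omega
      simp [Expr.eval, hsp, this, hI x (by omega)]
  · obtain ⟨lo, i, j, -, -, -, -, h5⟩ := h₂
    have hfin := h5.finish hf
    have hv : s₃.var vWidth = w := by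
      rw [hf₃.var _ (by simp [Cmd.vars_forUp, Cmd.vars]),
        hf₂.var _ (by simp [Cmd.vars_forUp, vars_mergeStep]), hf₁.var _ (by decide), hsw]
    refine (Runs.of_wp (c := .assign vWidth (.add (.var vWidth) (.var vWidth))) ?_).mono
      (by simp [Cmd.bound, Expr.cost]) fun _ _ h => h
    refine ⟨by simp [Expr.eval, hv]; ring, ?_⟩
    refine ⟨fun x hx => ?_, fun x y hxy hy => ?_, fun x y hxy hy hb => ?_⟩ <;>
      simp only [State.setVar_arr]
    · rw [h₃ x hx]; exact hfin.range x hx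
    · rw [h₃ x (by omega), h₃ y hy]; exact hfin.inj x y hxy hy
    · rw [h₃ x (by omega), h₃ y hy]; exact hfin.sorted x y hxy hy hb
  · nlinarith [Nat.zero_le ((mergeStep K P).bound)]

/-- After `i` passes the blocks have length `2 ^ i`. A further pass is made only if `2 ^ i < N`, so
at most `Nat.log 2 N + 1` passes of linear cost are made. -/
theorem mergeSort_spec (hKP : K ≠ P) (hK : K ≠ arrTmp) (hP : P ≠ arrTmp) {s : State}
    (hsN : s.var vLen = N) :
    Runs (mergeSort K P) (((mergeStep K P).bound + 80) * ((N + 1) * (Nat.log 2 N + 1))) s fun s' =>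
      ∃ σ : Equiv.Perm (Fin N), (∀ r : Fin N, s'.arr P r = (σ r : ℕ)) ∧
        ∀ r t : Fin N, r ≤ t → s.arr K (σ r : ℕ) ≤ s.arr K (σ t : ℕ) := by
  refine Runs.mono (Runs.seq
    (Runs.forUp (N := N) (K := 3) (Inv := fun p s' => ∀ x : ℕ, x < p →
      s'.arr P x = x) ?_ ?_ ?_ ?_ ?_) fun s₁ hf₁ h₁ => Runs.seq
    (Runs.of_wp (Q := fun s' => s'.var vWidth = (1 : ℕ)) ?_) fun s₂ hf₂ h₂ =>
    (Runs.loop (B := Nat.log 2 N + 1) (K := ((mergeStep K P).bound + 50) * (N + 1))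
      (Inv := fun i s' => s'.var vWidth = (2 ^ i : ℕ) ∧
        BlockSorted (s.arr K) N (2 ^ i) fun x => s'.arr P x) ?_ ?_)) ?_ ?_
  · exact hsN
  · simp [Cmd.vars]
  · simp [Cmd.vars]
  · simp
  · intro p s' hp hsp hF hI
    refine (Runs.of_wp ?_).mono (by simp [Cmd.bound, Expr.cost]) fun _ _ h => h
    intro x hx
    by_cases hxp : x = p
    · simp [Expr.eval, hsp, hxp]
    · have : (x : ℤ) ≠ p := by omega
      simp [Expr.eval, hsp, this, hI x (by omega)]
  · simp [Cmd.wp, Expr.eval]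
  · refine ⟨by simpa using h₂, ?_⟩
    rw [hf₂.arr _ (by simp [Cmd.arrs])]
    refine ⟨fun x hx => ⟨x, hx, h₁ x hx⟩, fun x y hxy hy => ?_, fun x y hxy hy hb => ?_⟩
    · rw [h₁ x (by omega), h₁ y hy]
      omega
    · simp only [pow_zero, Nat.div_one] at hb
      rw [hb]
  · rintro i s' hF ⟨hw, hI⟩ ht
    have hv : s'.var vLen = N := by
      rw [hF.var _ (by simp [vars_mergePass]), hf₂.var _ (by decide),
        hf₁.var _ (by simp [Cmd.vars_forUp, Cmd.vars]), hsN]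
    have hKa : s'.arr K = s.arr K := by
      rw [hF.arr _ (by simp [mergePass, mergeStep, Cmd.arrs, Cmd.arrs_forUp, hK, hKP]),
        hf₂.arr _ (by simp [Cmd.arrs]), hf₁.arr _ (by simp [Cmd.arrs, Cmd.arrs_forUp, hKP])]
    simp only [Test.lt_holds, Expr.eval, hw, hv] at ht
    have ht' : 2 ^ i < N := by exact_mod_cast ht
    refine ⟨Nat.lt_succ_of_le (Nat.le_log_of_pow_le (by norm_num) ht'.le), ?_⟩
    rw [← hKa] at hI ⊢
    refine (mergePass_spec hK hP (by positivity) hw hv hI).mono le_rfl fun s'' _ h => ?_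
    rw [pow_succ']
    exact h
  · simp only [Cmd.bound, Expr.cost, Test.cost, Test.lt]
    have h1 : 1 ≤ (N + 1) * (Nat.log 2 N + 1) := Nat.mul_pos (by omega) (by omega)
    have h2 : N ≤ (N + 1) * (Nat.log 2 N + 1) := by nlinarith
    have h3 : Nat.log 2 N + 1 ≤ (N + 1) * (Nat.log 2 N + 1) := by nlinarith
    calc _ = ((mergeStep K P).bound + 50) * ((N + 1) * (Nat.log 2 N + 1)) +
        (12 * N + 5 * (Nat.log 2 N + 1) + 14) := by ring
      _ ≤ _ := by nlinarith
  · rintro s' hF ⟨i, ⟨hw, hI⟩, ht⟩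
    have hv : s'.var vLen = N := by
      rw [← hsN]
      exact hF.var _ (by simp [vars_mergeSort, vars_mergePass])
    simp only [Test.lt_holds, Expr.eval, hw, hv] at ht
    exact hI.exists_perm (by exact_mod_cast not_lt.1 ht)

end

end ExactDelay

namespace ExactDelay

/-! ### Union-find -/

section Forest

variable {N : ℕ}

/-- The parent function `p` and the sizes `z` of subtrees represent the equivalence
relation `R`. -/
structure IsForest (p : Fin N → Fin N) (z : Fin N → ℕ) (R : Setoid (Fin N)) : Prop where
  pos : ∀ x, 1 ≤ z x
  double : ∀ x, p x ≠ x → 2 * z x ≤ z (p x)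
  total : ∑ x, (if p x = x then z x else 0) = N
  rel : ∀ x, R x (p x)
  root : ∀ x y, p x = x → p y = y → R x y → x = y

variable {p : Fin N → Fin N} {z : Fin N → ℕ} {R : Setoid (Fin N)}

theorem IsForest.init : IsForest (id : Fin N → Fin N) (fun _ => 1) (linked ∅) where
  pos _ := le_rfl
  double x h := absurd rfl h
  total := by simp
  rel x := Setoid.refl' _ _
  root x y _ _ h := linked_le (r := ⊥) (fun p hp => absurd hp (Set.notMem_empty p)) h

/-- Sizes grow strictly from a node to its parent, so the largest size belongs to a root, and the
sizes of the roots add up to `N`. -/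
theorem IsForest.le_card (h : IsForest p z R) (x : Fin N) : z x ≤ N := by
  obtain ⟨y, -, hy⟩ := Finset.exists_max_image Finset.univ z ⟨x, Finset.mem_univ x⟩
  refine (hy x (Finset.mem_univ x)).trans ?_
  have hroot : p y = y := by
    by_contra hne
    have := h.double y hne
    have := hy (p y) (Finset.mem_univ _)
    have := h.pos y
    omega
  have := Finset.single_le_sum (f := fun x => if p x = x then z x else 0)
    (fun _ _ => Nat.zero_le _) (Finset.mem_univ y)
  rwa [h.total, if_pos hroot] at this

/-- The smaller tree is hung below the root of the larger one. The size stored at `rx` is frozen,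
and the new size at `ry` is at least twice as large, which preserves `double`. -/
theorem IsForest.unite (h : IsForest p z R) {x y rx ry : Fin N} (hx : R x rx) (hy : R y ry)
    (hrx : p rx = rx) (hry : p ry = ry) (hne : rx ≠ ry) (hz : z rx ≤ z ry) :
    IsForest (Function.update p rx ry) (Function.update z ry (z rx + z ry))
      (mergeClasses R x y) := by
  have hz' : ∀ x, z x ≤ Function.update z ry (z rx + z ry) x := by
    intro x
    by_cases hx : x = ry
    · subst hx; simp
    · simp [hx]
  refine ⟨fun x => (h.pos x).trans (hz' x), fun u hu => ?_, ?_, fun u => ?_,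
    fun u v hu hv huv => ?_⟩
  · by_cases h1 : u = rx
    · subst h1
      simp only [Function.update_self, Function.update_of_ne hne]
      omega
    · rw [Function.update_of_ne h1] at hu ⊢
      have h2 : u ≠ ry := by rintro rfl; exact hu hry
      rw [Function.update_of_ne h2]
      exact (h.double u hu).trans (hz' _)
  · refine Eq.trans ?_ h.total
    have hsplit : ∀ f : Fin N → ℕ, ∑ r, f r = f rx + (f ry +
        ∑ r ∈ (Finset.univ.erase rx).erase ry, f r) := fun f => by
      rw [Finset.add_sum_erase _ _ (Finset.mem_erase.2 ⟨hne.symm, Finset.mem_univ _⟩),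
        Finset.add_sum_erase _ _ (Finset.mem_univ _)]
    rw [hsplit, hsplit fun x => if p x = x then z x else 0]
    simp only [Function.update_self, hrx, hry, if_true, if_neg hne.symm,
      Function.update_of_ne hne.symm]
    rw [zero_add, ← add_assoc]
    congr 1
    refine Finset.sum_congr rfl fun u hu => ?_
    simp only [Finset.mem_erase, Finset.mem_univ, and_true] at hu
    rw [Function.update_of_ne hu.1, Function.update_of_ne hu.2]
  · by_cases h1 : u = rx
    · subst h1
      rw [Function.update_self]
      exact Or.inr (Or.inl ⟨Setoid.symm' _ hx, hy⟩)
    · rw [Function.update_of_ne h1]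
      exact Or.inl (h.rel u)
  · have hnr : ∀ u, Function.update p rx ry u = u → u ≠ rx ∧ p u = u := by
      intro u hu
      by_cases h1 : u = rx
      · subst h1
        rw [Function.update_self] at hu
        exact absurd hu.symm hne
      · rw [Function.update_of_ne h1] at hu
        exact ⟨h1, hu⟩
    obtain ⟨hu1, hu2⟩ := hnr u hu
    obtain ⟨hv1, hv2⟩ := hnr v hv
    rcases huv with h1 | ⟨h1, h2⟩ | ⟨h1, h2⟩
    · exact h.root u v hu2 hv2 h1
    · exact absurd (h.root u rx hu2 hrx (Setoid.trans' _ h1 hx)) hu1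
    · exact absurd (h.root v rx hv2 hrx (Setoid.trans' _ (Setoid.symm' _ h2) hx)) hv1

theorem mergeClasses_comm {V : Type*} (R : Setoid V) (x y : V) :
    mergeClasses R x y = mergeClasses R y x := by
  ext u v
  change (_ ∨ _ ∨ _) ↔ (_ ∨ _ ∨ _)
  tauto

theorem mergeClasses_of_rel {V : Type*} {R : Setoid V} {x y : V} (h : R x y) :
    mergeClasses R x y = R := by
  ext u v
  refine ⟨?_, Or.inl⟩
  rintro (h1 | ⟨h1, h2⟩ | ⟨h1, h2⟩)
  · exact h1
  · exact Setoid.trans' _ h1 (Setoid.trans' _ h h2)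
  · exact Setoid.trans' _ h1 (Setoid.trans' _ (Setoid.symm' _ h) h2)

theorem mergeClasses_linked {V : Type*} (E : Set (V × V)) (x y : V) :
    mergeClasses (linked E) x y = linked (insert (x, y) E) := by
  ext u v
  exact linked_insert.symm

end Forest

notation "vFlag" => (7 : ℕ)
notation "vX" => (8 : ℕ)
notation "vY" => (9 : ℕ)
notation "arrParent" => (12 : ℕ)
notation "arrSize" => (13 : ℕ)

/-- `e = f`. -/
def Test.eq (e f : Expr) : Test := .and (.le e f) (.le f e)

@[simp] theorem Test.eq_holds (e f : Expr) (s : State) :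
    (Test.eq e f).Holds s ↔ e.eval s = f.eval s := by
  simp [Test.eq, Test.Holds, le_antisymm_iff]

/-- Replace the node in variable `x` by the root of its tree. -/
def findRoot (x : ℕ) : Cmd :=
  .loop (.not (.eq (.get arrParent (.var x)) (.var x))) (.assign x (.get arrParent (.var x)))

/-- Compare the roots in `vX` and `vY`, and link them if they are different. -/
def linkRoots : Cmd :=
  .cond (.eq (.var vX) (.var vY)) (.assign vFlag (.const 0))
    (.seq (.assign vFlag (.const 1))
      (.cond (.le (.get arrSize (.var vX)) (.get arrSize (.var vY)))
        (.seq (.store arrSize (.var vY)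
            (.add (.get arrSize (.var vX)) (.get arrSize (.var vY))))
          (.store arrParent (.var vX) (.var vY)))
        (.seq (.store arrSize (.var vX)
            (.add (.get arrSize (.var vY)) (.get arrSize (.var vX))))
          (.store arrParent (.var vY) (.var vX)))))

/-- Merge the classes of the nodes in `vX` and `vY`; `vFlag` tells whether they were different. -/
def unite : Cmd := .seq (findRoot vX) (.seq (findRoot vY) linkRoots)

/-- The arrays hold a forest that represents `R`. -/
def HasForest {N : ℕ} (s : State) (R : Setoid (Fin N)) : Prop :=
  ∃ (p : Fin N → Fin N) (z : Fin N → ℕ), (∀ x : Fin N, s.arr arrParent x = (p x : ℕ)) ∧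
    (∀ x : Fin N, s.arr arrSize x = z x) ∧ IsForest p z R

/-! ### Union-find on the random access machine -/

section

variable {N : ℕ} {R : Setoid (Fin N)} {s : State}

theorem HasForest.congr {s' : State} (h : HasForest s R)
    (hp : s'.arr arrParent = s.arr arrParent) (hz : s'.arr arrSize = s.arr arrSize) :
    HasForest s' R := by
  simpa only [HasForest, hp, hz] using h

/-- Each step towards the root at least doubles the stored size, which never exceeds `N`. So at most
`Nat.log 2 N` steps are made, even without path compression. -/
theorem findRoot_spec {v : ℕ} {p : Fin N → Fin N} {z : Fin N → ℕ} (h : IsForest p z R)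
    (hp : ∀ x : Fin N, s.arr arrParent x = (p x : ℕ)) {x : Fin N} (hx : s.var v = (x : ℕ)) :
    Runs (findRoot v) (20 * (Nat.log 2 N + 1)) s fun s' =>
      ∃ r : Fin N, s'.var v = (r : ℕ) ∧ R x r ∧ p r = r := by
  refine Runs.mono (Runs.loop (B := Nat.log 2 N) (K := 4) (Inv := fun i s' =>
    ∃ r : Fin N, s'.var v = (r : ℕ) ∧ R x r ∧ 2 ^ i ≤ z r) ⟨x, hx, Setoid.refl' _ _, ?_⟩ ?_) ?_ ?_
  · simpa using h.pos x
  · rintro i s' hF ⟨r, h1, h2, h3⟩ ht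
    have hP : s'.arr arrParent = s.arr arrParent := hF.arr _ (by simp [Cmd.arrs])
    simp only [Test.Holds, Test.eq_holds, Expr.eval, hP, h1, hp, Nat.cast_inj] at ht
    have hne : p r ≠ r := fun h => ht (congrArg Fin.val h)
    have h4 := h.double r hne
    have h5 : 2 ^ (i + 1) ≤ z (p r) := by rw [pow_succ']; omega
    refine ⟨Nat.le_log_of_pow_le (by norm_num) (h5.trans (h.le_card _)), ?_⟩
    refine (Runs.of_wp ?_).mono (by simp [Cmd.bound, Expr.cost]) fun _ _ h => h
    exact ⟨p r, by simp [Expr.eval, hP, h1, hp], Setoid.trans' _ h2 (h.rel r), h5⟩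
  · simp only [Test.cost, Test.eq, Expr.cost]
    omega
  · rintro s' hF ⟨i, ⟨r, h1, h2, h3⟩, ht⟩
    have hP : s'.arr arrParent = s.arr arrParent := hF.arr _ (by simp [findRoot, Cmd.arrs])
    simp only [Test.Holds, Test.eq_holds, Expr.eval, hP, h1, hp, Nat.cast_inj, not_not] at ht
    exact ⟨r, h1, h2, Fin.ext ht⟩

theorem linkRoots_spec {p : Fin N → Fin N} {z : Fin N → ℕ} (h : IsForest p z R)
    (hp : ∀ x : Fin N, s.arr arrParent x = (p x : ℕ)) (hz : ∀ x : Fin N, s.arr arrSize x = z x)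
    {x y rx ry : Fin N} (hx : R x rx) (hy : R y ry) (hrx : p rx = rx) (hry : p ry = ry)
    (hvx : s.var vX = (rx : ℕ)) (hvy : s.var vY = (ry : ℕ)) :
    Runs linkRoots linkRoots.bound s fun s' => HasForest s' (mergeClasses R x y) ∧
      ((R x y ∧ s'.var vFlag = 0) ∨ (¬ R x y ∧ s'.var vFlag = 1)) := by
  have hiff : rx = ry ↔ R x y := by
    constructor
    · rintro rfl
      exact Setoid.trans' _ hx (Setoid.symm' _ hy)
    · exact fun h' => h.root _ _ hrx hry
        (Setoid.trans' _ (Setoid.symm' _ hx) (Setoid.trans' _ h' hy))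
  have hcast : ∀ u v : Fin N, ((u : ℕ) : ℤ) = (v : ℕ) ↔ u = v := fun u v => by
    rw [Nat.cast_inj, Fin.ext_iff]
  apply Runs.of_wp
  refine ⟨fun ht => ?_, fun ht => ?_⟩
  · simp only [Test.eq_holds, Expr.eval, hvx, hvy, hcast, hiff] at ht
    refine ⟨?_, Or.inl ⟨ht, by simp [Expr.eval]⟩⟩
    rw [mergeClasses_of_rel ht]
    exact ⟨p, z, hp, hz, h⟩
  · simp only [Test.eq_holds, Expr.eval, hvx, hvy, hcast] at ht
    have hnR : ¬ R x y := mt hiff.2 ht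
    refine ⟨fun hle => ⟨⟨_, _, ?_, ?_, h.unite hx hy hrx hry ht ?_⟩, Or.inr ⟨hnR, ?_⟩⟩,
      fun hle => ⟨?_, Or.inr ⟨hnR, ?_⟩⟩⟩
    · intro u
      by_cases hu : u = rx
      · subst hu; simp [Expr.eval, hvx, hvy]
      · simp [Expr.eval, hvx, hvy, hcast, hu, hp]
    · intro u
      by_cases hu : u = ry
      · subst hu; simp [Expr.eval, hvx, hvy, hz]
      · simp [Expr.eval, hvx, hvy, hcast, hu, hz]
    · simpa [Test.Holds, Expr.eval, hvx, hvy, hz] using hle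
    · simp [Expr.eval]
    · rw [mergeClasses_comm]
      refine ⟨_, _, ?_, ?_, h.unite hy hx hry hrx (Ne.symm ht) ?_⟩
      · intro u
        by_cases hu : u = ry
        · subst hu; simp [Expr.eval, hvx, hvy]
        · simp [Expr.eval, hvx, hvy, hcast, hu, hp]
      · intro u
        by_cases hu : u = rx
        · subst hu; simp [Expr.eval, hvx, hvy, hz]
        · simp [Expr.eval, hvx, hvy, hcast, hu, hz]
      · simp [Test.Holds, Expr.eval, hvx, hvy, hz] at hle
        exact hle.le
    · simp [Expr.eval]

theorem unite_spec (h : HasForest s R) {x y : Fin N} (hx : s.var vX = (x : ℕ))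
    (hy : s.var vY = (y : ℕ)) :
    Runs unite ((linkRoots.bound + 40) * (Nat.log 2 N + 1)) s fun s' =>
      HasForest s' (mergeClasses R x y) ∧
      ((R x y ∧ s'.var vFlag = 0) ∨ (¬ R x y ∧ s'.var vFlag = 1)) := by
  obtain ⟨p, z, hp, hz, hf⟩ := h
  refine Runs.mono (Runs.seq (findRoot_spec hf hp hx) fun s₁ hf₁ ⟨rx, h1, h2, h3⟩ =>
    Runs.seq (findRoot_spec (x := y) hf ?_ ?_) fun s₂ hf₂ ⟨ry, g1, g2, g3⟩ =>
    linkRoots_spec hf ?_ ?_ h2 g2 h3 g3 ?_ g1) ?_ fun _ _ h => h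
  · rwa [hf₁.arr _ (by decide)]
  · rwa [hf₁.var _ (by decide)]
  · rwa [hf₂.arr _ (by decide), hf₁.arr _ (by decide)]
  · rwa [hf₂.arr _ (by decide), hf₁.arr _ (by decide)]
  · rwa [hf₂.var _ (by decide)]
  · nlinarith [Nat.zero_le (linkRoots.bound), Nat.zero_le (Nat.log 2 N)]

end

end ExactDelay

namespace ExactDelay

/-! ### The stages of the algorithm for equal delays -/

notation "vCount" => (0 : ℕ)
notation "vJobs" => (3 : ℕ)
notation "vNodes" => (4 : ℕ)
notation "vK" => (5 : ℕ)
notation "vTime" => (6 : ℕ)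
notation "vPass" => (10 : ℕ)
notation "vCur" => (11 : ℕ)
notation "vU" => (13 : ℕ)
notation "vV" => (14 : ℕ)
notation "arrJob" => (5 : ℕ)
notation "arrA" => (6 : ℕ)
notation "arrB" => (7 : ℕ)
notation "arrP" => (8 : ℕ)
notation "arrQ" => (9 : ℕ)
notation "arrGap" => (10 : ℕ)
notation "arrS" => (11 : ℕ)
notation "arrMark" => (14 : ℕ)
notation "arrE" => (15 : ℕ)
notation "arrNext" => (16 : ℕ)

/-- The number of steps, up to a constant factor, of a logarithmic search among `m + 1` nodes. -/
def lg (m : ℕ) : ℕ := Nat.log 2 (m + 1) + 1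

/-- The number of steps, up to a constant factor, of the algorithm on `m + 1` nodes. -/
def work (m : ℕ) : ℕ := (m + 1) * lg m

theorem one_le_lg (m : ℕ) : 1 ≤ lg m := Nat.le_add_left _ _

theorem lg_mono {m n : ℕ} (h : m ≤ n) : lg m ≤ lg n :=
  Nat.add_le_add_right (Nat.log_mono_right (by omega)) 1

theorem work_mono {m n : ℕ} (h : m ≤ n) : work m ≤ work n :=
  Nat.mul_le_mul (by omega) (lg_mono h)

theorem succ_le_work (m : ℕ) : m + 1 ≤ work m := Nat.le_mul_of_pos_right _ (one_le_lg m)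

theorem Runs.of_wp_lg {c : Cmd} {s : State} {Q : State → Prop} (m : ℕ) (h : c.wp Q s) :
    Runs c (c.bound * lg m) s Q :=
  (Runs.of_wp h).mono (Nat.le_mul_of_pos_right _ (one_le_lg m)) fun _ _ h => h

theorem Runs.of_wp_work {c : Cmd} {s : State} {Q : State → Prop} (m : ℕ) (h : c.wp Q s) :
    Runs c (c.bound * work m) s Q :=
  (Runs.of_wp h).mono (Nat.le_mul_of_pos_right _ (by have := succ_le_work m; omega))
    fun _ _ h => h

/-- The constant 16 absorbs the overhead of 9 steps per iteration and 7 steps once. -/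
theorem Runs.forUp_work {x y : ℕ} {c : Cmd} {N K m : ℕ} {s : State} {Inv : ℕ → State → Prop}
    (hNm : N ≤ m + 1) (hN : s.var y = N) (hx : x ∉ c.vars) (hy : y ≠ x ∧ y ∉ c.vars)
    (h0 : Inv 0 (s.setVar x 0))
    (hstep : ∀ (i : ℕ) (s' : State), i < N → s'.var x = i → Frame (.forUp x y c) s s' → Inv i s' →
      Runs c (K * lg m) s' (fun s'' => Inv (i + 1) (s''.setVar x (i + 1)))) :
    Runs (.forUp x y c) ((K + 16) * work m) s (Inv N) := by
  refine (Runs.forUp hN hx hy h0 hstep).mono ?_ fun _ _ h => h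
  have h1 := one_le_lg m
  calc (K * lg m + 9) * N + 7 ≤ (K * lg m + 9 * lg m) * (m + 1) + 7 * ((m + 1) * lg m) := by
        gcongr
        · omega
        · exact Nat.le_mul_of_pos_right _ (Nat.mul_pos (by omega) h1)
    _ = (K + 16) * work m := by rw [work]; ring

theorem Runs.seq_work {c d : Cmd} {k l m : ℕ} {s : State} {R Q : State → Prop}
    (h : Runs c (k * work m) s R) (h' : ∀ s', Frame c s s' → R s' → Runs d (l * work m) s' Q) :
    Runs (.seq c d) ((k + l) * work m) s Q := by
  rw [add_mul]
  exact h.seq h'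

theorem mergeSort_work {K P N m : ℕ} (hKP : K ≠ P) (hK : K ≠ arrTmp) (hP : P ≠ arrTmp) {s : State}
    (hsN : s.var vLen = N) (hN : N ≤ m + 1) :
    Runs (mergeSort K P) (2 * ((mergeStep K P).bound + 80) * work m) s fun s' =>
      ∃ σ : Equiv.Perm (Fin N), (∀ r : Fin N, s'.arr P r = (σ r : ℕ)) ∧
        ∀ r t : Fin N, r ≤ t → s.arr K (σ r : ℕ) ≤ s.arr K (σ t : ℕ) := by
  refine (mergeSort_spec hKP hK hP hsN).mono ?_ fun _ _ h => h
  rw [mul_comm 2, mul_assoc]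
  refine Nat.mul_le_mul le_rfl ?_
  rw [work, ← mul_assoc]
  -- The factor 2 comes from `N + 1 ≤ 2 * (m + 1)`.
  exact Nat.mul_le_mul (by omega) (Nat.add_le_add_right (Nat.log_mono_right hN) 1)

variable {m : ℕ} {s : State} {a b : Fin (m + 1) → ℤ} {P Q : Equiv.Perm (Fin (m + 1))}

/-! #### Sorting the nodes -/

/-- Sort the nodes by the lengths of their second and of their first operations. -/
def sortNodes : Cmd :=
  .seq (.assign vLen (.var vNodes)) (.seq (mergeSort arrB arrP) (mergeSort arrA arrQ))

/-- In this and the following stages `C` precedes `m` and the state, so it is an absolute constant.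
The proofs mostly leave its value to unification. -/
theorem sortNodes_spec : ∃ C, ∀ {m : ℕ} {s : State} {a b : Fin (m + 1) → ℤ},
    s.var vNodes = (m + 1 : ℕ) → (∀ x : Fin (m + 1), s.arr arrA x = a x) →
    (∀ x : Fin (m + 1), s.arr arrB x = b x) →
    Runs sortNodes (C * work m) s fun s' => ∃ P Q : Equiv.Perm (Fin (m + 1)),
      (∀ r : Fin (m + 1), s'.arr arrP r = (P r : ℕ)) ∧
      (∀ r : Fin (m + 1), s'.arr arrQ r = (Q r : ℕ)) ∧
      Monotone (b ∘ P) ∧ Monotone (a ∘ Q) := by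
  refine ⟨_, fun {m s a b} hN ha hb => Runs.seq_work
    (Runs.of_wp_work (Q := fun s' => s'.var vLen = (m + 1 : ℕ)) m ?_) fun s₁ hf₁ h₁ =>
    Runs.seq_work (mergeSort_work (by decide) (by decide) (by decide) h₁ le_rfl)
      fun s₂ hf₂ ⟨P, hP, hP'⟩ =>
    (mergeSort_work (N := m + 1) (by decide) (by decide) (by decide) ?_ le_rfl).mono le_rfl
      fun s₃ hf₃ ⟨Q, hQ, hQ'⟩ => ⟨P, Q, ?_, hQ, ?_, ?_⟩⟩
  · simp [Cmd.wp, Expr.eval, hN]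
  · rw [hf₂.var _ (by decide), h₁]
  · rwa [hf₃.arr _ (by decide)]
  · intro r t hrt
    have := hP' r t hrt
    rwa [hf₁.arr _ (by decide), hb, hb] at this
  · intro r t hrt
    have := hQ' r t hrt
    rwa [hf₂.arr _ (by decide), hf₁.arr _ (by decide), ha, ha] at this

/-! #### The costs of interchanges -/

/-- Compute the cost of interchanging the neighbours `vK` and `vK + 1`. -/
def gapStep : Cmd :=
  .seq (.cond (.le (.get arrA (.get arrQ (.var vK))) (.get arrB (.get arrP (.var vK))))
    (.assign vU (.get arrB (.get arrP (.var vK)))) (.assign vU (.get arrA (.get arrQ (.var vK)))))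
  (.seq (.cond (.le (.get arrA (.get arrQ (.add (.var vK) (.const 1))))
      (.get arrB (.get arrP (.add (.var vK) (.const 1)))))
    (.assign vV (.get arrA (.get arrQ (.add (.var vK) (.const 1)))))
    (.assign vV (.get arrB (.get arrP (.add (.var vK) (.const 1))))))
  (.cond (.le (.var vV) (.var vU)) (.store arrGap (.var vK) (.const 0))
    (.store arrGap (.var vK) (.sub (.var vV) (.var vU)))))

theorem gapStep_wp {k : Fin m} (hk : s.var vK = (k : ℕ))
    (ha : ∀ x : Fin (m + 1), s.arr arrA x = a x) (hb : ∀ x : Fin (m + 1), s.arr arrB x = b x)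
    (hP : ∀ r : Fin (m + 1), s.arr arrP r = (P r : ℕ))
    (hQ : ∀ r : Fin (m + 1), s.arr arrQ r = (Q r : ℕ)) :
    gapStep.wp (fun s' => s'.arr arrGap = Function.update (s.arr arrGap) (k : ℕ)
      (gapAt (a ∘ Q) (b ∘ P) k)) s := by
  have hP0 : s.arr arrP (k : ℕ) = (P k.castSucc : ℕ) := hP k.castSucc
  have hQ0 : s.arr arrQ (k : ℕ) = (Q k.castSucc : ℕ) := hQ k.castSucc
  have hP1 : s.arr arrP ((k : ℕ) + 1) = (P k.succ : ℕ) := by rw [← hP]; simp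
  have hQ1 : s.arr arrQ ((k : ℕ) + 1) = (Q k.succ : ℕ) := by rw [← hQ]; simp
  simp only [gapStep, Cmd.wp, Test.Holds, Expr.eval, State.setVar_var, State.setVar_arr,
    State.setArr_arr, hk, hP0, hQ0, ha, hb, gapAt, gap, Function.comp_apply]
  simp only [Nat.reduceEqDiff, if_false, if_true, hP1, hQ1, ha, hb]
  refine ⟨fun h => ⟨fun h' => ⟨fun h'' => ?_, fun h'' => ?_⟩,
    fun h' => ⟨fun h'' => ?_, fun h'' => ?_⟩⟩,
    fun h => ⟨fun h' => ⟨fun h'' => ?_, fun h'' => ?_⟩,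
    fun h' => ⟨fun h'' => ?_, fun h'' => ?_⟩⟩⟩ <;> congr 1 <;> omega

/-- Compute the costs of all interchanges and sort them. -/
def sortGaps : Cmd :=
  .seq (.forUp vK vJobs gapStep) (.seq (.assign vLen (.var vJobs)) (mergeSort arrGap arrS))

theorem sortGaps_spec : ∃ C, ∀ {m : ℕ} {s : State} {a b : Fin (m + 1) → ℤ}
    {P Q : Equiv.Perm (Fin (m + 1))},
    s.var vJobs = m → (∀ x : Fin (m + 1), s.arr arrA x = a x) →
    (∀ x : Fin (m + 1), s.arr arrB x = b x) →
    (∀ r : Fin (m + 1), s.arr arrP r = (P r : ℕ)) →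
    (∀ r : Fin (m + 1), s.arr arrQ r = (Q r : ℕ)) →
    Runs sortGaps (C * work m) s fun s' => ∃ S : Equiv.Perm (Fin m),
      (∀ i : Fin m, s'.arr arrS i = (S i : ℕ)) ∧
      ∀ i j, i ≤ j → gapAt (a ∘ Q) (b ∘ P) (S i) ≤ gapAt (a ∘ Q) (b ∘ P) (S j) := by
  refine ⟨_, fun {m s a b P Q} hM ha hb hP hQ => Runs.seq_work
    (Runs.forUp_work (N := m) (m := m) (K := gapStep.bound)
      (Inv := fun i s' => ∀ k : Fin m, (k : ℕ) < i →
      s'.arr arrGap (k : ℕ) = gapAt (a ∘ Q) (b ∘ P) k) (by omega) hM (by decide) (by decide)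
      (fun k hk => absurd hk (Nat.not_lt_zero _)) ?_)
    fun s₁ hf₁ h₁ => Runs.seq_work
    (Runs.of_wp_work (Q := fun s' => s'.var vLen = (m : ℕ)) m ?_) fun s₂ hf₂ h₂ =>
    (mergeSort_work (by decide) (by decide) (by decide) h₂ (by omega)).mono le_rfl
      fun s₃ hf₃ ⟨S, hS, hS'⟩ => ⟨S, hS, fun i j hij => ?_⟩⟩
  · intro i s' hi hsi hF hI
    refine (Runs.of_wp_lg m (gapStep_wp (k := ⟨i, hi⟩) hsi (a := a) (b := b) (P := P) (Q := Q)
      ?_ ?_ ?_ ?_)).mono le_rfl fun s'' _ h k hk => ?_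
    · rwa [hF.arr _ (by decide)]
    · rwa [hF.arr _ (by decide)]
    · rwa [hF.arr _ (by decide)]
    · rwa [hF.arr _ (by decide)]
    · rw [State.setVar_arr, h]
      by_cases hki : (k : ℕ) = i
      · have : k = ⟨i, hi⟩ := Fin.ext hki
        simp [this]
      · rw [Function.update_of_ne (by simpa using hki)]
        exact hI k (by omega)
  · simp only [Cmd.wp, Expr.eval, State.setVar_var, if_true]
    rw [hf₁.var _ (by decide), hM]
  · have := hS' i j hij
    rwa [hf₂.arr _ (by decide), h₁ _ (Fin.is_lt _), h₁ _ (Fin.is_lt _)] at this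

/-! #### The spanning tree -/

/-- Make every node the root of its own tree. -/
def initForest : Cmd :=
  .forUp vK vNodes (.seq (.store arrParent (.var vK) (.var vK))
    (.store arrSize (.var vK) (.const 1)))

theorem initForest_spec : ∃ C, ∀ {m : ℕ} {s : State}, s.var vNodes = (m + 1 : ℕ) →
    Runs initForest (C * work m) s fun s' => HasForest s' (linked (∅ : Set (Fin (m + 1) × _))) := by
  refine ⟨_, fun {m s} hN => (Runs.forUp_work (N := m + 1) (m := m) (Inv := fun i s' =>
    ∀ x : Fin (m + 1), (x : ℕ) < i → s'.arr arrParent x = (x : ℕ) ∧ s'.arr arrSize x = 1)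
    le_rfl hN (by decide) (by decide) (fun k hk => absurd hk (Nat.not_lt_zero _))
    fun i s' hi hsi hF hI => Runs.of_wp_lg m fun x hx => ?_).mono le_rfl fun s' _ h =>
      ⟨id, fun _ => 1, fun x => (h x x.2).1, fun x => by simpa using (h x x.2).2,
        IsForest.init⟩⟩
  by_cases hxi : (x : ℕ) = i
  · simp [Expr.eval, hsi, hxi]
  · have h1 : ((x : ℕ) : ℤ) ≠ i := by omega
    simp [Expr.eval, hsi, h1, hI x (by omega)]

/-- Merge the classes of nodes that follow each other in the optimal assignment. -/
def uniteBase : Cmd :=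
  .forUp vK vNodes
    (.seq (.seq (.assign vX (.get arrP (.var vK))) (.assign vY (.get arrQ (.var vK))))
    unite)

/-- Afterwards the classes are the cycles of `Q * P⁻¹`, which the greedy algorithm has to connect.
-/
theorem uniteBase_spec : ∃ C, ∀ {m : ℕ} {s : State} {P Q : Equiv.Perm (Fin (m + 1))},
    s.var vNodes = (m + 1 : ℕ) → (∀ r : Fin (m + 1), s.arr arrP r = (P r : ℕ)) →
    (∀ r : Fin (m + 1), s.arr arrQ r = (Q r : ℕ)) →
    HasForest s (linked (∅ : Set (Fin (m + 1) × Fin (m + 1)))) →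
    Runs uniteBase (C * work m) s fun s' => HasForest s' (linked (baseEdges P Q)) := by
  refine ⟨_, fun {m s P Q} hN hP hQ h0 => (Runs.forUp_work (N := m + 1) (m := m)
    (K := 10 + (linkRoots.bound + 40)) (Inv := fun i s' =>
      HasForest s' (linked ((fun r : Fin (m + 1) => (P r, Q r)) '' {r | (r : ℕ) < i})))
    le_rfl hN (by decide) (by decide) ?_ fun i s' hi hsi hF hI => ?_).mono le_rfl fun s' _ h => ?_⟩
  · have := h0.congr (s' := s.setVar vK 0) rfl rfl
    simpa using this
  · rw [add_mul]
    refine Runs.seq ((Runs.of_wp (Q := fun s' => s'.var vX = (P ⟨i, hi⟩ : ℕ) ∧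
      s'.var vY = (Q ⟨i, hi⟩ : ℕ)) ?_).mono (k' := 10 * lg m) ?_ fun _ _ h => h) fun s₁ hf₁ h₁ => ?_
    · have e1 : s'.arr arrP = s.arr arrP := hF.arr _ (by decide)
      have e2 : s'.arr arrQ = s.arr arrQ := hF.arr _ (by decide)
      have := hP ⟨i, hi⟩
      have := hQ ⟨i, hi⟩
      simp_all [Cmd.wp, Expr.eval]
    · have := one_le_lg m
      simp [Cmd.bound, Expr.cost]
      omega
    · have hI₁ : HasForest s₁
          (linked ((fun r : Fin (m + 1) => (P r, Q r)) '' {r | (r : ℕ) < i})) := by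
        exact hI.congr (hf₁.arr _ (by decide)) (hf₁.arr _ (by decide))
      refine (unite_spec hI₁ h₁.1 h₁.2).mono le_rfl fun s₂ _ h₂ => ?_
      have h3 := h₂.1
      rw [mergeClasses_linked] at h3
      have hset : {r : Fin (m + 1) | (r : ℕ) < i + 1} =
          insert ⟨i, hi⟩ {r : Fin (m + 1) | (r : ℕ) < i} := by
        ext r
        simp only [Set.mem_ofPred_eq, Set.mem_insert_iff, Fin.ext_iff]
        omega
      rw [hset, Set.image_insert_eq]
      exact h3
  · have hset : {r : Fin (m + 1) | (r : ℕ) < m + 1} = Set.univ := by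
      ext r; simp [Fin.is_le]
    rwa [hset, Set.image_univ] at h

/-- Consider the interchanges by increasing cost, and mark those that merge two classes. -/
def greedy : Cmd :=
  .forUp vK vJobs (.seq
    (.seq (.assign vU (.get arrS (.var vK))) (.seq (.assign vX (.get arrP (.var vU)))
      (.assign vY (.get arrP (.add (.var vU) (.const 1))))))
    (.seq unite (.store arrMark (.var vU) (.var vFlag))))

/-- Kruskal's algorithm. The forest represents connectivity by all edges considered so far, as
uniting the ends of a rejected edge changes nothing; this is the relation by which `IsGreedy`
decides. -/
theorem greedy_spec : ∃ C, ∀ {m : ℕ} {s : State} {P Q : Equiv.Perm (Fin (m + 1))}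
    {S : Equiv.Perm (Fin m)},
    s.var vJobs = m → (∀ r : Fin (m + 1), s.arr arrP r = (P r : ℕ)) →
    (∀ i : Fin m, s.arr arrS i = (S i : ℕ)) → HasForest s (linked (baseEdges P Q)) →
    Runs greedy (C * work m) s fun s' => ∃ T : Finset (Fin m),
      IsGreedy (baseEdges P Q) (stepEdge P) (fun k => (S.symm k : ℕ)) T ∧
      ∀ k : Fin m, s'.arr arrMark k = if k ∈ T then 1 else 0 := by
  refine ⟨20 + ((linkRoots.bound + 40) + 10) + 16, fun {m s P Q S} hM hP hS h0 => ?_⟩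
  classical
  let T : Finset (Fin m) := Finset.univ.filter fun k =>
    ¬ conn (baseEdges P Q) (stepEdge P) {k' | (S.symm k' : ℕ) < S.symm k}
      (stepEdge P k).1 (stepEdge P k).2
  have hT : IsGreedy (baseEdges P Q) (stepEdge P) (fun k => (S.symm k : ℕ)) T := fun k => by
    simp [T]
  refine (Runs.forUp_work (N := m) (m := m) (K := 20 + ((linkRoots.bound + 40) + 10))
    (Inv := fun i s' =>
      HasForest s' (conn (baseEdges P Q) (stepEdge P) {k | (S.symm k : ℕ) < i}) ∧
      ∀ k : Fin m, (S.symm k : ℕ) < i → s'.arr arrMark k = if k ∈ T then 1 else 0)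
    (by omega) hM (by decide) (by decide) ⟨?_, fun k hk => absurd hk (Nat.not_lt_zero _)⟩
    fun i s' hi hsi hF ⟨hI, hI'⟩ => ?_).mono le_rfl
    fun s' _ h => ⟨T, hT, fun k => h.2 k (Fin.is_lt _)⟩
  · have := h0.congr (s' := s.setVar vK 0) rfl rfl
    simpa [conn] using this
  · have hlg := one_le_lg m
    rw [add_mul, add_mul (linkRoots.bound + 40)]
    set k := S ⟨i, hi⟩ with hk
    refine Runs.seq ((Runs.of_wp (Q := fun s' => s'.var vU = (k : ℕ) ∧
      s'.var vX = (P k.castSucc : ℕ) ∧ s'.var vY = (P k.succ : ℕ)) ?_).mono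
      (k' := 20 * lg m) ?_ fun _ _ h => h) fun s₁ hf₁ ⟨h1, h2, h3⟩ => Runs.seq
      (unite_spec (R := conn (baseEdges P Q) (stepEdge P) {k | (S.symm k : ℕ) < i}) ?_ h2 h3)
      fun s₂ hf₂ ⟨g1, g2⟩ => (Runs.of_wp ?_).mono ?_ fun _ _ h => h
    · have e1 : s'.arr arrP = s.arr arrP := hF.arr _ (by decide)
      have e2 : s'.arr arrS = s.arr arrS := hF.arr _ (by decide)
      have e3 : s.arr arrS i = (k : ℕ) := hS ⟨i, hi⟩
      have e4 : s.arr arrP (k : ℕ) = (P k.castSucc : ℕ) := hP k.castSucc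
      have e5 : s.arr arrP ((k : ℕ) + 1) = (P k.succ : ℕ) := by rw [← hP]; simp
      simp [Cmd.wp, Expr.eval, e1, e2, e3, e4, e5, hsi]
    · simp [Cmd.bound, Expr.cost]
      omega
    · exact hI.congr (hf₁.arr _ (by decide)) (hf₁.arr _ (by decide))
    · have hset : {r : Fin m | (S.symm r : ℕ) < i + 1} = insert k {r | (S.symm r : ℕ) < i} := by
        ext r
        have : r = k ↔ (S.symm r : ℕ) = i := by
          rw [hk, ← Equiv.symm_apply_eq, Fin.ext_iff]
        simp only [Set.mem_ofPred_eq, Set.mem_insert_iff, this]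
        omega
      have hconn : conn (baseEdges P Q) (stepEdge P) {r | (S.symm r : ℕ) < i + 1} =
          mergeClasses (conn (baseEdges P Q) (stepEdge P) {r | (S.symm r : ℕ) < i})
            (P k.castSucc) (P k.succ) := by
        rw [hset]
        ext x y
        exact conn_insert
      have hU : s₂.var vU = (k : ℕ) := by rw [hf₂.var _ (by decide), h1]
      have hmark : s₂.arr arrMark = s'.arr arrMark := by
        rw [hf₂.arr _ (by decide), hf₁.arr _ (by decide)]
      have hkT : k ∈ T ↔ ¬ conn (baseEdges P Q) (stepEdge P) {r | (S.symm r : ℕ) < i}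
          (P k.castSucc) (P k.succ) := by
        have hpos : (S.symm k : ℕ) = i := by simp [hk]
        have h : k ∈ T ↔ ¬ conn (baseEdges P Q) (stepEdge P)
          {r | (S.symm r : ℕ) < (S.symm k : ℕ)} (P k.castSucc) (P k.succ) := hT k
        rwa [hpos] at h
      refine ⟨?_, fun r hr => ?_⟩
      · rw [hconn]
        exact g1.congr (by simp) (by simp)
      · by_cases hrk : r = k
        · rw [hrk]
          rcases g2 with ⟨g2, g3⟩ | ⟨g2, g3⟩
          · rw [if_neg (fun h => hkT.1 h g2)]
            simp [Expr.eval, hU, g3]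
          · rw [if_pos (hkT.2 g2)]
            simp [Expr.eval, hU, g3]
        · have hne : ((r : ℕ) : ℤ) ≠ (k : ℕ) := fun h => hrk (Fin.ext (by exact_mod_cast h))
          have hri : (S.symm r : ℕ) < i := by
            have : r ∈ insert k {r | (S.symm r : ℕ) < i} := hset ▸ hr
            exact this.resolve_left hrk
          simp [Expr.eval, hU, hmark, hne, hI' r hri]
    · simp [Cmd.bound, Expr.cost]
      omega

/-! #### The interchanges -/

/-- Interchange the entries `vU` and `vU + 1` of the assignment. -/
def interchange : Cmd :=
  .seq (.assign vV (.get arrE (.var vU)))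
  (.seq (.store arrE (.var vU) (.get arrE (.add (.var vU) (.const 1))))
    (.store arrE (.add (.var vU) (.const 1)) (.var vV)))

/-- Whether the entry `vU` is to be interchanged with the next one. -/
def markTest : Test := .eq (.get arrMark (.var vU)) (.const 1)

/-- Whether the first operation assigned to the entry `vU` is not the shorter one. -/
def longTest : Test := .le (.get arrB (.get arrP (.var vU))) (.get arrA (.get arrQ (.var vU)))

theorem interchange_wp {k : Fin m} {ψ : Equiv.Perm (Fin (m + 1))} (hk : s.var vU = (k : ℕ))
    (hE : ∀ r : Fin (m + 1), s.arr arrE r = (Q (ψ r) : ℕ)) :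
    interchange.wp (fun s' => ∀ r : Fin (m + 1),
      s'.arr arrE r = (Q ((ψ * Equiv.swap k.castSucc k.succ) r) : ℕ)) s := by
  have h0 : s.arr arrE (k : ℕ) = (Q (ψ k.castSucc) : ℕ) := hE k.castSucc
  have h1 : s.arr arrE ((k : ℕ) + 1) = (Q (ψ k.succ) : ℕ) := by rw [← hE]; simp
  intro r
  by_cases hr : r = k.castSucc
  · subst hr
    simp [Expr.eval, hk, h1]
  by_cases hr' : r = k.succ
  · subst hr'
    simp [Expr.eval, hk, h0]
  · rw [Equiv.Perm.mul_apply, Equiv.swap_apply_of_ne_of_ne hr hr']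
    have e1 : ((r : ℕ) : ℤ) ≠ (k : ℕ) := fun h => hr (Fin.ext (by simpa using h))
    have e2 : ((r : ℕ) : ℤ) ≠ (k : ℕ) + 1 := fun h => hr' (Fin.ext (by
      rw [Fin.val_succ]; exact_mod_cast h))
    simp [Expr.eval, hk, e1, e2, hE]

/-- Start with the optimal assignment. -/
def initAssignment : Cmd := .forUp vK vNodes (.store arrE (.var vK) (.get arrQ (.var vK)))

/-- Carry out the interchanges of the first kind, from top to bottom. -/
def interchangeDown : Cmd :=
  .forUp vK vJobs (.seq (.assign vU (.sub (.sub (.var vJobs) (.const 1)) (.var vK)))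
    (.cond (.and markTest longTest) interchange .skip))

/-- Carry out the interchanges of the second kind, from bottom to top. -/
def interchangeUp : Cmd :=
  .forUp vK vJobs (.seq (.assign vU (.var vK))
    (.cond (.and markTest (.not longTest)) interchange .skip))

theorem initAssignment_spec : ∃ C, ∀ {m : ℕ} {s : State} {Q : Equiv.Perm (Fin (m + 1))},
    s.var vNodes = (m + 1 : ℕ) → (∀ r : Fin (m + 1), s.arr arrQ r = (Q r : ℕ)) →
    Runs initAssignment (C * work m) s fun s' =>
      ∀ r : Fin (m + 1), s'.arr arrE r = (Q r : ℕ) := by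
  refine ⟨_, fun {m s Q} hN hQ => (Runs.forUp_work (N := m + 1) (m := m) (Inv := fun i s' =>
    ∀ r : Fin (m + 1), (r : ℕ) < i → s'.arr arrE r = (Q r : ℕ))
    le_rfl hN (by decide) (by decide) (fun k hk => absurd hk (Nat.not_lt_zero _))
    fun i s' hi hsi hF hI => Runs.of_wp_lg m fun x hx => ?_).mono le_rfl fun s' _ h x => h x x.2⟩
  have e1 : s'.arr arrQ = s.arr arrQ := hF.arr _ (by decide)
  by_cases hxi : (x : ℕ) = i
  · have e2 : s.arr arrQ i = (Q x : ℕ) := by rw [← hQ, hxi]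
    simp [Expr.eval, hsi, hxi, e1, e2]
  · have h1 : ((x : ℕ) : ℤ) ≠ i := by omega
    simp [Expr.eval, hsi, h1, hI x (by omega)]

section Phases

variable {T : Finset (Fin m)}

/-- Common to both phases: `p` says that the edge is of the kind treated in the phase, and `D`, `D'`
are the interchanges made before and after. Independence of `T` guarantees that the interchange
joins two cycles. -/
theorem interchange_step {pos : Fin m → ℕ}
    (hT : IsGreedy (baseEdges P Q) (stepEdge P) pos T) (hpos : Function.Injective pos)
    (hB : Monotone (b ∘ P)) {D D' : Finset (Fin m)} (hDT : D ⊆ T) {k : Fin m}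
    (hk : s.var vU = (k : ℕ)) {t : Test} {p : Prop} (ht : t.Holds s ↔ p)
    (hmark : s.arr arrMark k = if k ∈ T then 1 else 0)
    (hkD : p → k ∉ D) (hD : k ∈ T ∧ p → D' = insert k D)
    (hD' : ¬ (k ∈ T ∧ p) → D' = D)
    (hlow : p → b (P k.castSucc) < a (Q k.castSucc) → ∀ k' ∈ D, k'.succ ≠ k.castSucc)
    (hupp : p → a (Q k.succ) < b (P k.succ) → ∀ k' ∈ D, k'.castSucc ≠ k.succ)
    (h : ∃ ψ, Interchanged a b P Q D ψ ∧ ∀ r : Fin (m + 1), s.arr arrE r = (Q (ψ r) : ℕ)) :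
    Cmd.wp (.cond (.and markTest t) interchange .skip) (fun s' =>
      ∃ ψ, Interchanged a b P Q D' ψ ∧ ∀ r : Fin (m + 1), s'.arr arrE r = (Q (ψ r) : ℕ)) s := by
  obtain ⟨ψ, hψ, hE⟩ := h
  have hkT : markTest.Holds s ↔ k ∈ T := by
    by_cases hkT : k ∈ T <;> simp [markTest, Expr.eval, hk, hmark, hkT]
  simp only [Cmd.wp, Test.Holds, hkT, ht]
  refine ⟨fun hc => ?_, fun hc => ?_⟩
  · rw [hD hc]
    have hind := hT.independent hpos hc.1
    have hst := hψ.step hB (hkD hc.2) (fun hcon => hind (conn_mono (fun k' hk' =>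
      show k' ∈ T ∧ k' ≠ k from ⟨hDT hk', fun h => hkD hc.2 (h ▸ hk')⟩) hcon))
      (hlow hc.2) (hupp hc.2)
    exact ⟨_, hst, interchange_wp hk hE⟩
  · rw [hD' hc]
    exact ⟨ψ, hψ, hE⟩

end Phases

end ExactDelay

namespace ExactDelay

/-! ### The two phases of interchanges -/

section Phases

open Classical in
/-- The interchanges of the first kind among those in `T`. -/
noncomputable def longEdges {m : ℕ} (a b : Fin (m + 1) → ℤ) (P Q : Equiv.Perm (Fin (m + 1)))
    (T : Finset (Fin m)) : Finset (Fin m) :=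
  T.filter fun k => b (P k.castSucc) ≤ a (Q k.castSucc)

theorem longTest_holds {m : ℕ} {s : State} {a b : Fin (m + 1) → ℤ}
    {P Q : Equiv.Perm (Fin (m + 1))} {k : Fin m} (hk : s.var vU = (k : ℕ))
    (ha : ∀ x : Fin (m + 1), s.arr arrA x = a x) (hb : ∀ x : Fin (m + 1), s.arr arrB x = b x)
    (hP : ∀ r : Fin (m + 1), s.arr arrP r = (P r : ℕ))
    (hQ : ∀ r : Fin (m + 1), s.arr arrQ r = (Q r : ℕ)) :
    longTest.Holds s ↔ b (P k.castSucc) ≤ a (Q k.castSucc) := by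
  have hP0 : s.arr arrP (k : ℕ) = (P k.castSucc : ℕ) := hP k.castSucc
  have hQ0 : s.arr arrQ (k : ℕ) = (Q k.castSucc : ℕ) := hQ k.castSucc
  simp [longTest, Test.Holds, Expr.eval, hk, hP0, hQ0, ha, hb]

/-- Going down, the neighbouring interchange below has not been made yet, which gives `hlow`. For
`hupp`, a neighbouring interchange of the first kind above would have `b ≤ a` at the shared
position. -/
theorem interchangeDown_spec : ∃ C, ∀ {m : ℕ} {s : State} {a b : Fin (m + 1) → ℤ}
    {P Q : Equiv.Perm (Fin (m + 1))} {T : Finset (Fin m)} {pos : Fin m → ℕ},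
    s.var vJobs = m → (∀ x : Fin (m + 1), s.arr arrA x = a x) →
    (∀ x : Fin (m + 1), s.arr arrB x = b x) →
    (∀ r : Fin (m + 1), s.arr arrP r = (P r : ℕ)) →
    (∀ r : Fin (m + 1), s.arr arrQ r = (Q r : ℕ)) → Monotone (b ∘ P) →
    IsGreedy (baseEdges P Q) (stepEdge P) pos T → Function.Injective pos →
    (∀ k : Fin m, s.arr arrMark k = if k ∈ T then 1 else 0) →
    (∀ r : Fin (m + 1), s.arr arrE r = (Q r : ℕ)) →
    Runs interchangeDown (C * work m) s fun s' =>
      ∃ ψ, Interchanged a b P Q (longEdges a b P Q T) ψ ∧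
        ∀ r : Fin (m + 1), s'.arr arrE r = (Q (ψ r) : ℕ) := by
  classical
  refine ⟨_, fun {m s a b P Q T pos} hM ha hb hP hQ hB hT hpos hmark hE =>
    (Runs.forUp_work (N := m) (m := m) (Inv := fun i s' => ∃ ψ,
      Interchanged a b P Q ((longEdges a b P Q T).filter fun k => m ≤ (k : ℕ) + i) ψ ∧
        ∀ r : Fin (m + 1), s'.arr arrE r = (Q (ψ r) : ℕ)) (by omega) hM (by decide) (by decide) ?_
      fun i s' hi hsi hF hI => Runs.of_wp_lg m ?_).mono le_rfl fun s' _ h => ?_⟩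
  · refine ⟨1, ?_, hE⟩
    have : (longEdges a b P Q T).filter (fun k : Fin m => m ≤ (k : ℕ) + 0) = ∅ :=
      Finset.filter_eq_empty_iff.2 fun k _ => by have := k.2; omega
    rw [this]
    exact Interchanged.init a b P Q
  · have hlt : m - 1 - i < m := by omega
    have hu : (Expr.sub (.sub (.var vJobs) (.const 1)) (.var vK)).eval s' =
        ((⟨m - 1 - i, hlt⟩ : Fin m) : ℕ) := by
      simp only [Expr.eval, hsi]
      rw [hF.var _ (by decide), hM]
      omega
    have key := interchange_step (s := s'.setVar vU ((⟨m - 1 - i, hlt⟩ : Fin m) : ℕ))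
      (k := ⟨m - 1 - i, hlt⟩) (a := a) (b := b) (t := longTest)
      (D := (longEdges a b P Q T).filter fun k => m ≤ (k : ℕ) + i)
      (D' := (longEdges a b P Q T).filter fun k => m ≤ (k : ℕ) + (i + 1)) hT hpos hB
      ?_ (by simp)
      (longTest_holds (k := ⟨m - 1 - i, hlt⟩) (by simp) (a := a) (b := b) (P := P) (Q := Q) ?_ ?_ ?_ ?_)
      ?_ ?_ ?_ ?_ ?_ ?_ hI
    · simp only [Cmd.wp, hu]
      exact key
    · exact (Finset.filter_subset _ _).trans (Finset.filter_subset _ _)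
    · rwa [State.setVar_arr, hF.arr _ (by decide)]
    · rwa [State.setVar_arr, hF.arr _ (by decide)]
    · rwa [State.setVar_arr, hF.arr _ (by decide)]
    · rwa [State.setVar_arr, hF.arr _ (by decide)]
    · rw [State.setVar_arr, hF.arr _ (by decide)]
      exact hmark _
    · simp only [Finset.mem_filter, not_and]
      omega
    · intro h
      ext k
      simp only [longEdges, Finset.mem_filter, Finset.mem_insert]
      by_cases hk : k = ⟨m - 1 - i, hlt⟩
      · subst hk
        simp only [true_or, iff_true]
        exact ⟨h, by omega⟩
      · have : (k : ℕ) ≠ m - 1 - i := fun h => hk (Fin.ext h)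
        simp only [hk, false_or]
        refine and_congr_right fun _ => ?_
        omega
    · intro h
      ext k
      simp only [longEdges, Finset.mem_filter]
      refine and_congr_right fun hk' => ?_
      have : (k : ℕ) ≠ m - 1 - i := by
        intro h'
        obtain rfl : k = ⟨m - 1 - i, hlt⟩ := Fin.ext h'
        exact h hk'
      omega
    · rintro - - k' hk' h
      have h1 := congrArg Fin.val h
      have h2 := (Finset.mem_filter.1 hk').2
      simp only [Fin.val_succ, Fin.val_castSucc] at h1
      omega
    · rintro - hlt k' hk' h
      have h2 := (Finset.mem_filter.1 (Finset.mem_filter.1 hk').1).2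
      rw [h] at h2
      exact absurd hlt (not_lt.2 h2)
  · have : (longEdges a b P Q T).filter (fun k : Fin m => m ≤ (k : ℕ) + m) = longEdges a b P Q T :=
      Finset.filter_true_of_mem fun k _ => by omega
    rwa [this] at h

/-- Edges of the second kind have `a < b` at the lower position, so `hlow` is void. If `a < b` at
the upper position too, a neighbouring tree edge above is also of the second kind and, going up, has
not been treated yet. -/
theorem interchangeUp_spec : ∃ C, ∀ {m : ℕ} {s : State} {a b : Fin (m + 1) → ℤ}
    {P Q : Equiv.Perm (Fin (m + 1))} {T : Finset (Fin m)} {pos : Fin m → ℕ},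
    s.var vJobs = m → (∀ x : Fin (m + 1), s.arr arrA x = a x) →
    (∀ x : Fin (m + 1), s.arr arrB x = b x) →
    (∀ r : Fin (m + 1), s.arr arrP r = (P r : ℕ)) →
    (∀ r : Fin (m + 1), s.arr arrQ r = (Q r : ℕ)) → Monotone (b ∘ P) →
    IsGreedy (baseEdges P Q) (stepEdge P) pos T → Function.Injective pos →
    (∀ k : Fin m, s.arr arrMark k = if k ∈ T then 1 else 0) →
    (∃ ψ, Interchanged a b P Q (longEdges a b P Q T) ψ ∧
      ∀ r : Fin (m + 1), s.arr arrE r = (Q (ψ r) : ℕ)) →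
    Runs interchangeUp (C * work m) s fun s' =>
      ∃ ψ, Interchanged a b P Q T ψ ∧ ∀ r : Fin (m + 1), s'.arr arrE r = (Q (ψ r) : ℕ) := by
  classical
  refine ⟨_, fun {m s a b P Q T pos} hM ha hb hP hQ hB hT hpos hmark hE =>
    (Runs.forUp_work (N := m) (m := m) (Inv := fun i s' => ∃ ψ,
      Interchanged a b P Q (T.filter fun k => k ∈ longEdges a b P Q T ∨ (k : ℕ) < i) ψ ∧
        ∀ r : Fin (m + 1), s'.arr arrE r = (Q (ψ r) : ℕ)) (by omega) hM (by decide) (by decide) ?_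
      fun i s' hi hsi hF hI => Runs.of_wp_lg m ?_).mono le_rfl fun s' _ h => ?_⟩
  · have : T.filter (fun k : Fin m => k ∈ longEdges a b P Q T ∨ (k : ℕ) < 0) =
        longEdges a b P Q T := by
      ext k
      simp only [longEdges, Finset.mem_filter, Nat.not_lt_zero, or_false]
      tauto
    rw [this]
    exact hE
  · have hu : (Expr.var vK).eval s' = ((⟨i, hi⟩ : Fin m) : ℕ) := hsi
    have key := interchange_step (s := s'.setVar vU ((⟨i, hi⟩ : Fin m) : ℕ))
      (k := ⟨i, hi⟩) (a := a) (b := b) (t := .not longTest)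
      (D := T.filter fun k => k ∈ longEdges a b P Q T ∨ (k : ℕ) < i)
      (D' := T.filter fun k => k ∈ longEdges a b P Q T ∨ (k : ℕ) < i + 1) hT hpos hB
      (Finset.filter_subset _ _) (by simp)
      (not_congr (longTest_holds (k := ⟨i, hi⟩) (by simp) (a := a) (b := b) (P := P) (Q := Q)
        ?_ ?_ ?_ ?_))
      ?_
    · simp only [Cmd.wp, hu]
      refine key (fun hlong => ?_) ?_ ?_ ?_ ?_ hI
      · simp only [longEdges, Finset.mem_filter, hlong]
        simp
      · intro h
        ext k
        simp only [Finset.mem_filter, Finset.mem_insert]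
        by_cases hk : k = ⟨i, hi⟩
        · subst hk
          simp [h.1]
        · have : (k : ℕ) ≠ i := fun h => hk (Fin.ext h)
          simp only [hk, false_or]
          refine and_congr_right fun _ => or_congr_right ?_
          omega
      · intro h
        ext k
        simp only [Finset.mem_filter]
        refine and_congr_right fun hk => ?_
        by_cases hki : (k : ℕ) = i
        · obtain rfl : k = ⟨i, hi⟩ := Fin.ext hki
          have hlong : ⟨i, hi⟩ ∈ longEdges a b P Q T :=
            Finset.mem_filter.2 ⟨hk, not_not.1 fun h' => h ⟨hk, h'⟩⟩
          exact ⟨fun _ => Or.inl hlong, fun _ => Or.inl hlong⟩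
        · refine or_congr_right ?_
          omega
      · intro h1 h2
        exact absurd h2.le h1
      · rintro - hlt k' hk' h
        have h1 := congrArg Fin.val h
        simp only [Fin.val_succ, Fin.val_castSucc] at h1
        rcases (Finset.mem_filter.1 hk').2 with h2 | h2
        · have h3 := (Finset.mem_filter.1 h2).2
          rw [h] at h3
          exact absurd hlt (not_lt.2 h3)
        · omega
    · rwa [State.setVar_arr, hF.arr _ (by decide)]
    · rwa [State.setVar_arr, hF.arr _ (by decide)]
    · rwa [State.setVar_arr, hF.arr _ (by decide)]
    · rwa [State.setVar_arr, hF.arr _ (by decide)]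
    · rw [State.setVar_arr, hF.arr _ (by decide)]
      exact hmark _
  · have : T.filter (fun k : Fin m => k ∈ longEdges a b P Q T ∨ (k : ℕ) < m) = T :=
      Finset.filter_true_of_mem fun k _ => Or.inr k.2
    rwa [this] at h

end Phases

/-! #### The tour -/

/-- Compute the successors of the nodes. -/
def buildNext : Cmd :=
  .forUp vK vNodes (.store arrNext (.get arrP (.var vK)) (.get arrE (.var vK)))

theorem buildNext_spec : ∃ C, ∀ {m : ℕ} {s : State} {P Q ψ : Equiv.Perm (Fin (m + 1))},
    s.var vNodes = (m + 1 : ℕ) → (∀ r : Fin (m + 1), s.arr arrP r = (P r : ℕ)) →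
    (∀ r : Fin (m + 1), s.arr arrE r = (Q (ψ r) : ℕ)) →
    Runs buildNext (C * work m) s fun s' =>
      ∀ x : Fin (m + 1), s'.arr arrNext x = ((Q * ψ * P⁻¹) x : ℕ) := by
  refine ⟨_, fun {m s P Q ψ} hN hP hE => (Runs.forUp_work (N := m + 1) (m := m) (Inv := fun i s' =>
    ∀ r : Fin (m + 1), (r : ℕ) < i → s'.arr arrNext (P r : ℕ) = (Q (ψ r) : ℕ))
    le_rfl hN (by decide) (by decide) (fun k hk => absurd hk (Nat.not_lt_zero _))
    fun i s' hi hsi hF hI => Runs.of_wp_lg m fun x hx => ?_).mono le_rfl fun s' _ h x => ?_⟩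
  · have e1 : s'.arr arrP = s.arr arrP := hF.arr _ (by decide)
    have e2 : s'.arr arrE = s.arr arrE := hF.arr _ (by decide)
    have e3 : s.arr arrP i = (P ⟨i, hi⟩ : ℕ) := hP ⟨i, hi⟩
    have e4 : s.arr arrE i = (Q (ψ ⟨i, hi⟩) : ℕ) := hE ⟨i, hi⟩
    by_cases hxi : x = ⟨i, hi⟩
    · subst hxi
      simp [Expr.eval, hsi, e1, e2, e3, e4]
    · have h1 : ((P x : ℕ) : ℤ) ≠ (P ⟨i, hi⟩ : ℕ) := fun h =>
        hxi (P.injective (Fin.ext (by exact_mod_cast h)))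
      have h2 : (x : ℕ) ≠ i := fun h => hxi (Fin.ext h)
      simp [Expr.eval, hsi, e1, e3, h1, hI x (by omega)]
  · obtain ⟨r, rfl⟩ := P.surjective x
    rw [h r r.2]
    simp

/-- Proceed to the next node of the tour and fix the times of its job. -/
def visit : Cmd :=
  .seq (.assign vU (.get arrB (.var vCur)))
  (.seq (.assign vCur (.get arrNext (.var vCur)))
  (.seq (.cond (.le (.get arrA (.var vCur)) (.var vU))
    (.assign vPass (.add (.var vPass) (.var vU)))
    (.assign vPass (.add (.var vPass) (.get arrA (.var vCur)))))
  (.seq (.store 3 (.get arrJob (.var vCur)) (.sub (.var vPass) (.get arrA (.var vCur))))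
  (.seq (.store 4 (.get arrJob (.var vCur))
      (.add (.var vPass) (.get 1 (.get arrJob (.var vCur)))))
    (.assign vTime (.add (.get 4 (.get arrJob (.var vCur))) (.get arrB (.var vCur))))))))

theorem visit_wp {m : ℕ} {s : State} {a b : Fin (m + 1) → ℤ} {x y : Fin (m + 1)} {c j l : ℤ}
    (ha : ∀ x : Fin (m + 1), s.arr arrA x = a x) (hb : ∀ x : Fin (m + 1), s.arr arrB x = b x)
    (hx : s.var vCur = (x : ℕ)) (hy : s.arr arrNext x = (y : ℕ)) (hc : s.var vPass = c)
    (hj : s.arr arrJob y = j) (hl : s.arr 1 j = l) :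
    visit.wp (fun s' => s'.var vCur = (y : ℕ) ∧ s'.var vPass = c + max (b x) (a y) ∧
      s'.arr 3 = Function.update (s.arr 3) j (c + max (b x) (a y) - a y) ∧
      s'.arr 4 = Function.update (s.arr 4) j (c + max (b x) (a y) + l) ∧
      s'.var vTime = c + max (b x) (a y) + l + b y) s := by
  simp only [visit, Cmd.wp, Test.Holds, Expr.eval, State.setVar_var, State.setVar_arr,
    State.setArr_arr, State.setArr_var, hx, hb, hc]
  simp only [Nat.reduceEqDiff, if_false, if_true, hy, ha, hb, hj, hl,
    Function.update_self]
  refine ⟨fun h => ?_, fun h => ?_⟩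
  · rw [max_eq_left h]
    simp
  · rw [max_eq_right (not_le.1 h).le]
    simp

/-- Traverse the tour. -/
def traverse : Cmd :=
  .seq (.seq (.assign vPass (.var vTime)) (.assign vCur (.const 0))) (.forUp vK vJobs visit)

/-- The nodes `(π ^ k) 0` with `1 ≤ k ≤ m` are distinct and different from `0`, so each visit writes
the times of a new job. At the end `vTime` holds the completion time of the last job, or its old
value if there are no jobs. -/
theorem traverse_spec : ∃ C, ∀ {m : ℕ} {s : State} {a b : Fin (m + 1) → ℤ}
    {π : Equiv.Perm (Fin (m + 1))} {J : Fin m → ℕ} {L : ℕ}, s.var vJobs = m →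
    (∀ x : Fin (m + 1), s.arr arrA x = a x) → (∀ x : Fin (m + 1), s.arr arrB x = b x) →
    (∀ x : Fin (m + 1), s.arr arrNext x = (π x : ℕ)) → (∀ x y, π.SameCycle x y) →
    Function.Injective J → (∀ i : Fin m, s.arr arrJob (i.succ : ℕ) = J i) →
    (∀ i : Fin m, s.arr 1 (J i) = L) →
    Runs traverse (C * work m) s fun s' =>
      (∀ (i : Fin m) (k : ℕ), k ≤ m → (π ^ k) 0 = i.succ →
        s'.arr 3 (J i) = passTime a b π (s.var vTime) k - a i.succ ∧
        s'.arr 4 (J i) = passTime a b π (s.var vTime) k + L) ∧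
      (∀ z : ℤ, (∀ i, z ≠ J i) → s'.arr 3 z = s.arr 3 z ∧ s'.arr 4 z = s.arr 4 z) ∧
      (m = 0 → s'.var vTime = s.var vTime) ∧
      (m ≠ 0 → s'.var vTime =
        passTime a b π (s.var vTime) m + L + b ((π ^ m) 0)) := by
  refine ⟨_, fun {m s a b π J L} hM ha hb hX hπ hJ hJ' hL => Runs.seq_work (Runs.of_wp_work m
    (Q := fun s' => s'.var vPass = s.var vTime ∧ s'.var vCur = ((0 : Fin (m + 1)) : ℕ)) ?_)
    fun s₁ hf₁ ⟨h1, h2⟩ => (Runs.forUp_work (N := m) (m := m) (K := visit.bound) (Inv := fun n s' =>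
      s'.var vCur = ((π ^ n) 0 : ℕ) ∧ s'.var vPass = passTime a b π (s.var vTime) n ∧
      (∀ (i : Fin m) (k : ℕ), k ≤ n → (π ^ k) 0 = i.succ →
        s'.arr 3 (J i) = passTime a b π (s.var vTime) k - a i.succ ∧
        s'.arr 4 (J i) = passTime a b π (s.var vTime) k + L) ∧
      (∀ z : ℤ, (∀ i, z ≠ J i) → s'.arr 3 z = s.arr 3 z ∧ s'.arr 4 z = s.arr 4 z) ∧
      (n = 0 → s'.var vTime = s.var vTime) ∧
      (n ≠ 0 → s'.var vTime =
        passTime a b π (s.var vTime) n + L + b ((π ^ n) 0))) (by omega) ?_ (by decide) (by decide)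
      ⟨by simp [h2], by simp [h1, passTime], ?_, ?_, ?_, fun h => absurd rfl h⟩
      fun n s' hn hsn hF ⟨g1, g2, g3, g4, g5, g6⟩ => ?_).mono le_rfl
    fun s' _ ⟨g1, g2, g3, g4, g5, g6⟩ => ⟨g3, g4, g5, g6⟩⟩
  · simp [Cmd.wp, Expr.eval]
  · rw [hf₁.var _ (by decide), hM]
  · intro i k hk h
    obtain rfl : k = 0 := by omega
    exact absurd h.symm (Fin.succ_ne_zero i)
  · intro z _
    rw [State.setVar_arr, hf₁.arr _ (by decide), hf₁.arr _ (by decide)]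
    exact ⟨rfl, rfl⟩
  · intro _
    simp only [State.setVar_var]
    rw [if_neg (by decide), hf₁.var _ (by decide)]
  · have hpow : π ((π ^ n) 0) = (π ^ (n + 1)) 0 := by
      rw [pow_succ', Equiv.Perm.mul_apply]
    obtain ⟨i, hi⟩ : ∃ i : Fin m, (π ^ (n + 1)) 0 = i.succ := by
      refine ⟨((π ^ (n + 1)) 0).pred fun h0 => ?_, by simp⟩
      have := pow_zero_injOn hπ (show n + 1 ≤ m from hn) (Nat.zero_le m) (h0.trans (by simp))
      omega
    refine (Runs.of_wp_lg m (visit_wp (a := a) (b := b) (x := (π ^ n) 0) (y := i.succ) (j := J i)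
      (l := L) ?_ ?_ g1 ?_ g2 ?_ ?_)).mono le_rfl fun s₂ hf₂ ⟨k1, k2, k3, k4, k5⟩ => ?_
    · rwa [hF.arr _ (by decide), hf₁.arr _ (by decide)]
    · rwa [hF.arr _ (by decide), hf₁.arr _ (by decide)]
    · rw [hF.arr _ (by decide), hf₁.arr _ (by decide), hX, hpow, hi]
    · rw [hF.arr _ (by decide), hf₁.arr _ (by decide), hJ']
    · rw [hF.arr _ (by decide), hf₁.arr _ (by decide), hL]
    have hpass : passTime a b π (s.var vTime) (n + 1) =
        passTime a b π (s.var vTime) n + max (b ((π ^ n) 0)) (a i.succ) := by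
      rw [passTime, hi]
    rw [← hpass] at k2 k3 k4 k5
    refine ⟨by simp [k1, hi], by simp [k2], fun i' k hk hik => ?_, fun z hz => ?_,
      fun h => absurd h (by omega), fun _ => by simp [k5, hi]⟩
    · rw [State.setVar_arr, k3, k4]
      by_cases hkn : k = n + 1
      · subst hkn
        obtain rfl : i' = i := Fin.succ_injective _ (hik.symm.trans hi)
        simp
      · have hne : i' ≠ i := by
          rintro rfl
          exact hkn (pow_zero_injOn hπ (by omega) hn (hik.trans hi.symm))
        have hne' : ((J i' : ℕ) : ℤ) ≠ J i := fun h => hne (hJ (by exact_mod_cast h))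
        rw [Function.update_of_ne hne', Function.update_of_ne hne']
        exact g3 i' k (by omega) hik
    · rw [State.setVar_arr, k3, k4, Function.update_of_ne (hz i), Function.update_of_ne (hz i)]
      exact g4 z hz

end ExactDelay

namespace ExactDelay

/-! ### The algorithm for equal delays -/

/-- Compute an optimal schedule of the collected jobs. -/
def solve : Cmd :=
  .seq sortNodes (.seq sortGaps (.seq initForest (.seq uniteBase (.seq greedy (.seq initAssignment
    (.seq interchangeDown (.seq interchangeUp (.seq buildNext traverse))))))))

/-- The state holds `m` jobs, whose numbers are given by `J`, with common delay `L`. -/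
structure NodeData {m : ℕ} (a b : Fin (m + 1) → ℤ) (J : Fin m → ℕ) (L : ℕ) (s₀ s : State) :
    Prop where
  jobs : s.var vJobs = m
  nodes : s.var vNodes = (m + 1 : ℕ)
  time : s.var vTime = s₀.var vTime
  lenA : ∀ x : Fin (m + 1), s.arr arrA x = a x
  lenB : ∀ x : Fin (m + 1), s.arr arrB x = b x
  job : ∀ i : Fin m, s.arr arrJob (i.succ : ℕ) = J i
  delay : ∀ i : Fin m, s.arr 1 (J i) = L
  out₁ : s.arr 3 = s₀.arr 3
  out₂ : s.arr 4 = s₀.arr 4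

theorem NodeData.of_frame {m : ℕ} {a b : Fin (m + 1) → ℤ} {J : Fin m → ℕ} {L : ℕ}
    {s₀ s s' : State} {c : Cmd} (h : NodeData a b J L s₀ s) (hf : Frame c s s')
    (hv : ∀ x ∈ [vJobs, vNodes, vTime], x ∉ c.vars)
    (ha : ∀ A ∈ [1, 3, 4, arrA, arrB, arrJob], A ∉ c.arrs) : NodeData a b J L s₀ s' := by
  have hv' : ∀ x ∈ [vJobs, vNodes, vTime], s'.var x = s.var x := fun x hx => hf.var x (hv x hx)
  have ha' : ∀ A ∈ [1, 3, 4, arrA, arrB, arrJob], s'.arr A = s.arr A :=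
    fun A hA => hf.arr A (ha A hA)
  simp only [List.mem_cons, List.not_mem_nil, or_false, forall_eq_or_imp, forall_eq] at hv' ha'
  obtain ⟨v1, v2, v3⟩ := hv'
  obtain ⟨a1, a2, a3, a4, a5, a6⟩ := ha'
  refine ⟨?_, ?_, ?_, ?_, ?_, ?_, ?_, ?_, ?_⟩
  · rw [v1, h.jobs]
  · rw [v2, h.nodes]
  · rw [v3, h.time]
  · rw [a4]; exact h.lenA
  · rw [a5]; exact h.lenB
  · rw [a6]; exact h.job
  · rw [a1]; exact h.delay
  · rw [a2, h.out₁]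
  · rw [a3, h.out₂]

/-- The state holds the sorted orders `P` and `Q`. -/
structure OrderData {m : ℕ} (P Q : Equiv.Perm (Fin (m + 1))) (s : State) : Prop where
  ordP : ∀ r : Fin (m + 1), s.arr arrP r = (P r : ℕ)
  ordQ : ∀ r : Fin (m + 1), s.arr arrQ r = (Q r : ℕ)

theorem OrderData.of_frame {m : ℕ} {P Q : Equiv.Perm (Fin (m + 1))}
    {s s' : State} {c : Cmd} (h : OrderData P Q s) (hf : Frame c s s')
    (ha : ∀ A ∈ [arrP, arrQ], A ∉ c.arrs) : OrderData P Q s' := by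
  refine ⟨?_, ?_⟩
  · rw [hf.arr _ (ha _ (by simp))]; exact h.ordP
  · rw [hf.arr _ (ha _ (by simp))]; exact h.ordQ

/-- Here the bounds meet: the interchanges of the greedy tree cost at most its weight above the
optimal assignment, and no tour costs less. As the tree connects everything, a single cycle results.
-/
theorem tour_optimal {m : ℕ} {a b : Fin (m + 1) → ℤ} {P Q ψ : Equiv.Perm (Fin (m + 1))}
    {S : Equiv.Perm (Fin m)} {T : Finset (Fin m)} (hB : Monotone (b ∘ P)) (hA : Monotone (a ∘ Q))
    (hS : ∀ i j, i ≤ j → gapAt (a ∘ Q) (b ∘ P) (S i) ≤ gapAt (a ∘ Q) (b ∘ P) (S j))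
    (hT : IsGreedy (baseEdges P Q) (stepEdge P) (fun k => (S.symm k : ℕ)) T)
    (hψ : Interchanged a b P Q T ψ) :
    (∀ x y, (Q * ψ * P⁻¹).SameCycle x y) ∧
      ∀ π', IsTour π' → tourCost a b (Q * ψ * P⁻¹) ≤ tourCost a b π' := by
  have hpos : Function.Injective fun k => (S.symm k : ℕ) :=
    Fin.val_injective.comp S.symm.injective
  constructor
  · intro x y
    refine (hψ.cycles x y).2 (hT.conn_total (fun x y => ?_) x y)
    obtain ⟨r, rfl⟩ := P.surjective x
    obtain ⟨t, rfl⟩ := P.surjective y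
    rcases le_total r t with h | h
    · exact conn_of_forall_between h fun _ _ _ => Set.mem_univ _
    · exact Setoid.symm' _ (conn_of_forall_between h fun _ _ _ => Set.mem_univ _)
  · intro π' hπ'
    have h1 := tourCost_ge hA hB hT hpos (fun k k' hk => by
      have := hS (S.symm k) (S.symm k') hk
      simpa using this) hπ'
    refine le_trans (le_trans (le_of_eq ?_) hψ.cost) h1
    rw [tourCost, ← Equiv.sum_comp P]
    simp

/-- Nothing is assumed about the arrays outside `NodeData`, so the program may be run again on used
memory for the second part. -/
theorem solve_spec : ∃ C, ∀ {m : ℕ} {s : State} {a b : Fin (m + 1) → ℤ} {J : Fin m → ℕ} {L : ℕ},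
    NodeData a b J L s s → Function.Injective J →
    Runs solve (C * work m) s fun s' => ∃ π : Equiv.Perm (Fin (m + 1)),
      (∀ x y, π.SameCycle x y) ∧ (∀ π', IsTour π' → tourCost a b π ≤ tourCost a b π') ∧
      (∀ (i : Fin m) (k : ℕ), k ≤ m → (π ^ k) 0 = i.succ →
        s'.arr 3 (J i) = passTime a b π (s.var vTime) k - a i.succ ∧
        s'.arr 4 (J i) = passTime a b π (s.var vTime) k + L) ∧
      (∀ z : ℤ, (∀ i, z ≠ J i) → s'.arr 3 z = s.arr 3 z ∧ s'.arr 4 z = s.arr 4 z) ∧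
      (m = 0 → s'.var vTime = s.var vTime) ∧
      (m ≠ 0 → s'.var vTime =
        passTime a b π (s.var vTime) m + L + b ((π ^ m) 0)) := by
  obtain ⟨C₁, h₁⟩ := sortNodes_spec
  obtain ⟨C₂, h₂⟩ := sortGaps_spec
  obtain ⟨C₃, h₃⟩ := initForest_spec
  obtain ⟨C₄, h₄⟩ := uniteBase_spec
  obtain ⟨C₅, h₅⟩ := greedy_spec
  obtain ⟨C₆, h₆⟩ := initAssignment_spec
  obtain ⟨C₇, h₇⟩ := interchangeDown_spec
  obtain ⟨C₈, h₈⟩ := interchangeUp_spec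
  obtain ⟨C₉, h₉⟩ := buildNext_spec
  obtain ⟨C₁₀, h₁₀⟩ := traverse_spec
  refine ⟨C₁ + (C₂ + (C₃ + (C₄ + (C₅ + (C₆ + (C₇ + (C₈ + (C₉ + C₁₀)))))))),
    fun {m s a b J L} hD hJ => ?_⟩
  refine (h₁ hD.nodes hD.lenA hD.lenB).seq_work fun s₁ f₁ ⟨P, Q, hP, hQ, hB, hA⟩ => ?_
  have hD := hD.of_frame f₁ (by decide) (by decide)
  have hO : OrderData P Q s₁ := ⟨hP, hQ⟩
  refine (h₂ hD.jobs hD.lenA hD.lenB hP hQ).seq_work fun s₂ f₂ ⟨S, hS, hS'⟩ => ?_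
  have hD := hD.of_frame f₂ (by decide) (by decide)
  have hO := hO.of_frame f₂ (by decide)
  refine (h₃ hD.nodes).seq_work fun s₃ f₃ hF => ?_
  have hD := hD.of_frame f₃ (by decide) (by decide)
  have hO := hO.of_frame f₃ (by decide)
  rw [← f₃.arr arrS (by decide)] at hS
  refine (h₄ hD.nodes hO.ordP hO.ordQ hF).seq_work fun s₄ f₄ hF => ?_
  have hD := hD.of_frame f₄ (by decide) (by decide)
  have hO := hO.of_frame f₄ (by decide)
  rw [← f₄.arr arrS (by decide)] at hS
  refine (h₅ hD.jobs hO.ordP hS hF).seq_work fun s₅ f₅ ⟨T, hT, hM⟩ => ?_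
  have hD := hD.of_frame f₅ (by decide) (by decide)
  have hO := hO.of_frame f₅ (by decide)
  have hpos : Function.Injective fun k => (S.symm k : ℕ) :=
    Fin.val_injective.comp S.symm.injective
  refine (h₆ hD.nodes hO.ordQ).seq_work fun s₆ f₆ hE => ?_
  have hD := hD.of_frame f₆ (by decide) (by decide)
  have hO := hO.of_frame f₆ (by decide)
  rw [← f₆.arr arrMark (by decide)] at hM
  refine (h₇ hD.jobs hD.lenA hD.lenB hO.ordP hO.ordQ hB hT hpos hM hE).seq_work
    fun s₇ f₇ hE => ?_
  have hD := hD.of_frame f₇ (by decide) (by decide)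
  have hO := hO.of_frame f₇ (by decide)
  rw [← f₇.arr arrMark (by decide)] at hM
  refine (h₈ hD.jobs hD.lenA hD.lenB hO.ordP hO.ordQ hB hT hpos hM hE).seq_work
    fun s₈ f₈ ⟨ψ, hψ, hE⟩ => ?_
  have hD := hD.of_frame f₈ (by decide) (by decide)
  have hO := hO.of_frame f₈ (by decide)
  refine (h₉ hD.nodes hO.ordP hE).seq_work fun s₉ f₉ hX => ?_
  have hD := hD.of_frame f₉ (by decide) (by decide)
  obtain ⟨hπ, hmin⟩ := tour_optimal hB hA hS' hT hψ
  refine (h₁₀ hD.jobs hD.lenA hD.lenB hX hπ hJ hD.job hD.delay).mono le_rfl fun s' _ h => ?_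
  rw [hD.time, hD.out₁, hD.out₂] at h
  exact ⟨_, hπ, hmin, h⟩

/-! ### Collecting the jobs -/

/-- Add job `vK` to the collection if `g` holds. -/
def collectStep (g : Test) : Cmd :=
  .cond g (.seq (.assign vJobs (.add (.var vJobs) (.const 1)))
    (.seq (.store arrJob (.var vJobs) (.var vK))
    (.seq (.store arrA (.var vJobs) (.get 0 (.var vK)))
      (.store arrB (.var vJobs) (.get 2 (.var vK)))))) .skip

/-- Collect the jobs for which `g` holds, after a dummy job. -/
def collect (g : Test) : Cmd :=
  .seq (.seq (.assign vJobs (.const 0)) (.seq (.store arrA (.const 0) (.const 0))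
    (.store arrB (.const 0) (.const 0))))
  (.seq (.forUp vK vCount (collectStep g)) (.assign vNodes (.add (.var vJobs) (.const 1))))

theorem vars_collectStep (g : Test) : (collectStep g).vars = [vJobs] := rfl

theorem arrs_collectStep (g : Test) : (collectStep g).arrs = [arrJob, arrA, arrB] := rfl

theorem vars_collect (g : Test) : (collect g).vars = [vJobs, vK, vJobs, vK, vNodes] := rfl

theorem arrs_collect (g : Test) : (collect g).arrs = [arrA, arrB, arrJob, arrA, arrB] := rfl

theorem arrayOf_val {n : ℕ} (f : Fin n → ℕ) (j : Fin n) : arrayOf f (j : ℕ) = f j := by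
  simp [arrayOf]

/-- The jobs with numbers below `k` that satisfy `p` have been collected. -/
structure Collected {n : ℕ} (I : Instance (Fin n)) (p : Fin n → Prop) (k c : ℕ) (s : State) :
    Prop where
  le : c ≤ k
  jobs : s.var vJobs = c
  zeroA : s.arr arrA 0 = 0
  zeroB : s.arr arrB 0 = 0
  entry : ∀ i < c, ∃ j : Fin n, (j : ℕ) < k ∧ p j ∧ s.arr arrJob (i + 1 : ℕ) = (j : ℕ) ∧
    s.arr arrA (i + 1 : ℕ) = I.a j ∧ s.arr arrB (i + 1 : ℕ) = I.b j
  inj : ∀ i i', i < i' → i' < c → s.arr arrJob (i + 1 : ℕ) ≠ s.arr arrJob (i' + 1 : ℕ)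
  surj : ∀ j : Fin n, (j : ℕ) < k → p j → ∃ i < c, s.arr arrJob (i + 1 : ℕ) = (j : ℕ)

theorem Collected.exists_equiv {n c : ℕ} {I : Instance (Fin n)} {p : Fin n → Prop} {s : State}
    (h : Collected I p n c s) : ∃ J : Fin c ≃ {j : Fin n // p j},
      (∀ i : Fin c, s.arr arrJob (i.succ : ℕ) = ((J i).1 : ℕ)) ∧
      (∀ x : Fin (c + 1), s.arr arrA x = (I.restrict p).nodeA J x) ∧
      (∀ x : Fin (c + 1), s.arr arrB x = (I.restrict p).nodeB J x) := by
  have hent : ∀ i : Fin c, ∃ j : {j : Fin n // p j}, s.arr arrJob (i + 1 : ℕ) = (j.1 : ℕ) ∧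
      s.arr arrA (i + 1 : ℕ) = I.a j ∧ s.arr arrB (i + 1 : ℕ) = I.b j := fun i => by
    obtain ⟨j, -, hp, h1, h2, h3⟩ := h.entry i i.2
    exact ⟨⟨j, hp⟩, h1, h2, h3⟩
  choose f hf hfa hfb using hent
  have hbij : Function.Bijective f := by
    constructor
    · intro i i' he
      have he' : s.arr arrJob (i + 1 : ℕ) = s.arr arrJob (i' + 1 : ℕ) := by
        rw [hf i, hf i', he]
      by_contra hne
      rcases lt_or_gt_of_ne hne with hlt | hlt
      · exact h.inj i i' hlt i'.2 he'
      · exact h.inj i' i hlt i.2 he'.symm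
    · rintro ⟨j, hj⟩
      obtain ⟨i, hi, he⟩ := h.surj j j.2 hj
      have h1 := hf ⟨i, hi⟩
      refine ⟨⟨i, hi⟩, Subtype.ext (Fin.ext ?_)⟩
      have h2 : ((f ⟨i, hi⟩).1 : ℤ) = (j : ℕ) := by rw [← h1, ← he]
      exact_mod_cast h2
  refine ⟨Equiv.ofBijective f hbij, fun i => ?_, fun x => ?_, fun x => ?_⟩
  · rw [Fin.val_succ]; exact hf i
  · cases x using Fin.cases with
    | zero => simpa using h.zeroA
    | succ i => rw [Fin.val_succ]; exact hfa i
  · cases x using Fin.cases with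
    | zero => simpa using h.zeroB
    | succ i => rw [Fin.val_succ]; exact hfb i

/-- The test `g` is evaluated in changing states. It has to express `p` only in those that keep
variable `1`, the first delay, and array `1`, the delays, which collecting never overwrites. -/
theorem collect_spec (g : Test) : ∃ C, ∀ {n : ℕ} {I : Instance (Fin n)} {p : Fin n → Prop}
    {s : State}, s.var vCount = n → s.arr 0 = arrayOf I.a → s.arr 2 = arrayOf I.b →
    (∀ (s' : State) (j : Fin n), s'.var 1 = s.var 1 → s'.arr 1 = s.arr 1 → s'.var vK = (j : ℕ) →
      (g.Holds s' ↔ p j)) →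
    Runs (collect g) (C * work n) s fun s' => ∃ m, m ≤ n ∧
      s'.var vJobs = m ∧ s'.var vNodes = (m + 1 : ℕ) ∧ ∃ J : Fin m ≃ {j : Fin n // p j},
      (∀ i : Fin m, s'.arr arrJob (i.succ : ℕ) = ((J i).1 : ℕ)) ∧
      (∀ x : Fin (m + 1), s'.arr arrA x = (I.restrict p).nodeA J x) ∧
      (∀ x : Fin (m + 1), s'.arr arrB x = (I.restrict p).nodeB J x) := by
  refine ⟨_, fun {n I p s} hn ha hb hg => Runs.seq_work (Runs.of_wp_work n
    (Q := fun s' => s'.var vJobs = 0 ∧ s'.arr arrA 0 = 0 ∧ s'.arr arrB 0 = 0) ?_)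
    fun s₁ f₁ ⟨h1, h2, h3⟩ => Runs.seq_work
    (Runs.forUp_work (N := n) (m := n) (K := (collectStep g).bound)
      (Inv := fun k s' => ∃ c, Collected I p k c s') (by omega) ?_ (by simp [vars_collectStep])
      (by simp [vars_collectStep]) ⟨0, ?_⟩ fun k s' hk hsk hF ⟨c, hc⟩ => Runs.of_wp_lg n ?_)
    fun s₂ f₂ ⟨c, hc⟩ => Runs.of_wp_work n (c := .assign vNodes (.add (.var vJobs) (.const 1))) ?_⟩
  · simp [Cmd.wp, Expr.eval]
  · rw [f₁.var _ (by decide), hn]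
  · exact ⟨le_rfl, by simp [h1], h2, h3, fun i hi => absurd hi (Nat.not_lt_zero _),
      fun i i' _ hi => absurd hi (Nat.not_lt_zero _), fun j hj => absurd hj (Nat.not_lt_zero _)⟩
  · have e1 : s'.var 1 = s.var 1 := by
      rw [hF.var _ (by simp [Cmd.vars_forUp, vars_collectStep]), f₁.var _ (by decide)]
    have e2 : s'.arr 1 = s.arr 1 := by
      rw [hF.arr _ (by simp [Cmd.arrs_forUp, arrs_collectStep]), f₁.arr _ (by decide)]
    have e3 : s'.arr 0 = arrayOf I.a := by
      rw [hF.arr _ (by simp [Cmd.arrs_forUp, arrs_collectStep]), f₁.arr _ (by decide), ha]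
    have e4 : s'.arr 2 = arrayOf I.b := by
      rw [hF.arr _ (by simp [Cmd.arrs_forUp, arrs_collectStep]), f₁.arr _ (by decide), hb]
    have e5 : arrayOf I.a k = I.a ⟨k, hk⟩ := arrayOf_val I.a ⟨k, hk⟩
    have e6 : arrayOf I.b k = I.b ⟨k, hk⟩ := arrayOf_val I.b ⟨k, hk⟩
    have hgk := hg s' ⟨k, hk⟩ e1 e2 hsk
    have hle := hc.le
    refine ⟨fun ht => ⟨c + 1, ?_⟩, fun ht => ⟨c, ?_⟩⟩
    · have h0 : (0 : ℤ) ≠ (c : ℤ) + 1 := by omega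
      have hcell : ∀ (A : ℕ) (v : ℤ) (i : ℕ), i ≠ c →
          Function.update (s'.arr A) ((c : ℤ) + 1) v ((i : ℤ) + 1) = s'.arr A ((i : ℤ) + 1) :=
        fun A v i hi => Function.update_of_ne (by simp [hi]) _ _
      refine ⟨by omega, ?_, ?_, ?_, fun i hi => ?_, fun i i' hi hi' => ?_, fun j hj hp => ?_⟩
      · simp [Expr.eval, hc.jobs]
      · simp [Expr.eval, hc.jobs, Function.update_of_ne h0, hc.zeroA]
      · simp [Expr.eval, hc.jobs, Function.update_of_ne h0, hc.zeroB]
      · by_cases hic : i = c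
        · refine ⟨⟨k, hk⟩, by simp, hgk.1 ht, ?_⟩
          simp [Expr.eval, hc.jobs, hic, hsk, e3, e4, e5, e6]
        · obtain ⟨j, g1, g2, g3, g4, g5⟩ := hc.entry i (by omega)
          push_cast at g3 g4 g5
          refine ⟨j, by omega, g2, ?_⟩
          simp [Expr.eval, hc.jobs, hcell _ _ i hic, g3, g4, g5]
      · by_cases hic : i' = c
        · obtain ⟨j, g1, g2, g3, g4, g5⟩ := hc.entry i (by omega)
          push_cast at g3
          have : i ≠ c := by omega
          simp [Expr.eval, hc.jobs, hcell _ _ i this, hic, hsk, g3]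
          omega
        · have h' := hc.inj i i' hi (by omega)
          push_cast at h'
          have : i ≠ c := by omega
          simp only [Expr.eval, hc.jobs]
          simpa [hcell _ _ i this, hcell _ _ i' hic] using h'
      · by_cases hjk : (j : ℕ) = k
        · refine ⟨c, by omega, ?_⟩
          simp [Expr.eval, hc.jobs, hsk, hjk]
        · obtain ⟨i, hi, he⟩ := hc.surj j (by omega) hp
          push_cast at he
          have : i ≠ c := by omega
          refine ⟨i, by omega, ?_⟩
          simp [Expr.eval, hc.jobs, hcell _ _ i this, he]
    · refine ⟨by omega, by simp [hc.jobs], hc.zeroA, hc.zeroB, fun i hi => ?_, hc.inj,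
        fun j hj hp => ?_⟩
      · obtain ⟨j, g1, g2⟩ := hc.entry i hi
        exact ⟨j, by omega, g2⟩
      · refine hc.surj j ?_ hp
        by_contra hjk
        obtain rfl : j = ⟨k, hk⟩ := Fin.ext (by simp only; omega)
        exact ht (hgk.2 hp)
  · refine ⟨c, hc.le, by simp [hc.jobs], by simp [Expr.eval, hc.jobs], ?_⟩
    obtain ⟨J, hJ⟩ := hc.exists_equiv
    exact ⟨J, by simpa using hJ⟩

/-- Schedule the jobs for which `g` holds optimally, from time `vTime` on, and set `vTime` to the
completion time. -/
def part (g : Test) : Cmd := .seq (collect g) solve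

/-- The schedule begins at the old value of `vTime`, and the output cells of other jobs are left
alone. These two clauses let a second run append its schedule to that of the first. -/
theorem part_spec (g : Test) : ∃ C, ∀ {n : ℕ} {I : Instance (Fin n)} {p : Fin n → Prop} {L : ℕ}
    {s : State}, s.var vCount = n → s.arr 0 = arrayOf I.a → s.arr 1 = arrayOf I.l →
    s.arr 2 = arrayOf I.b → (∀ j, p j → I.l j = L) →
    (∀ (s' : State) (j : Fin n), s'.var 1 = s.var 1 → s'.arr 1 = s.arr 1 → s'.var vK = (j : ℕ) →
      (g.Holds s' ↔ p j)) →
    Runs (part g) (C * work n) s fun s' => ∃ σ : Schedule {j : Fin n // p j},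
      (∀ j, σ.start₁ j = s'.arr 3 (j.1 : ℕ) ∧ σ.start₂ j = s'.arr 4 (j.1 : ℕ)) ∧
      (I.restrict p).Optimal σ ∧
      (Nonempty {j : Fin n // p j} →
        σ.beginTime = s.var vTime ∧ (I.restrict p).endTime σ = s'.var vTime) ∧
      (IsEmpty {j : Fin n // p j} → s'.var vTime = s.var vTime) ∧
      ∀ j : Fin n, ¬ p j →
        s'.arr 3 (j : ℕ) = s.arr 3 (j : ℕ) ∧ s'.arr 4 (j : ℕ) = s.arr 4 (j : ℕ) := by
  obtain ⟨C₁, h₁⟩ := collect_spec g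
  obtain ⟨C₂, h₂⟩ := solve_spec
  refine ⟨C₁ + C₂, fun {n I p L s} hn ha hl hb hL hg => ?_⟩
  refine (h₁ hn ha hb hg).seq_work fun s₁ f₁ ⟨m, hmn, hM, hN, J, hJ, hA, hB⟩ => ?_
  have hD : NodeData ((I.restrict p).nodeA J) ((I.restrict p).nodeB J)
      (fun i => ((J i).1 : ℕ)) L s₁ s₁ := by
    refine ⟨hM, hN, rfl, hA, hB, hJ, fun i => ?_, rfl, rfl⟩
    rw [f₁.arr _ (by simp [arrs_collect]), hl, arrayOf_val, hL _ (J i).2]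
  have hinj : Function.Injective fun i => ((J i).1 : ℕ) :=
    Fin.val_injective.comp (Subtype.val_injective.comp J.injective)
  refine (h₂ hD hinj).mono (Nat.mul_le_mul le_rfl (work_mono hmn))
    fun s' _ ⟨π, hπ, hmin, g1, g2, g3, g4⟩ => ?_
  rw [f₁.var _ (by simp [vars_collect])] at g1 g3 g4
  rw [f₁.arr _ (by simp [arrs_collect]), f₁.arr _ (by simp [arrs_collect])] at g2
  let σ : Schedule {j : Fin n // p j} :=
    ⟨fun j => (s'.arr 3 (j.1 : ℕ) : ℝ), fun j => (s'.arr 4 (j.1 : ℕ) : ℝ)⟩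
  obtain ⟨hopt, hends⟩ := optimal_of_tour (I := I.restrict p) (L := L) (fun j => hL _ j.2) J hπ hmin
    (s.var vTime) (σ := σ) (fun i k hk hik => by
      obtain ⟨e1, e2⟩ := g1 i k hk hik
      constructor
      · simp only [σ, e1, Instance.nodeA_succ]
        push_cast; ring
      · simp only [σ, e2]
        push_cast; ring)
  refine ⟨σ, fun j => ⟨rfl, rfl⟩, hopt, fun hne => ?_, fun hem => ?_, fun j hj => ?_⟩
  · have hm : m ≠ 0 := by
      rintro rfl
      exact (J.symm hne.some).elim0
    obtain ⟨e1, e2⟩ := hends hm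
    refine ⟨e1, e2.trans ?_⟩
    -- The step back to node `0` costs the last `b`, so `vTime` agrees with the end of the schedule.
    rw [g4 hm, passTime, pow_card_zero hπ, Instance.nodeA_zero,
      max_eq_left (Instance.nodeB_nonneg _ _ _)]
    push_cast; ring
  · refine g3 ?_
    by_contra hm
    exact hem.false (J ⟨0, Nat.pos_of_ne_zero hm⟩)
  · refine g2 _ fun i h => hj ?_
    have : j = (J i).1 := Fin.ext (by exact_mod_cast h)
    rw [this]
    exact (J i).2

end ExactDelay

namespace ExactDelay

/-! ### Concatenation -/

section Concat

variable {ι : Type} {I : Instance ι}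

theorem Instance.Feasible.restrict {τ : Schedule ι} (h : I.Feasible τ) (p : ι → Prop) :
    (I.restrict p).Feasible ⟨fun j => τ.start₁ j, fun j => τ.start₂ j⟩ :=
  ⟨fun j => h.delay j, fun i j hij => h.machine₁ i j fun h => hij (Subtype.ext h),
    fun i j hij => h.machine₂ i j fun h => hij (Subtype.ext h)⟩

variable {p : ι → Prop} [DecidablePred p] {σ₁ : Schedule {j // p j}} {σ₂ : Schedule {j // ¬ p j}}

theorem concat_of_pos (j : ι) (h : p j) :
    (I.concat p σ₁ σ₂).start₁ j = σ₁.start₁ ⟨j, h⟩ ∧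
      (I.concat p σ₁ σ₂).start₂ j = σ₁.start₂ ⟨j, h⟩ := by
  simp [Instance.concat, h]

theorem concat_of_neg (j : ι) (h : ¬ p j) :
    (I.concat p σ₁ σ₂).start₁ j =
        σ₂.start₁ ⟨j, h⟩ + ((I.restrict p).endTime σ₁ - σ₂.beginTime) ∧
      (I.concat p σ₁ σ₂).start₂ j =
        σ₂.start₂ ⟨j, h⟩ + ((I.restrict p).endTime σ₁ - σ₂.beginTime) := by
  simp [Instance.concat, h]

variable [Finite ι]

theorem Instance.Feasible.start₁_le {σ : Schedule ι} (h : I.Feasible σ) (j : ι) :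
    σ.start₁ j + I.a j ≤ I.endTime σ := by
  have h1 := I.le_endTime σ j
  rw [h.delay j] at h1
  have : (0 : ℝ) ≤ I.l j := Nat.cast_nonneg _
  have : (0 : ℝ) ≤ I.b j := Nat.cast_nonneg _
  linarith

theorem Instance.Feasible.length_nonneg {σ : Schedule ι} (h : I.Feasible σ) : 0 ≤ I.length σ := by
  rw [Instance.length, sub_nonneg]
  cases isEmpty_or_nonempty ι with
  | inl _ => simp [Schedule.beginTime, Instance.endTime]
  | inr hne =>
    have h1 := h.start₁_le hne.some
    have h2 := σ.beginTime_le hne.some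
    have : (0 : ℝ) ≤ I.a hne.some := Nat.cast_nonneg _
    linarith

/-- Fewer jobs lower the supremum of the completion times and raise the infimum of the starting
times. An empty part has length `0`, whence the need for `length_nonneg`. -/
theorem Instance.Feasible.length_restrict_le {τ : Schedule ι} (h : I.Feasible τ) (p : ι → Prop) :
    (I.restrict p).length ⟨fun j => τ.start₁ j, fun j => τ.start₂ j⟩ ≤ I.length τ := by
  cases isEmpty_or_nonempty {j // p j} with
  | inl _ =>
    refine le_trans (le_of_eq ?_) h.length_nonneg
    simp [Instance.length, Schedule.beginTime, Instance.endTime]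
  | inr _ =>
    exact sub_le_sub (ciSup_le fun j => I.le_endTime τ j) (le_ciInf fun j => τ.beginTime_le j)

/-- On both machines the second part starts only after the whole first part has ended, so conflicts
could occur only within a part. -/
theorem concat_feasible (h₁ : (I.restrict p).Feasible σ₁)
    (h₂ : (I.restrict fun j => ¬ p j).Feasible σ₂) : I.Feasible (I.concat p σ₁ σ₂) := by
  have hmix : ∀ i j, p i → ¬ p j →
      (I.concat p σ₁ σ₂).start₁ i + I.a i ≤ (I.concat p σ₁ σ₂).start₁ j ∧
      (I.concat p σ₁ σ₂).start₂ i + I.b i ≤ (I.concat p σ₁ σ₂).start₂ j := by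
    intro i j hi hj
    rw [(concat_of_pos i hi).1, (concat_of_pos i hi).2, (concat_of_neg j hj).1,
      (concat_of_neg j hj).2, h₂.delay]
    have e1 := h₁.start₁_le ⟨i, hi⟩
    have e2 := (I.restrict p).le_endTime σ₁ ⟨i, hi⟩
    have e3 := σ₂.beginTime_le ⟨j, hj⟩
    have e4 : (0 : ℝ) ≤ (I.restrict fun j => ¬ p j).a ⟨j, hj⟩ := Nat.cast_nonneg _
    have e5 : (0 : ℝ) ≤ (I.restrict fun j => ¬ p j).l ⟨j, hj⟩ := Nat.cast_nonneg _
    simp only [Instance.restrict] at *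
    constructor <;> linarith
  refine ⟨fun j => ?_, fun i j hij => ?_, fun i j hij => ?_⟩
  · by_cases hj : p j
    · rw [(concat_of_pos j hj).1, (concat_of_pos j hj).2]
      exact h₁.delay ⟨j, hj⟩
    · rw [(concat_of_neg j hj).1, (concat_of_neg j hj).2, h₂.delay]
      simp only [Instance.restrict]
      ring
  · by_cases hi : p i <;> by_cases hj : p j
    · rw [(concat_of_pos i hi).1, (concat_of_pos j hj).1]
      exact h₁.machine₁ ⟨i, hi⟩ ⟨j, hj⟩ fun h => hij (congrArg Subtype.val h)
    · exact Or.inl (hmix i j hi hj).1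
    · exact Or.inr (hmix j i hj hi).1
    · rw [(concat_of_neg i hi).1, (concat_of_neg j hj).1]
      have := h₂.machine₁ ⟨i, hi⟩ ⟨j, hj⟩ fun h => hij (congrArg Subtype.val h)
      simp only [Instance.restrict] at this ⊢
      exact this.imp (fun h => by linarith) (fun h => by linarith)
  · by_cases hi : p i <;> by_cases hj : p j
    · rw [(concat_of_pos i hi).2, (concat_of_pos j hj).2]
      exact h₁.machine₂ ⟨i, hi⟩ ⟨j, hj⟩ fun h => hij (congrArg Subtype.val h)
    · exact Or.inl (hmix i j hi hj).2
    · exact Or.inr (hmix j i hj hi).2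
    · rw [(concat_of_neg i hi).2, (concat_of_neg j hj).2]
      have := h₂.machine₂ ⟨i, hi⟩ ⟨j, hj⟩ fun h => hij (congrArg Subtype.val h)
      simp only [Instance.restrict] at this ⊢
      exact this.imp (fun h => by linarith) (fun h => by linarith)

/-- The second part begins where the first ends. The separate bounds for begin and end also cover an
empty part, whose begin and end are `0` by convention. -/
theorem length_concat_le (h₁ : (I.restrict p).Feasible σ₁)
    (h₂ : (I.restrict fun j => ¬ p j).Feasible σ₂) :
    I.length (I.concat p σ₁ σ₂) ≤
      (I.restrict p).length σ₁ + (I.restrict fun j => ¬ p j).length σ₂ := by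
  have l₁ := h₁.length_nonneg
  have l₂ := h₂.length_nonneg
  cases isEmpty_or_nonempty ι with
  | inl _ =>
    refine le_trans (le_of_eq ?_) (add_nonneg l₁ l₂)
    simp [Instance.length, Schedule.beginTime, Instance.endTime]
  | inr _ =>
    have hend : I.endTime (I.concat p σ₁ σ₂) ≤
        (I.restrict p).endTime σ₁ + (I.restrict fun j => ¬ p j).length σ₂ := by
      refine ciSup_le fun j => ?_
      by_cases hj : p j
      · rw [(concat_of_pos j hj).2]
        have := (I.restrict p).le_endTime σ₁ ⟨j, hj⟩
        simp only [Instance.restrict] at *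
        linarith
      · rw [(concat_of_neg j hj).2]
        have := (I.restrict fun j => ¬ p j).le_endTime σ₂ ⟨j, hj⟩
        simp only [Instance.length, Instance.restrict] at *
        linarith
    have hbeg : σ₁.beginTime ≤ (I.concat p σ₁ σ₂).beginTime := by
      refine le_ciInf fun j => ?_
      by_cases hj : p j
      · rw [(concat_of_pos j hj).1]
        exact σ₁.beginTime_le _
      · rw [(concat_of_neg j hj).1]
        have := σ₂.beginTime_le ⟨j, hj⟩
        simp only [Instance.length] at l₁
        linarith
    simp only [Instance.length] at *
    linarith

/-- The restriction of `τ` to either part competes with the optimal schedule of that part, which is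
therefore no longer than `τ`. -/
theorem concatenationOutput_approx {L₁ : ℕ} {σ : Schedule ι} (h : I.ConcatenationOutput L₁ σ) :
    I.Feasible σ ∧ ∀ τ, I.Feasible τ → I.length σ ≤ 2 * I.length τ := by
  obtain ⟨σ₁, σ₂, h₁, h₂, rfl⟩ := h
  refine ⟨concat_feasible h₁.1 h₂.1, fun τ hτ => ?_⟩
  have e1 := length_concat_le h₁.1 h₂.1
  have e2 := (h₁.2 _ (hτ.restrict _)).trans (hτ.length_restrict_le _)
  have e3 := (h₂.2 _ (hτ.restrict _)).trans (hτ.length_restrict_le _)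
  linarith

end Concat

/-! ### The program -/

/-- Whether job `vK` has the first delay. -/
def firstDelay : Test := .eq (.get 1 (.var vK)) (.var 1)

/-- Algorithm Concatenation. -/
def concatenation : Cmd := .seq (part firstDelay) (part (.not firstDelay))

theorem firstDelay_holds {n : ℕ} {I : Instance (Fin n)} {L₁ : ℕ} {s : State} {j : Fin n}
    (h1 : s.var 1 = L₁) (h2 : s.arr 1 = arrayOf I.l) (h3 : s.var vK = (j : ℕ)) :
    firstDelay.Holds s ↔ I.l j = L₁ := by
  simp [firstDelay, Expr.eval, h1, h2, h3, arrayOf_val]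

/-- The second run starts at the end of the first schedule, so the translation in `Instance.concat`
is by zero. -/
theorem concatenation_spec : ∃ C, ∀ (n : ℕ) (I : Instance (Fin n)) (L₁ L₂ : ℕ),
    (∀ j, I.l j = L₁ ∨ I.l j = L₂) →
    Runs concatenation (C * work n) (I.input L₁ L₂) fun s =>
      I.ConcatenationOutput L₁ (s.output n) := by
  obtain ⟨C₁, h₁⟩ := part_spec firstDelay
  obtain ⟨C₂, h₂⟩ := part_spec (.not firstDelay)
  refine ⟨C₁ + C₂, fun n I L₁ L₂ hL => ?_⟩
  refine (h₁ (I := I) (p := fun j => I.l j = L₁) (L := L₁) (s := I.input L₁ L₂) rfl rfl rfl rfl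
    (fun _ h => h) fun s' j e1 e2 e3 => firstDelay_holds e1 e2 e3).seq_work
    fun s₁ f₁ ⟨σ₁, hσ₁, hopt₁, hne₁, hem₁, _⟩ => ?_
  refine (h₂ (I := I) (p := fun j => ¬ I.l j = L₁) (L := L₂) (s := s₁) ?_ ?_ ?_ ?_
    (fun j h => (hL j).resolve_left h) fun s' j e1 e2 e3 => not_congr
      (firstDelay_holds (e1.trans ?_) (e2.trans ?_) e3)).mono le_rfl
    fun s₂ _ ⟨σ₂, hσ₂, hopt₂, hne₂, hem₂, hout⟩ => ?_
  · exact f₁.var _ (by decide)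
  · exact f₁.arr _ (by decide)
  · exact f₁.arr _ (by decide)
  · exact f₁.arr _ (by decide)
  · exact f₁.var _ (by decide)
  · exact f₁.arr _ (by decide)
  -- Without jobs of the first delay, `endTime` is the supremum of an empty family, hence `0`, which
  -- is also the input value of `vTime`.
  have hend : (I.restrict fun j => I.l j = L₁).endTime σ₁ = s₁.var vTime := by
    cases isEmpty_or_nonempty {j // I.l j = L₁} with
    | inl hem =>
      rw [hem₁ hem]
      simp [Instance.endTime, Instance.input]
    | inr hne => exact (hne₁ hne).2
  refine ⟨σ₁, σ₂, hopt₁, hopt₂, ?_⟩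
  have key : ∀ j, (s₂.output n).start₁ j = (I.concat (fun j => I.l j = L₁) σ₁ σ₂).start₁ j ∧
      (s₂.output n).start₂ j = (I.concat (fun j => I.l j = L₁) σ₁ σ₂).start₂ j := by
    intro j
    by_cases hj : I.l j = L₁
    · obtain ⟨e1, e2⟩ := concat_of_pos (I := I) (p := fun j => I.l j = L₁) (σ₁ := σ₁)
        (σ₂ := σ₂) j hj
      obtain ⟨e3, e4⟩ := hσ₁ ⟨j, hj⟩
      obtain ⟨e5, e6⟩ := hout j (not_not.2 hj)
      rw [e1, e2, e3, e4]
      exact ⟨congrArg (Int.cast : ℤ → ℝ) e5, congrArg (Int.cast : ℤ → ℝ) e6⟩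
    · obtain ⟨e1, e2⟩ := concat_of_neg (I := I) (p := fun j => I.l j = L₁) (σ₁ := σ₁)
        (σ₂ := σ₂) j hj
      obtain ⟨e3, e4⟩ := hσ₂ ⟨j, hj⟩
      rw [e1, e2, hend, (hne₂ ⟨⟨j, hj⟩⟩).1, sub_self, add_zero, add_zero, e3, e4]
      exact ⟨rfl, rfl⟩
  have e1 : (s₂.output n).start₁ = (I.concat (fun j => I.l j = L₁) σ₁ σ₂).start₁ :=
    funext fun j => (key j).1
  have e2 : (s₂.output n).start₂ = (I.concat (fun j => I.l j = L₁) σ₁ σ₂).start₂ :=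
    funext fun j => (key j).2
  calc s₂.output n = ⟨(s₂.output n).start₁, (s₂.output n).start₂⟩ := rfl
    _ = _ := by rw [e1, e2]

/-- For `n ≥ 2`, `n + 1 ≤ 2 * n` and `Nat.log 2 n + 2 ≤ 3 * Nat.log 2 n`, whence the factor 6;
division by `Real.log 2` changes the base of the logarithm. -/
theorem isBigO_work (C : ℕ) :
    (fun n : ℕ => ((C * work n : ℕ) : ℝ)) =O[Filter.atTop] (fun n : ℕ => (n : ℝ) * Real.log n) := by
  refine Asymptotics.IsBigO.of_bound (6 * C / Real.log 2) ?_
  filter_upwards [Filter.eventually_ge_atTop 2] with n hn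
  have hlog2 : 0 < Real.log 2 := Real.log_pos (by norm_num)
  have h1 : Nat.log 2 (n + 1) ≤ Nat.log 2 n + 1 := by
    rw [← Nat.log_mul_base (by norm_num) (by omega)]
    exact Nat.log_mono_right (by omega)
  have h2 : 1 ≤ Nat.log 2 n := Nat.log_pos (by norm_num) hn
  have h3 : work n ≤ 6 * (n * Nat.log 2 n) := by
    calc work n ≤ (2 * n) * (3 * Nat.log 2 n) := Nat.mul_le_mul (by omega) (by rw [lg]; omega)
      _ = _ := by ring
  have h4 : (Nat.log 2 n : ℝ) ≤ Real.log n / Real.log 2 := by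
    have := Real.natLog_le_logb n 2
    rwa [Real.logb, Nat.cast_ofNat] at this
  have h5 : 0 ≤ Real.log n := Real.log_natCast_nonneg n
  rw [Real.norm_of_nonneg (Nat.cast_nonneg _), Real.norm_of_nonneg (by positivity)]
  have h6 : (work n : ℝ) ≤ 6 * (n * (Real.log n / Real.log 2)) := by
    calc (work n : ℝ) ≤ 6 * (n * Nat.log 2 n) := by exact_mod_cast h3
      _ ≤ _ := by gcongr
  push_cast
  calc (C : ℝ) * work n ≤ C * (6 * (n * (Real.log n / Real.log 2))) := by gcongr
    _ = _ := by ring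

end ExactDelay

theorem theorem2 :
    -- some program implements Algorithm Concatenation and runs in time `O(n log n)`
    (∃ (prog : ExactDelay.Cmd) (T : ℕ → ℕ),
      (fun n : ℕ => (T n : ℝ)) =O[Filter.atTop] (fun n : ℕ => (n : ℝ) * Real.log n) ∧
      ∀ (n : ℕ) (I : ExactDelay.Instance (Fin n)) (L₁ L₂ : ℕ),
        (∀ j, I.l j = L₁ ∨ I.l j = L₂) →
        ∃ (k : ℕ) (s : ExactDelay.State),
          ExactDelay.Exec prog (I.input L₁ L₂) k s ∧ k ≤ T n ∧
          I.ConcatenationOutput L₁ (s.output n)) ∧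
    -- every output of the algorithm is feasible and within a factor of 2 of the optimum
    (∀ (n : ℕ) (I : ExactDelay.Instance (Fin n)) (L₁ L₂ : ℕ),
      (∀ j, I.l j = L₁ ∨ I.l j = L₂) →
      ∀ σ : ExactDelay.Schedule (Fin n), I.ConcatenationOutput L₁ σ →
        I.Feasible σ ∧
        ∀ τ : ExactDelay.Schedule (Fin n), I.Feasible τ → I.length σ ≤ 2 * I.length τ) := by
  obtain ⟨C, hC⟩ := ExactDelay.concatenation_spec
  exact ⟨⟨ExactDelay.concatenation, fun n => C * ExactDelay.work n, ExactDelay.isBigO_work C,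
    fun n I L₁ L₂ hL => hC n I L₁ L₂ hL⟩,
    fun n I L₁ L₂ _ σ hσ => ExactDelay.concatenationOutput_approx hσ⟩
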